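/- **Setting.** Fix $T\ge 2$. Unit $i$ is described by $\mathcal Z_i=(\mathbf Y_i(1),\mathbf Y_i(0),\mathbf W_i,\mathbf X_i,\mathbf U_i)$ with potential outcomes $\mathbf Y_i(1),\mathbf Y_i(0)\in\mathbb R^T$, an assignment path $\mathbf W_i\in\{0,1\}^T$, and observed and unobserved confounders $\mathbf X_i,\mathbf U_i$; the $\mathcal Z_i$ are i.i.d. All probabilities and expectations are conditional on the confounders $(\mathbf X_i,\mathbf U_i)_{i\le n}$, which are treated as fixed; thus the triples $(\mathbf Y_i(1),\mathbf Y_i(0),\mathbf W_i)$ are independent, with laws given by a common conditional law (a Markov kernel) $\kappa(\mathbf X_i,\mathbf U_i)$. Let $Y^{\rm obs}_{it}=Y_{it}(1)W_{it}+Y_{it}(0)(1-W_{it})$, $\boldsymbol\pi_i(\mathbf w)=\mathbb P[\mathbf W_i=\mathbf w]$, $\tau_{it}=\mathbb E[Y_{it}(1)-Y_{it}(0)]$, $\boldsymbol\tau_i=(\tau_{i1},\dots,\tau_{iT})$, and let $m_{it}$ be the doubly centered (over $i\le n$ and $t\le T$) version of the array $\mathbb E[Y_{it}(0)]$. For weights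 $\xi_t\ge0$, $\sum_t\xi_t=1$, let $\tau^*(\xi)=\sum_t\xi_t\frac1n\sum_{i\le n}\tau_{it}$. For every $n$ let $(\hat{\boldsymbol\pi}_i,\hat{\mathbf m}_i)_{i\le n}$ be estimates with $\hat{\boldsymbol\pi}_i(\mathbf w)\in[0,1]$ and $\hat{\mathbf m}_i\in\mathbb R^T$ that are independent of the data $(\mathbf Y_i(1),\mathbf Y_i(0),\mathbf W_i)_{i\le n}$ (for instance, deterministic). Put $$\delta_{\pi i}=\sqrt{\mathbb E[(\hat{\boldsymbol\pi}_i(\mathbf W_i)-\boldsymbol\pi_i(\mathbf W_i))^2]},\qquad \delta_{yi}=\sqrt{\mathbb E\|\hat{\mathbf m}_i-\mathbf m_i\|_2^2}+\|\boldsymbol\tau_i-\tau^*(\xi)\mathbf 1_T\|_2,$$ $\bar\delta_\pi=\sqrt{\frac1n\sum_i\delta_{\pi i}^2}$ and $\bar\delta_y=\sqrt{\frac1n\sum_i\delta_{yi}^2}$. **Assumptions.** 1. (Latent mean ignorability) $\mathbb E[(\mathbf Y_i(1),\mathbf Y_i(0))\mid\mathbf W_i]=\mathbb E[(\mathbf Y_i(1),\mathbf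 Y_i(0))]$ for all $i$. 2. (Overlap) There are a constant $c>0$ and a fixed set $\mathbb S^*\subset\{0,1\}^T$ with at least two elements, at least one of them not in $\{\mathbf 0_T,\mathbf 1_T\}$, such that almost surely $\hat{\boldsymbol\pi}_i(\mathbf w)>c$ and $\boldsymbol\pi_i(\mathbf w)>c$ for all $\mathbf w\in\mathbb S^*$ and all $i\le n$. 3. (Bounded outcomes) There is $M<\infty$ such that almost surely $|Y_{it}(w)-\hat m_{it}|<M$ for all $i\le n$, $t\le T$ and $w\in\{0,1\}$. 4. $\boldsymbol\Pi$ is a probability mass function on $\{0,1\}^T$ with support $\mathbb S^*$ that solves the DATE equation $$\mathbb E_{\mathbf W\sim\boldsymbol\Pi}\big[(\mathrm{diag}(\mathbf W)-\xi\mathbf W^\top)J(\mathbf W-\mathbb E_{\mathbf W\sim\boldsymbol\Pi}[\mathbf W])\big]=0,\qquad J=I_T-\mathbf 1_T\mathbf 1_T^\top/T.$$ 5. $\bar\delta_\pi\bar\delta_y=o(1/\sqrt n)$. **Estimator and interval.** Let $\Theta_i=\boldsymbol\Pi(\mathbf W_i)/\hat{\boldsymbol\pi}_i(\mathbf W_i)$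 and $\tilde{\mathbf Y}_i=\mathbf Y^{\rm obs}_i-\hat{\mathbf m}_i$, and let $\hat\tau$ be the $\tau$-component of a minimizer of $$\sum_{i\le n}\sum_{t\le T}(\tilde Y_{it}-\mu-\alpha_i-\gamma_t-W_{it}\tau)^2\,\Theta_i\quad\text{over }(\tau,\mu,\alpha,\gamma)\text{ with }\sum_i\alpha_i=\sum_t\gamma_t=0 .$$ Let $\Gamma_\theta=\frac1n\sum_i\Theta_i$, $\Gamma_{ww}=\frac1n\sum_i\Theta_i\mathbf W_i^\top J\mathbf W_i$, $\Gamma_{wy}=\frac1n\sum_i\Theta_i\mathbf W_i^\top J\tilde{\mathbf Y}_i$, $\mathbf\Gamma_w=\frac1n\sum_i\Theta_iJ\mathbf W_i$, $\mathbf\Gamma_y=\frac1n\sum_i\Theta_iJ\tilde{\mathbf Y}_i$, $\mathcal D=\Gamma_{ww}\Gamma_\theta-\mathbf\Gamma_w^\top\mathbf\Gamma_w$, and, with $\tau^*=\tau^*(\xi)$, $$\mathcal V_i=\Theta_i\Big\{(\mathbb E[\Gamma_{wy}]-\tau^*\mathbb E[\Gamma_{ww}])-(\mathbb E[\mathbf\Gamma_y]-\tau^*\mathbb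 E[\mathbf\Gamma_w])^\top J\mathbf W_i+\mathbb E[\Gamma_\theta]\mathbf W_i^\top J(\tilde{\mathbf Y}_i-\tau^*\mathbf W_i)-\mathbb E[\mathbf\Gamma_w]^\top J(\tilde{\mathbf Y}_i-\tau^*\mathbf W_i)\Big\},$$ where, in the definition of $\mathcal V_i$ and in $\mathrm{Var}(\mathcal V_i)$ below, the estimates are held fixed (expectation and variance are conditional on them). Let $\hat{\mathcal V}_i$ be obtained from $\mathcal V_i$ by replacing each expectation by the corresponding $\Gamma$ and $\tau^*$ by $\hat\tau$, let $\hat\sigma^2=\frac1{n-1}\sum_i\big(\hat{\mathcal V}_i-\frac1n\sum_j\hat{\mathcal V}_j\big)^2$, and, with $z_\eta$ the $\eta$-quantile of the standard normal distribution, $$\hat C_{1-\alpha}=\Big[\hat\tau-\frac{z_{1-\alpha/2}\,\hat\sigma}{\sqrt n\,\mathcal D},\ \hat\tau+\frac{z_{1-\alpha/2}\,\hat\sigma}{\sqrt n\,\mathcal D}\Big].$$ **Theorem.** Suppose in addition that there is a constant $\nu_0>0$ such that, for all large $n$, almost surely $\frac1n\sum_{i\le n}\mathrm{Var}(\mathcal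 V_i)\ge\nu_0$. Then for every $\alpha\in(0,1)$, $$\liminf_{n\to\infty}\mathbb P\big(\tau^*(\xi)\in\hat C_{1-\alpha}\big)\ge1-\alpha .$$ -/

import Mathlib

open MeasureTheory ProbabilityTheory Filter Asymptotics
open scoped Matrix

noncomputable section

namespace RIPW

/-- Assignment paths `w ∈ {0,1}^T`. -/
abbrev AssignPath (T : ℕ) : Type := Fin T → Bool

/-- The assignment path as a real vector with entries `0` and `1`. -/
def pathVec {T : ℕ} (w : AssignPath T) : Fin T → ℝ := fun t => if w t then 1 else 0

/-- The data `(Y_i(1), Y_i(0), W_i)` of one unit (potential outcomes and assignment path). -/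
abbrev UnitData (T : ℕ) : Type := (Fin T → ℝ) × (Fin T → ℝ) × AssignPath T

/-- The potential outcomes `Y_i(1)` (`b = true`) and `Y_i(0)` (`b = false`). -/
def potential {T : ℕ} (b : Bool) (z : UnitData T) : Fin T → ℝ := if b then z.1 else z.2.1

/-- The assignment path `W_i`. -/
def assign {T : ℕ} (z : UnitData T) : AssignPath T := z.2.2

/-- The observed outcomes `Y_it = Y_it(1) W_it + Y_it(0) (1 - W_it)`. -/
def observed {T : ℕ} (z : UnitData T) : Fin T → ℝ := fun t =>
  potential true z t * pathVec (assign z) t + potential false z t * (1 - pathVec (assign z) t)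

/-! ### Population quantities, computed from the laws of the units given their confounders -/

/-- The generalized propensity score `π_i(w) = P[W_i = w]`. -/
def propensity {T : ℕ} (ν : Measure (UnitData T)) (w : AssignPath T) : ℝ :=
  ν.real {z | assign z = w}

/-- The treatment effect `τ_it = E[Y_it(1) - Y_it(0)]`. -/
def effect {T : ℕ} (ν : Measure (UnitData T)) (t : Fin T) : ℝ :=
  ∫ z, (potential true z t - potential false z t) ∂ν

/-- The doubly average treatment effect `τ*(ξ) = ∑_t ξ_t (1/n) ∑_i τ_it`. -/
def date {n T : ℕ} (ξ : Fin T → ℝ) (ν : Fin n → Measure (UnitData T)) : ℝ :=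
  ∑ t, ξ t * ((1 / (n : ℝ)) * ∑ i, effect (ν i) t)

/-- The baseline mean `E[Y_it(0)]`. -/
def baseMean {T : ℕ} (ν : Measure (UnitData T)) (t : Fin T) : ℝ :=
  ∫ z, potential false z t ∂ν

/-- `m_it`, the doubly centered version of the array `E[Y_it(0)]`. -/
def centeredMean {n T : ℕ} (ν : Fin n → Measure (UnitData T)) (i : Fin n) (t : Fin T) : ℝ :=
  baseMean (ν i) t - (1 / (n : ℝ)) * ∑ j, baseMean (ν j) t
    - (1 / (T : ℝ)) * ∑ s, baseMean (ν i) s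
    + (1 / ((n : ℝ) * (T : ℝ))) * ∑ j, ∑ s, baseMean (ν j) s

/-- Latent mean ignorability: `E[(Y_i(1), Y_i(0)) | W_i] = E[(Y_i(1), Y_i(0))]` under the law `ν`
of `(Y_i(1), Y_i(0), W_i)` given the confounders of unit `i`. -/
def LatentMeanIgnorable {T : ℕ} (ν : Measure (UnitData T)) : Prop :=
  ∀ (b : Bool) (t : Fin T),
    ν[fun z => potential b z t | MeasurableSpace.comap (assign (T := T)) inferInstance]
      =ᵐ[ν] fun _ => ∫ z, potential b z t ∂ν

/-! ### Reshaped distributions and the DATE equation -/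

/-- `Π` is a probability mass function on `{0,1}^T` with support `S`. -/
structure IsReshaped {T : ℕ} (Pi : AssignPath T → ℝ) (S : Finset (AssignPath T)) : Prop where
  nonneg : ∀ w, 0 ≤ Pi w
  sum_eq_one : ∑ w, Pi w = 1
  support : ∀ w, 0 < Pi w ↔ w ∈ S

/-- `J = I_T - 1 1ᵀ / T`. -/
def centering (T : ℕ) : Matrix (Fin T) (Fin T) ℝ :=
  1 - (1 / (T : ℝ)) • Matrix.of (fun _ _ => (1 : ℝ))

/-- `E_{W ∼ Π}[W]`. -/
def reshapedMean {T : ℕ} (Pi : AssignPath T → ℝ) : Fin T → ℝ := ∑ w, Pi w • pathVec w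

/-- The DATE equation `E_{W ∼ Π}[(diag(W) - ξ Wᵀ) J (W - E_{W ∼ Π}[W])] = 0`. -/
def DateEquation {T : ℕ} (Pi : AssignPath T → ℝ) (ξ : Fin T → ℝ) : Prop :=
  ∑ w, Pi w • ((Matrix.diagonal (pathVec w) - Matrix.vecMulVec ξ (pathVec w)) *ᵥ
    (centering T *ᵥ (pathVec w - reshapedMean Pi))) = 0

/-! ### The estimator and the confidence interval -/

/-- Estimates `(π̂_i, m̂_i)` for one unit. -/
abbrev UnitEst (T : ℕ) : Type := (AssignPath T → ℝ) × (Fin T → ℝ)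

/-- The weight `Θ_i = Π(W_i) / π̂_i(W_i)`. -/
def theta {T : ℕ} (Pi : AssignPath T → ℝ) (e : UnitEst T) (z : UnitData T) : ℝ :=
  Pi (assign z) / e.1 (assign z)

/-- The adjusted outcomes `Y_i^obs - m̂_i`. -/
def adjusted {T : ℕ} (e : UnitEst T) (z : UnitData T) : Fin T → ℝ := observed z - e.2

/-- The weighted two-way fixed effects least squares objective. -/
def loss {n T : ℕ} (Pi : AssignPath T → ℝ) (e : Fin n → UnitEst T) (z : Fin n → UnitData T)
    (τ μ : ℝ) (a : Fin n → ℝ) (g : Fin T → ℝ) : ℝ :=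
  ∑ i, ∑ t, (adjusted (e i) (z i) t - μ - a i - g t - pathVec (assign (z i)) t * τ) ^ 2
    * theta Pi (e i) (z i)

/-- `τ` is the treatment coefficient of a minimizer of the weighted two-way fixed effects
objective over `(τ, μ, a, g)` with `∑ a_i = ∑ g_t = 0`. -/
def IsRIPWEstimate {n T : ℕ} (Pi : AssignPath T → ℝ) (e : Fin n → UnitEst T) (z : Fin n → UnitData T)
    (τ : ℝ) : Prop :=
  ∃ (μ : ℝ) (a : Fin n → ℝ) (g : Fin T → ℝ), ∑ i, a i = 0 ∧ ∑ t, g t = 0 ∧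
    ∀ (τ' μ' : ℝ) (a' : Fin n → ℝ) (g' : Fin T → ℝ), ∑ i, a' i = 0 → ∑ t, g' t = 0 →
      loss Pi e z τ μ a g ≤ loss Pi e z τ' μ' a' g'

/-- `Γ_θ = (1/n) ∑ Θ_i`. -/
def gammaTheta {n T : ℕ} (Pi : AssignPath T → ℝ) (e : Fin n → UnitEst T) (z : Fin n → UnitData T) : ℝ :=
  (1 / (n : ℝ)) * ∑ i, theta Pi (e i) (z i)

/-- `Γ_ww = (1/n) ∑ Θ_i W_iᵀ J W_i`. -/
def gammaWW {n T : ℕ} (Pi : AssignPath T → ℝ) (e : Fin n → UnitEst T) (z : Fin n → UnitData T) : ℝ :=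
  (1 / (n : ℝ)) * ∑ i, theta Pi (e i) (z i) *
    (pathVec (assign (z i)) ⬝ᵥ (centering T *ᵥ pathVec (assign (z i))))

/-- `Γ_wy = (1/n) ∑ Θ_i W_iᵀ J (Y_i^obs - m̂_i)`. -/
def gammaWY {n T : ℕ} (Pi : AssignPath T → ℝ) (e : Fin n → UnitEst T) (z : Fin n → UnitData T) : ℝ :=
  (1 / (n : ℝ)) * ∑ i, theta Pi (e i) (z i) *
    (pathVec (assign (z i)) ⬝ᵥ (centering T *ᵥ adjusted (e i) (z i)))

/-- The vector `Γ_w = (1/n) ∑ Θ_i J W_i`. -/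
def gammaW {n T : ℕ} (Pi : AssignPath T → ℝ) (e : Fin n → UnitEst T) (z : Fin n → UnitData T) :
    Fin T → ℝ :=
  (1 / (n : ℝ)) • ∑ i, theta Pi (e i) (z i) • (centering T *ᵥ pathVec (assign (z i)))

/-- The vector `Γ_y = (1/n) ∑ Θ_i J (Y_i^obs - m̂_i)`. -/
def gammaY {n T : ℕ} (Pi : AssignPath T → ℝ) (e : Fin n → UnitEst T) (z : Fin n → UnitData T) :
    Fin T → ℝ :=
  (1 / (n : ℝ)) • ∑ i, theta Pi (e i) (z i) • (centering T *ᵥ adjusted (e i) (z i))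

/-- `D = Γ_ww Γ_θ - Γ_wᵀ Γ_w`. -/
def denom {n T : ℕ} (Pi : AssignPath T → ℝ) (e : Fin n → UnitEst T) (z : Fin n → UnitData T) : ℝ :=
  gammaWW Pi e z * gammaTheta Pi e z - gammaW Pi e z ⬝ᵥ gammaW Pi e z

/-- The expression
`Θ {(g_wy - τ g_ww) - (g_y - τ g_w)ᵀ J W + g_θ Wᵀ J (Ỹ - τ W) - g_wᵀ J (Ỹ - τ W)}` for one unit,
with `Ỹ = Y^obs - m̂`, as a function of `g_θ, g_ww, g_wy, g_w, g_y` and `τ`. -/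
def score {T : ℕ} (Pi : AssignPath T → ℝ) (e : UnitEst T) (z : UnitData T)
    (gθ gww gwy : ℝ) (gw gy : Fin T → ℝ) (τ : ℝ) : ℝ :=
  theta Pi e z *
    ((gwy - τ * gww)
      - (gy - τ • gw) ⬝ᵥ (centering T *ᵥ pathVec (assign z))
      + gθ * (pathVec (assign z) ⬝ᵥ (centering T *ᵥ (adjusted e z - τ • pathVec (assign z))))
      - gw ⬝ᵥ (centering T *ᵥ (adjusted e z - τ • pathVec (assign z))))

/-- `V_i`, for estimates held fixed at `e` and sample `Z`, as a function on the probability space: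
the score at the expectations of the `Γ`'s (coordinatewise for vectors) and at `τ = τ*(ξ)`. -/
def oracleScore {Ω : Type*} [MeasurableSpace Ω] (P : Measure Ω) {n T : ℕ} (Pi : AssignPath T → ℝ)
    (e : Fin n → UnitEst T) (Z : Ω → Fin n → UnitData T) (τstar : ℝ) (i : Fin n) (ω : Ω) : ℝ :=
  score Pi (e i) (Z ω i)
    (∫ ω', gammaTheta Pi e (Z ω') ∂P) (∫ ω', gammaWW Pi e (Z ω') ∂P)
    (∫ ω', gammaWY Pi e (Z ω') ∂P) (fun t => ∫ ω', gammaW Pi e (Z ω') t ∂P)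
    (fun t => ∫ ω', gammaY Pi e (Z ω') t ∂P) τstar

/-- The plug-in estimate `V̂_i`. -/
def plugInScore {n T : ℕ} (Pi : AssignPath T → ℝ) (e : Fin n → UnitEst T) (z : Fin n → UnitData T)
    (τhat : ℝ) (i : Fin n) : ℝ :=
  score Pi (e i) (z i) (gammaTheta Pi e z) (gammaWW Pi e z) (gammaWY Pi e z) (gammaW Pi e z)
    (gammaY Pi e z) τhat

/-- `σ̂`, the square root of `(1/(n-1)) ∑ (V̂_i - mean of V̂)²`. -/
def sigmaHat {n T : ℕ} (Pi : AssignPath T → ℝ) (e : Fin n → UnitEst T) (z : Fin n → UnitData T)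
    (τhat : ℝ) : ℝ :=
  √((1 / ((n : ℝ) - 1)) * ∑ i, (plugInScore Pi e z τhat i
    - (1 / (n : ℝ)) * ∑ j, plugInScore Pi e z τhat j) ^ 2)

/-- The `η`-th quantile of the standard normal distribution. -/
def normalQuantile (η : ℝ) : ℝ := sInf {x : ℝ | η ≤ cdf (gaussianReal 0 1) x}

/-- The Wald interval `[τ̂ - z_{1-α/2} σ̂ / (√n D), τ̂ + z_{1-α/2} σ̂ / (√n D)]`. -/
def waldInterval {n T : ℕ} (Pi : AssignPath T → ℝ) (e : Fin n → UnitEst T) (z : Fin n → UnitData T)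
    (τhat α : ℝ) : Set ℝ :=
  Set.Icc
    (τhat - normalQuantile (1 - α / 2) * sigmaHat Pi e z τhat / (√(n : ℝ) * denom Pi e z))
    (τhat + normalQuantile (1 - α / 2) * sigmaHat Pi e z τhat / (√(n : ℝ) * denom Pi e z))

/-! ### Accuracy of the estimates -/

/-- `δ_{πi} = √(E[(π̂_i(W_i) - π_i(W_i))²])`, the expectation being over the data and the
estimates. -/
def deltaPi {Ω : Type*} [MeasurableSpace Ω] (P : Measure Ω) {n T : ℕ}
    (ν : Fin n → Measure (UnitData T)) (est : Ω → Fin n → UnitEst T)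
    (Z : Ω → Fin n → UnitData T) (i : Fin n) : ℝ :=
  √(∫ ω, ((est ω i).1 (assign (Z ω i)) - propensity (ν i) (assign (Z ω i))) ^ 2 ∂P)

/-- `δ_{yi} = √(E[‖m̂_i - m_i‖₂²]) + ‖τ_i - τ*(ξ) 1_T‖₂`. -/
def deltaY {Ω : Type*} [MeasurableSpace Ω] (P : Measure Ω) {n T : ℕ} (ξ : Fin T → ℝ)
    (ν : Fin n → Measure (UnitData T)) (est : Ω → Fin n → UnitEst T) (i : Fin n) : ℝ :=
  √(∫ ω, ∑ t, ((est ω i).2 t - centeredMean ν i t) ^ 2 ∂P)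
    + √(∑ t, (effect (ν i) t - date ξ ν) ^ 2)

/-- The root mean square `√((1/n) ∑ d_i²)`. -/
def rootMeanSq {n : ℕ} (d : Fin n → ℝ) : ℝ := √((1 / (n : ℝ)) * ∑ i, d i ^ 2)

end RIPW

end

open RIPW

namespace RIPW

open scoped Topology

/-! Let A, B, P, Q be the sample averages of Θ, Θ WᵀJ(Ỹ - τ*W), Θ JW and Θ J(Ỹ - τ*W). The normal
equation of the weighted regression (`IsRIPWEstimate.denom_mul`) yields (τ̂ - τ*) 𝒟 = N with N = AB
- P·Q, so the problem concerns one quadratic form in averages of independent bounded variables.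

Let N₀ be the value of this form at the expectations. The form is homogeneous of degree two, so its
linear part at the expectations, evaluated at the sample averages, is the average of the 𝒱_i, and
that average has mean 2N₀. The remainder N - N₀ - (avg 𝒱 - 2N₀) is a product of deviations
(`abs_numerator_sub_le`). Deviations of order n^(-3/8) have probability tending to one by Chebyshev,
so √n times the remainder vanishes, and √n (avg 𝒱 - 2N₀) obeys a central limit theorem for bounded
arrays (`eventually_gaussian_le_of_bounded`).

The bias N₀ is doubly robust (`abs_biasTerm_le`). Ignorability turns it into a form in the path
weights π_i Π / π̂_i and the conditional means of the residuals. If the weights are replaced by Π,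
the form vanishes by the DATE equation (`date_orthogonality`). Each term of the difference carries a
propensity error and an outcome error, so √n N₀ is controlled by √n times the product of the two
accuracies (`bilinear_sub_le`). The population denominator is bounded below by a positive spread of
the demeaned paths in the support of Π (`le_meanDenom`).

The plug-in variance approaches the average of E[𝒱_i²] minus (2N₀)², which by Jensen is at least the
average of Var(𝒱_i); unequal means can only widen the interval. The Gaussian mass is evaluated at
some q slightly below the quantile z, and the gap z² - q², multiplied by the variance bound ν₀, pays
for all remaining errors (`sq_numerator_le_of_close`, `measureReal_le_cover_add`).

The estimates are random but independent of the data. Coverage is proved for every deterministic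
sequence of good estimate values and made uniform over good values by choosing the worst one at each
n (`eventually_forall_of_selection`). Markov's inequality shows that the estimates are good with
probability tending to one, and Fubini combines the two statements
(`mul_measureReal_le_of_forall_mem`). -/

/-! ### Central limit theorem for bounded triangular arrays -/

theorem norm_prod_sub_prod_le {ι : Type*} (s : Finset ι) (a b : ι → ℂ)
    (ha : ∀ i ∈ s, ‖a i‖ ≤ 1) (hb : ∀ i ∈ s, ‖b i‖ ≤ 1) :
    ‖∏ i ∈ s, a i - ∏ i ∈ s, b i‖ ≤ ∑ i ∈ s, ‖a i - b i‖ := by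
  classical
  induction s using Finset.induction_on with
  | empty => simp
  | insert j s hj ih =>
    rw [Finset.prod_insert hj, Finset.prod_insert hj, Finset.sum_insert hj]
    have ih' := ih (fun i hi => ha i (Finset.mem_insert_of_mem hi))
      (fun i hi => hb i (Finset.mem_insert_of_mem hi))
    have hP : ‖∏ i ∈ s, a i‖ ≤ 1 := by
      rw [norm_prod]
      exact Finset.prod_le_one (fun _ _ => norm_nonneg _)
        (fun i hi => ha i (Finset.mem_insert_of_mem hi))
    have e : a j * ∏ i ∈ s, a i - b j * ∏ i ∈ s, b i
        = (a j - b j) * ∏ i ∈ s, a i + b j * (∏ i ∈ s, a i - ∏ i ∈ s, b i) := by ring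
    rw [e]
    refine (norm_add_le _ _).trans (add_le_add ?_ ?_)
    · rw [norm_mul]
      exact mul_le_of_le_one_right (norm_nonneg _) hP
    · rw [norm_mul]
      exact (mul_le_of_le_one_left (norm_nonneg _) (hb j (Finset.mem_insert_self _ _))).trans ih'

section Bounded

variable {Ω : Type*} [MeasurableSpace Ω] {P : Measure Ω} [IsProbabilityMeasure P]

theorem integrable_of_ae_abs_le {X : Ω → ℝ} (hm : Measurable X) {K : ℝ}
    (hK : ∀ᵐ ω ∂P, |X ω| ≤ K) : Integrable X P :=
  Integrable.of_bound hm.aestronglyMeasurable K (by simpa [Real.norm_eq_abs] using hK)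

theorem memLp_two_of_ae_abs_le {X : Ω → ℝ} (hm : Measurable X) {K : ℝ}
    (hK : ∀ᵐ ω ∂P, |X ω| ≤ K) : MemLp X 2 P :=
  MemLp.of_bound hm.aestronglyMeasurable K (by simpa [Real.norm_eq_abs] using hK)

theorem abs_integral_le_of_ae_abs_le {X : Ω → ℝ} {K : ℝ}
    (hK : ∀ᵐ ω ∂P, |X ω| ≤ K) : |∫ ω, X ω ∂P| ≤ K := by
  have := norm_integral_le_of_norm_le_const (μ := P) (f := X) (C := K)
    (by simpa [Real.norm_eq_abs] using hK)
  simpa using this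

theorem variance_le_of_ae_abs_le {X : Ω → ℝ} (hm : Measurable X) {K : ℝ}
    (hK : ∀ᵐ ω ∂P, |X ω| ≤ K) : variance X P ≤ K ^ 2 := by
  refine (variance_le_expectation_sq hm.aestronglyMeasurable).trans ?_
  refine (le_abs_self _).trans (abs_integral_le_of_ae_abs_le ?_)
  filter_upwards [hK] with ω h
  simp only [Pi.pow_apply, abs_pow]
  gcongr

/-- Both terms are compared with the common second-order polynomial 1 - u² Var(Y)/2. For |u|L ≤ 1
the Taylor remainder of the complex exponential contributes 2/9 of the cubic bound. The real
exponential contributes 1/4, from s² ≤ (|u|L)⁴/4 with s = u² Var(Y)/2. -/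
theorem charFun_sub_exp_le {Y : Ω → ℝ} (hm : Measurable Y) {L : ℝ}
    (hL : ∀ᵐ ω ∂P, |Y ω| ≤ L) (h0 : ∫ ω, Y ω ∂P = 0) {u : ℝ} (hu : |u| * L ≤ 1) :
    ‖charFun (P.map Y) u - Complex.exp ((-(u ^ 2 * variance Y P / 2) : ℝ))‖
      ≤ |u| ^ 3 * L ^ 3 := by
  have hL0 : 0 ≤ L := by
    obtain ⟨ω, hω⟩ := hL.exists
    exact (abs_nonneg _).trans hω
  have hint : Integrable Y P := integrable_of_ae_abs_le hm hL
  have hint2 : Integrable (fun ω => Y ω ^ 2) P :=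
    integrable_of_ae_abs_le (hm.pow_const 2) (K := L ^ 2) (by
      filter_upwards [hL] with ω h
      rw [abs_pow]; gcongr)
  have hv : variance Y P = ∫ ω, Y ω ^ 2 ∂P := by
    rw [variance_eq_integral hm.aemeasurable]; simp [h0]
  have hvL : variance Y P ≤ L ^ 2 := variance_le_of_ae_abs_le hm hL
  have hv0 : 0 ≤ variance Y P := variance_nonneg _ _
  have hcf : charFun (P.map Y) u = ∫ ω, Complex.exp (u * Y ω * Complex.I) ∂P := by
    rw [charFun_apply_real, integral_map hm.aemeasurable (by fun_prop)]
  have hpoly : ∫ ω, ((1 : ℂ) + u * Y ω * Complex.I + (-(u ^ 2 * Y ω ^ 2 / 2) : ℝ)) ∂P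
      = ((1 - u ^ 2 * variance Y P / 2 : ℝ) : ℂ) := by
    have i1 : Integrable (fun ω => (u : ℂ) * Y ω * Complex.I) P :=
      ((hint.ofReal (𝕜 := ℂ)).const_mul _).mul_const _
    have i2 : Integrable (fun ω => ((-(u ^ 2 * Y ω ^ 2 / 2) : ℝ) : ℂ)) P :=
      (((hint2.const_mul _).div_const _).neg).ofReal
    have i3 : Integrable (fun ω => (1 : ℂ) + u * Y ω * Complex.I) P := (integrable_const _).add i1
    rw [integral_add i3 i2, integral_add (integrable_const _) i1,
      integral_complex_ofReal, integral_neg, integral_div, integral_const_mul, ← hv,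
      integral_mul_const, integral_const_mul, integral_complex_ofReal, h0]
    simp; ring
  have hexpint : Integrable (fun ω => Complex.exp (u * Y ω * Complex.I)) P := by
    refine Integrable.of_bound (by fun_prop) 1 (ae_of_all _ fun ω => ?_)
    have : (u : ℂ) * Y ω * Complex.I = ((u * Y ω : ℝ) : ℂ) * Complex.I := by push_cast; ring
    rw [this, Complex.norm_exp_ofReal_mul_I]
  have hpint : Integrable (fun ω => (1 : ℂ) + u * Y ω * Complex.I + (-(u ^ 2 * Y ω ^ 2 / 2) : ℝ)) P :=
    ((integrable_const _).add (((hint.ofReal (𝕜 := ℂ)).const_mul _).mul_const _)).add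
      (((hint2.const_mul _).div_const _).neg).ofReal
  have h1 : ‖charFun (P.map Y) u - ((1 - u ^ 2 * variance Y P / 2 : ℝ) : ℂ)‖
      ≤ |u| ^ 3 * L ^ 3 * (2 / 9) := by
    rw [hcf, ← hpoly, ← integral_sub hexpint hpint]
    have := norm_integral_le_of_norm_le_const (μ := P) (C := |u| ^ 3 * L ^ 3 * (2 / 9))
      (f := fun ω => Complex.exp (u * Y ω * Complex.I) -
        (1 + u * Y ω * Complex.I + (-(u ^ 2 * Y ω ^ 2 / 2) : ℝ))) ?_
    · simpa using this
    filter_upwards [hL] with ω hω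
    have hn : ‖(u : ℂ) * Y ω * Complex.I‖ = |u| * |Y ω| := by simp
    have hle : |u| * |Y ω| ≤ |u| * L := by gcongr
    have hb := Complex.exp_bound (x := (u : ℂ) * Y ω * Complex.I) (by rw [hn]; linarith)
      (n := 3) (by norm_num)
    have es : ∑ m ∈ Finset.range 3, ((u : ℂ) * Y ω * Complex.I) ^ m / (m.factorial : ℂ)
        = 1 + u * Y ω * Complex.I + (-(u ^ 2 * Y ω ^ 2 / 2) : ℝ) := by
      simp only [Finset.sum_range_succ, Finset.sum_range_zero, Nat.factorial]
      push_cast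
      linear_combination ((u : ℂ) ^ 2 * (Y ω : ℂ) ^ 2 / 2) * Complex.I_sq
    rw [es, hn] at hb
    refine hb.trans ?_
    have : (|u| * |Y ω|) ^ 3 ≤ (|u| * L) ^ 3 := by gcongr
    norm_num [Nat.factorial] at hb ⊢
    nlinarith [this]
  have h2 : ‖((1 - u ^ 2 * variance Y P / 2 : ℝ) : ℂ)
      - Complex.exp ((-(u ^ 2 * variance Y P / 2) : ℝ))‖ ≤ |u| ^ 3 * L ^ 3 * (1 / 4) := by
    rw [← Complex.ofReal_exp, ← Complex.ofReal_sub, Complex.norm_real, Real.norm_eq_abs,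
      abs_sub_comm]
    set s := u ^ 2 * variance Y P / 2 with hs
    have hsn : 0 ≤ s := by positivity
    have hs1 : s ≤ (|u| * L) ^ 2 / 2 := by
      rw [hs, mul_pow, sq_abs]; gcongr
    have hx0 : 0 ≤ |u| * L := by positivity
    have hsle : s ≤ 1 := by nlinarith
    have := Real.abs_exp_sub_one_sub_id_le (x := -s) (by rw [abs_neg, abs_of_nonneg hsn]; exact hsle)
    have e : Real.exp (-s) - (1 - s) = Real.exp (-s) - 1 - -s := by ring
    rw [e]
    refine this.trans ?_
    rw [← mul_pow, neg_sq]
    have h4 : s ^ 2 ≤ ((|u| * L) ^ 2 / 2) ^ 2 := by gcongr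
    have h5 : (|u| * L) ^ 4 ≤ (|u| * L) ^ 3 := pow_le_pow_of_le_one hx0 hu (by norm_num)
    nlinarith
  have h3 : 0 ≤ |u| ^ 3 * L ^ 3 := by positivity
  calc _ ≤ _ := norm_sub_le_norm_sub_add_norm_sub _ ((1 - u ^ 2 * variance Y P / 2 : ℝ) : ℂ) _
    _ ≤ |u| ^ 3 * L ^ 3 * (2 / 9) + |u| ^ 3 * L ^ 3 * (1 / 4) := add_le_add h1 h2
    _ ≤ _ := by linarith

/-- Chebyshev's inequality for the mean of independent bounded variables. -/
theorem measureReal_abs_mean_sub_gt_le {n : ℕ} (hn : 0 < n) {X : Fin n → Ω → ℝ}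
    (hm : ∀ i, Measurable (X i)) (hind : iIndepFun X P) {K : ℝ}
    (hK : ∀ i, ∀ᵐ ω ∂P, |X i ω| ≤ K) {r : ℝ} (hr : 0 < r) :
    P.real {ω | r < |(1 / (n : ℝ)) * ∑ i, X i ω - (1 / (n : ℝ)) * ∑ i, ∫ ω', X i ω' ∂P|}
      ≤ K ^ 2 / (n * r ^ 2) := by
  have hn' : (0 : ℝ) < n := by exact_mod_cast hn
  have hL : ∀ i, MemLp (X i) 2 P := fun i => memLp_two_of_ae_abs_le (hm i) (hK i)
  have hsum : MemLp (∑ i, X i) 2 P := memLp_finsetSum' _ fun i _ => hL i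
  have hvar : variance (∑ i, X i) P ≤ n * K ^ 2 := by
    rw [IndepFun.variance_sum (fun i _ => hL i) (fun i _ j _ hij => hind.indepFun hij)]
    refine (Finset.sum_le_sum fun i _ => variance_le_of_ae_abs_le (hm i) (hK i)).trans ?_
    simp
  have hint : ∫ ω, (∑ i, X i) ω ∂P = ∑ i, ∫ ω, X i ω ∂P := by
    simp only [Finset.sum_apply]
    exact integral_finsetSum _ fun i _ => (integrable_of_ae_abs_le (hm i) (hK i))
  have hch := meas_ge_le_variance_div_sq hsum (c := n * r) (by positivity)
  have hsub : {ω | r < |(1 / (n : ℝ)) * ∑ i, X i ω - (1 / (n : ℝ)) * ∑ i, ∫ ω', X i ω' ∂P|}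
      ⊆ {ω | n * r ≤ |(∑ i, X i) ω - ∫ ω, (∑ i, X i) ω ∂P|} := by
    intro ω hω
    simp only [Set.mem_ofPred_eq] at hω ⊢
    rw [hint, Finset.sum_apply]
    rw [← mul_sub, abs_mul, abs_of_pos (by positivity), one_div, ← div_eq_inv_mul,
      lt_div_iff₀ hn'] at hω
    linarith
  have := (measure_mono hsub).trans hch
  refine (ENNReal.toReal_le_of_le_ofReal
    (div_nonneg (variance_nonneg _ _) (by positivity)) this).trans ?_
  rw [div_le_div_iff₀ (by positivity) (by positivity)]
  have : variance (∑ i, X i) P * (n * r ^ 2) ≤ n * K ^ 2 * (n * r ^ 2) := by gcongr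
  nlinarith

end Bounded

/-- Independence factors the characteristic function at u = t/√V, and exp(-t²/2) factors as the
product of the exp(-u² Var(X_i)/2). Each of the n factors costs |u|³(2K)³ with |u| ≤ |t|/√(nν₀), so
the total is of order n^(-1/2). The bound 2K is that of the centred variables. -/
theorem norm_charFun_standardized_sub_le {Ω : Type*} [MeasurableSpace Ω] {P : Measure Ω}
    [IsProbabilityMeasure P] {n : ℕ} (hn : 0 < n) {X : Fin n → Ω → ℝ}
    (hm : ∀ i, Measurable (X i)) (hind : iIndepFun X P) {K : ℝ}
    (hKn : ∀ i, ∀ᵐ ω ∂P, |X i ω| ≤ K) {ν₀ : ℝ} (hν₀ : 0 < ν₀)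
    (hVn : n * ν₀ ≤ ∑ i, variance (X i) P) {t : ℝ}
    (hsm : |t| * (√(n * ν₀))⁻¹ * (2 * K) ≤ 1) :
    ‖charFun (P.map fun ω => (√(∑ i, variance (X i) P))⁻¹ *
        ∑ i, (X i ω - ∫ ω', X i ω' ∂P)) t - charFun (gaussianReal 0 1) t‖
      ≤ |t| ^ 3 * (2 * K) ^ 3 / (ν₀ * √ν₀) * (√(n : ℝ))⁻¹ := by
  set V : ℝ := ∑ i, variance (X i) P with hV
  set Y : Fin n → Ω → ℝ := fun i ω => X i ω - ∫ ω', X i ω' ∂P with hY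
  have hYm : ∀ i, Measurable (Y i) := fun i => (hm i).sub_const _
  have hn' : (0 : ℝ) < n := by exact_mod_cast hn
  have hVpos : 0 < V := lt_of_lt_of_le (by positivity) hVn
  have hs : √(n * ν₀) ≤ √(V) := Real.sqrt_le_sqrt hVn
  have hs0 : 0 < √(n * ν₀) := Real.sqrt_pos.2 (by positivity)
  have hK0 : 0 ≤ K := by
    obtain ⟨ω, hω⟩ := (hKn ⟨0, hn⟩).exists
    exact (abs_nonneg _).trans hω
  have hYK : ∀ i, ∀ᵐ ω ∂P, |Y i ω| ≤ 2 * K := fun i => by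
    filter_upwards [hKn i] with ω hω
    have := abs_integral_le_of_ae_abs_le (hKn i)
    calc |Y i ω| ≤ |X i ω| + |∫ ω', X i ω' ∂P| := abs_sub _ _
      _ ≤ 2 * K := by linarith
  have hY0 : ∀ i, ∫ ω, Y i ω ∂P = 0 := fun i => by
    rw [hY]
    simp only
    rw [integral_sub (integrable_of_ae_abs_le (hm i) (hKn i)) (integrable_const _)]
    simp
  have hYind : iIndepFun (Y) P :=
    (hind).comp (fun i x => x - ∫ ω', X i ω' ∂P) (fun i => by fun_prop)
  have hYv : ∀ i, variance (Y i) P = variance (X i) P := fun i =>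
    variance_sub_const (hm i).aestronglyMeasurable _
  set u : ℝ := (√(V))⁻¹ * t with hu
  have hu_abs : |u| ≤ |t| * (√(n * ν₀))⁻¹ := by
    rw [hu, abs_mul, abs_of_nonneg (by positivity), mul_comm]
    gcongr
  have hu1 : |u| * (2 * K) ≤ 1 := le_trans (by gcongr) hsm
  have hcf : charFun (P.map (fun ω => (√(V))⁻¹ * ∑ i, Y i ω)) t
      = ∏ i, charFun (P.map (Y i)) u := by
    rw [charFun_map_mul_comp (Finset.measurable_fun_sum _ fun i _ => hYm i).aemeasurable,
      hYind.charFun_map_fun_sum_eq_prod fun i => (hYm i).aemeasurable]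
    simp [hu]
  have hg : charFun (gaussianReal 0 1) t
      = ∏ i, Complex.exp ((-(u ^ 2 * variance (Y i) P / 2) : ℝ)) := by
    rw [← Complex.exp_sum, charFun_gaussianReal, ← Complex.ofReal_sum]
    have : ∑ i, -(u ^ 2 * variance (Y i) P / 2) = - t ^ 2 / 2 := by
      simp_rw [hYv]
      rw [Finset.sum_neg_distrib, ← Finset.sum_div, ← Finset.mul_sum]
      change -(u ^ 2 * V / 2) = _
      rw [hu, mul_pow, inv_pow, Real.sq_sqrt hVpos.le]
      field_simp
    rw [this]
    congr 1
    push_cast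
    simp
    ring
  rw [hcf, hg]
  refine (norm_prod_sub_prod_le _ _ _ (fun i _ => ?_) (fun i _ => ?_)).trans ?_
  · have := Measure.isProbabilityMeasure_map (μ := P) (hYm i).aemeasurable
    exact norm_charFun_le_one u
  · rw [← Complex.ofReal_exp, Complex.norm_real, Real.norm_eq_abs, Real.abs_exp,
      Real.exp_le_one_iff]
    exact neg_nonpos.2
      (div_nonneg (mul_nonneg (sq_nonneg u) (variance_nonneg (Y i) P)) zero_le_two)
  · refine (Finset.sum_le_sum fun i _ =>
      charFun_sub_exp_le (hYm i) (hYK i) (hY0 i) hu1).trans ?_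
    rw [Finset.sum_const, Finset.card_univ, Fintype.card_fin, nsmul_eq_mul]
    have h3 : |u| ^ 3 ≤ (|t| * (√(n * ν₀))⁻¹) ^ 3 := by gcongr
    calc (n : ℝ) * (|u| ^ 3 * (2 * K) ^ 3)
        ≤ n * ((|t| * (√(n * ν₀))⁻¹) ^ 3 * (2 * K) ^ 3) := by gcongr
      _ = _ := by
        rw [Real.sqrt_mul hn'.le]
        have e1 : √(n : ℝ) ^ 2 = n := Real.sq_sqrt hn'.le
        have e2 : √ν₀ ^ 2 = ν₀ := Real.sq_sqrt hν₀.le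
        have p1 : 0 < √(n : ℝ) := Real.sqrt_pos.2 hn'
        have p2 : 0 < √ν₀ := Real.sqrt_pos.2 hν₀
        generalize √(n : ℝ) = a at *
        generalize √ν₀ = b at *
        rw [← e1, ← e2]
        field_simp

/-- Central limit theorem for triangular arrays of uniformly bounded independent variables, as a
lower bound for the probability of a symmetric interval. -/
theorem eventually_gaussian_le_of_bounded {Ω : ℕ → Type*} [∀ n, MeasurableSpace (Ω n)]
    (P : (n : ℕ) → Measure (Ω n)) [∀ n, IsProbabilityMeasure (P n)]
    {X : (n : ℕ) → Fin n → Ω n → ℝ} (hm : ∀ n i, Measurable (X n i))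
    (hind : ∀ n, iIndepFun (X n) (P n)) {K : ℝ}
    (hK : ∀ᶠ n in atTop, ∀ i, ∀ᵐ ω ∂(P n), |X n i ω| ≤ K) {ν₀ : ℝ} (hν₀ : 0 < ν₀)
    (hvar : ∀ᶠ n : ℕ in atTop, ν₀ ≤ (1 / (n : ℝ)) * ∑ i, variance (X n i) (P n))
    {q ε : ℝ} (hε : 0 < ε) :
    ∀ᶠ n in atTop, (gaussianReal 0 1).real (Set.Ioo (-q) q) - ε ≤
      (P n).real {ω | |∑ i, (X n i ω - ∫ ω', X n i ω' ∂(P n))|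
        < q * √(∑ i, variance (X n i) (P n))} := by
  set V : ℕ → ℝ := fun n => ∑ i, variance (X n i) (P n) with hV
  set Y : (n : ℕ) → Fin n → Ω n → ℝ := fun n i ω => X n i ω - ∫ ω', X n i ω' ∂(P n) with hY
  have hYm : ∀ n i, Measurable (Y n i) := fun n i => (hm n i).sub_const _
  have hSm : ∀ n, Measurable (fun ω => (√(V n))⁻¹ * ∑ i, Y n i ω) := fun n =>
    (Finset.measurable_fun_sum _ fun i _ => hYm n i).const_mul _
  set μ : ℕ → ProbabilityMeasure ℝ := fun n =>
    ⟨(P n).map (fun ω => (√(V n))⁻¹ * ∑ i, Y n i ω),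
      Measure.isProbabilityMeasure_map (hSm n).aemeasurable⟩ with hμ
  have hVge : ∀ᶠ n : ℕ in atTop, n * ν₀ ≤ V n := by
    filter_upwards [hvar, eventually_gt_atTop 0] with n h hn
    have hn' : (0 : ℝ) < n := by exact_mod_cast hn
    rw [one_div, ← div_eq_inv_mul, le_div_iff₀ hn'] at h
    linarith
  have hn_top : Tendsto (fun n : ℕ => (n : ℝ)) atTop atTop := tendsto_natCast_atTop_atTop
  have hconv : Tendsto μ atTop (𝓝 (⟨gaussianReal 0 1, inferInstance⟩ : ProbabilityMeasure ℝ)) := by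
    refine ProbabilityMeasure.tendsto_iff_tendsto_charFun.2 fun t => ?_
    simp only [hμ, ProbabilityMeasure.coe_mk]
    rw [tendsto_iff_norm_sub_tendsto_zero]
    have hsq : Tendsto (fun n : ℕ => |t| ^ 3 * (2 * K) ^ 3 / (ν₀ * √ν₀) * (√(n : ℝ))⁻¹) atTop (𝓝 0) := by
      simpa using (tendsto_inv_atTop_zero.comp (Real.tendsto_sqrt_atTop.comp hn_top)).const_mul
        (|t| ^ 3 * (2 * K) ^ 3 / (ν₀ * √ν₀))
    have hsmall : ∀ᶠ n : ℕ in atTop, |t| * (√(n * ν₀))⁻¹ * (2 * K) ≤ 1 := by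
      have : Tendsto (fun n : ℕ => |t| * (√(n * ν₀))⁻¹ * (2 * K)) atTop (𝓝 (|t| * 0 * (2 * K))) :=
        ((tendsto_inv_atTop_zero.comp (Real.tendsto_sqrt_atTop.comp
          (hn_top.atTop_mul_const hν₀))).const_mul _).mul_const _
      rw [mul_zero, zero_mul] at this
      exact (this.eventually (gt_mem_nhds one_pos)).mono fun _ h => h.le
    refine squeeze_zero' (Eventually.of_forall fun _ => norm_nonneg _) ?_ hsq
    filter_upwards [hK, hVge, hsmall, eventually_gt_atTop 0] with n hKn hVn hsm hn
    exact norm_charFun_standardized_sub_le hn (hm n) (hind n) hKn hν₀ hVn hsm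
  -- Portmanteau for an open set gives exactly the one-sided bound needed, without a boundary
  -- condition.
  have hlim := ProbabilityMeasure.le_liminf_measure_open_of_tendsto hconv
    (isOpen_Ioo (a := -q) (b := q))
  by_cases hg0 : (gaussianReal 0 1).real (Set.Ioo (-q) q) - ε < 0
  · exact Eventually.of_forall fun n => hg0.le.trans measureReal_nonneg
  push Not at hg0
  have hlt : ENNReal.ofReal ((gaussianReal 0 1).real (Set.Ioo (-q) q) - ε)
      < (gaussianReal 0 1) (Set.Ioo (-q) q) := by
    rw [ENNReal.ofReal_lt_iff_lt_toReal hg0 (measure_ne_top _ _)]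
    change _ < (gaussianReal 0 1).real _
    linarith
  have hev := eventually_lt_of_lt_liminf (hlt.trans_le hlim)
  filter_upwards [hev, hVge, eventually_gt_atTop 0] with n h hVn hn
  have hn' : (0 : ℝ) < n := by exact_mod_cast hn
  have hVpos : 0 < V n := lt_of_lt_of_le (by positivity) hVn
  have hsp : 0 < √(V n) := Real.sqrt_pos.2 hVpos
  rw [hμ] at h
  simp only [ProbabilityMeasure.coe_mk] at h
  rw [Measure.map_apply (hSm n) measurableSet_Ioo] at h
  have hset : (fun ω => (√(V n))⁻¹ * ∑ i, Y n i ω) ⁻¹' Set.Ioo (-q) q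
      = {ω | |∑ i, Y n i ω| < q * √(V n)} := by
    ext ω
    simp only [Set.mem_preimage, Set.mem_Ioo, Set.mem_ofPred_eq]
    rw [← abs_lt, abs_mul, abs_of_pos (inv_pos.2 hsp), ← div_eq_inv_mul, div_lt_iff₀ hsp]
  rw [hset] at h
  exact (ENNReal.ofReal_le_iff_le_toReal (measure_ne_top _ _)).1 h.le

/-! ### Standard normal quantiles -/

theorem cdf_gaussianReal_zero : cdf (gaussianReal 0 1) 0 = 1 / 2 := by
  have := nullSingletonClass_gaussianReal (μ := 0) (v := 1) one_ne_zero
  have hneg : (gaussianReal 0 1).map (fun x => -x) = gaussianReal 0 1 := by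
    rw [gaussianReal_map_neg]; simp
  have h1 : (gaussianReal 0 1).real (Set.Iic 0) = (gaussianReal 0 1).real (Set.Ici 0) := by
    conv_lhs => rw [← hneg]
    rw [map_measureReal_apply measurable_neg measurableSet_Iic]
    congr 1; ext x; simp
  have h2 : (gaussianReal 0 1).real (Set.Ici 0) = (gaussianReal 0 1).real (Set.Ioi 0) :=
    measureReal_congr Ioi_ae_eq_Ici.symm
  have h3 := probReal_compl_eq_one_sub (μ := gaussianReal 0 1) (measurableSet_Iic (a := (0 : ℝ)))
  rw [Set.compl_Iic, ← h2, ← h1] at h3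
  rw [cdf_eq_real]
  linarith

/-- Right continuity of the distribution function at the infimum defining the quantile. The
condition η < 1 makes the set nonempty and 0 < η makes it bounded below, so that `sInf` is not a
default value. -/
theorem le_cdf_normalQuantile {η : ℝ} (h0 : 0 < η) (h1 : η < 1) :
    η ≤ cdf (gaussianReal 0 1) (normalQuantile η) := by
  set A : Set ℝ := {x : ℝ | η ≤ cdf (gaussianReal 0 1) x} with hA
  have hne : A.Nonempty := by
    obtain ⟨x, hx⟩ := ((tendsto_cdf_atTop (gaussianReal 0 1)).eventually (lt_mem_nhds h1)).exists
    exact ⟨x, hx.le⟩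
  have hbdd : BddBelow A := by
    obtain ⟨x, hx⟩ := ((tendsto_cdf_atBot (gaussianReal 0 1)).eventually (gt_mem_nhds h0)).exists
    refine ⟨x, fun y hy => ?_⟩
    by_contra! hlt
    have := monotone_cdf (gaussianReal 0 1) hlt.le
    have hy' : η ≤ cdf (gaussianReal 0 1) y := hy
    linarith
  have hcont : ContinuousWithinAt (cdf (gaussianReal 0 1)) (Set.Ioi (sInf A)) (sInf A) :=
    ((cdf (gaussianReal 0 1)).right_continuous _).mono Set.Ioi_subset_Ici_self
  refine ge_of_tendsto hcont ?_
  filter_upwards [self_mem_nhdsWithin] with x hx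
  obtain ⟨y, hy, hyx⟩ := exists_lt_of_csInf_lt hne hx
  exact le_trans hy (monotone_cdf _ hyx.le)

theorem normalQuantile_pos {η : ℝ} (h0 : 1 / 2 < η) (h1 : η < 1) : 0 < normalQuantile η := by
  by_contra! h
  have h2 := le_cdf_normalQuantile (by linarith) h1
  have h3 := monotone_cdf (gaussianReal 0 1) h
  rw [cdf_gaussianReal_zero] at h3
  linarith

/-- By symmetry and absence of atoms the mass below -z equals the mass above z, which is at most
α/2. -/
theorem le_gaussianReal_Ioo_normalQuantile {α : ℝ} (hα : α ∈ Set.Ioo (0 : ℝ) 1) :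
    1 - α ≤ (gaussianReal 0 1).real
      (Set.Ioo (-normalQuantile (1 - α / 2)) (normalQuantile (1 - α / 2))) := by
  have := nullSingletonClass_gaussianReal (μ := 0) (v := 1) one_ne_zero
  set z := normalQuantile (1 - α / 2) with hz
  have hzpos : 0 < z := normalQuantile_pos (by linarith [hα.2]) (by linarith [hα.1])
  have hc : 1 - α / 2 ≤ (gaussianReal 0 1).real (Set.Iic z) := by
    rw [← cdf_eq_real]
    exact le_cdf_normalQuantile (by linarith [hα.2]) (by linarith [hα.1])
  have hneg : (gaussianReal 0 1).map (fun x => -x) = gaussianReal 0 1 := by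
    rw [gaussianReal_map_neg]; simp
  have h1 : (gaussianReal 0 1).real (Set.Iic (-z)) = (gaussianReal 0 1).real (Set.Ici z) := by
    conv_lhs => rw [← hneg]
    rw [map_measureReal_apply measurable_neg measurableSet_Iic]
    congr 1; ext x; simp
  have h2 : (gaussianReal 0 1).real (Set.Ici z) = (gaussianReal 0 1).real (Set.Ioi z) :=
    measureReal_congr Ioi_ae_eq_Ici.symm
  have h3 := probReal_compl_eq_one_sub (μ := gaussianReal 0 1) (measurableSet_Iic (a := z))
  rw [Set.compl_Iic] at h3
  have h4 : (gaussianReal 0 1).real (Set.Iic z)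
      ≤ (gaussianReal 0 1).real (Set.Iic (-z)) + (gaussianReal 0 1).real (Set.Ioo (-z) z) := by
    have : (gaussianReal 0 1).real (Set.Iic z) = (gaussianReal 0 1).real (Set.Iio z) :=
      measureReal_congr Iio_ae_eq_Iic.symm
    rw [this, ← Set.Iic_union_Ioo_eq_Iio (by linarith : -z < z)]
    exact measureReal_union_le _ _
  linarith

/-- The open interval is an increasing union of shorter symmetric ones, so continuity from below
applies. The strict gap between q and z is the slack that later absorbs bias, linearization and
variance estimation errors. -/
theorem exists_lt_gaussianReal_Ioo {z ε : ℝ} (hz : 0 < z) (hε : 0 < ε) :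
    ∃ q, 0 < q ∧ q < z ∧ (gaussianReal 0 1).real (Set.Ioo (-z) z) - ε
      ≤ (gaussianReal 0 1).real (Set.Ioo (-q) q) := by
  -- The shift by 2 keeps the endpoint z - z/(k+2) positive already at k = 0.
  have hmono : Monotone fun k : ℕ => Set.Ioo (-(z - z / (k + 2))) (z - z / (k + 2)) := by
    intro k l hkl
    have : z / ((l : ℝ) + 2) ≤ z / (k + 2) := by gcongr
    exact Set.Ioo_subset_Ioo (by linarith) (by linarith)
  have hlim : Tendsto (fun k : ℕ => z / ((k : ℝ) + 2)) atTop (𝓝 0) :=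
    tendsto_const_nhds.div_atTop
      (tendsto_atTop_add_const_right _ _ tendsto_natCast_atTop_atTop)
  have hU : ⋃ k : ℕ, Set.Ioo (-(z - z / (k + 2))) (z - z / (k + 2)) = Set.Ioo (-z) z := by
    ext x
    simp only [Set.mem_iUnion, Set.mem_Ioo]
    constructor
    · rintro ⟨k, h1, h2⟩
      have : 0 < z / ((k : ℝ) + 2) := by positivity
      constructor <;> linarith
    · rintro ⟨h1, h2⟩
      have hpos : 0 < min (x + z) (z - x) := lt_min (by linarith) (by linarith)
      obtain ⟨k, hk⟩ := (hlim.eventually (gt_mem_nhds hpos)).exists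
      have := lt_min_iff.1 hk
      exact ⟨k, by linarith [this.1], by linarith [this.2]⟩
  have ht := tendsto_measure_iUnion_atTop (μ := gaussianReal 0 1) hmono
  rw [hU] at ht
  have ht' := (ENNReal.tendsto_toReal (measure_ne_top _ _)).comp ht
  obtain ⟨k, hk⟩ := (ht'.eventually (lt_mem_nhds
    (show ((gaussianReal 0 1) (Set.Ioo (-z) z)).toReal - ε < _ by linarith))).exists
  refine ⟨z - z / (k + 2), ?_, ?_, hk.le⟩
  · have : z / ((k : ℝ) + 2) < z := div_lt_self hz (by linarith [(Nat.cast_nonneg k : (0:ℝ) ≤ k)])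
    linarith
  · have : 0 < z / ((k : ℝ) + 2) := by positivity
    linarith

/-! ### Averages and plug-in stability -/

/-- The average of a finite family of reals. -/
noncomputable def avg {n : ℕ} (f : Fin n → ℝ) : ℝ := (1 / (n : ℝ)) * ∑ i, f i

section Avg

variable {n : ℕ} (f g : Fin n → ℝ)

theorem avg_add : avg (fun i => f i + g i) = avg f + avg g := by
  simp [avg, Finset.sum_add_distrib, mul_add]

theorem avg_sub : avg (fun i => f i - g i) = avg f - avg g := by
  simp [avg, Finset.sum_sub_distrib, mul_sub]

theorem avg_const_mul (c : ℝ) : avg (fun i => c * f i) = c * avg f := by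
  simp only [avg, ← Finset.mul_sum]; ring

theorem avg_sum {ι : Type*} (s : Finset ι) (F : ι → Fin n → ℝ) :
    avg (fun i => ∑ t ∈ s, F t i) = ∑ t ∈ s, avg (F t) := by
  simp only [avg]; rw [Finset.sum_comm, Finset.mul_sum]

theorem avg_const (hn : 0 < n) (c : ℝ) : avg (fun _ : Fin n => c) = c := by
  have : (n : ℝ) ≠ 0 := by exact_mod_cast hn.ne'
  simp [avg, this]

variable {f g}

theorem avg_mono (h : ∀ i, f i ≤ g i) : avg f ≤ avg g :=
  mul_le_mul_of_nonneg_left (Finset.sum_le_sum fun i _ => h i) (by positivity)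

theorem avg_nonneg (h : ∀ i, 0 ≤ f i) : 0 ≤ avg f :=
  mul_nonneg (by positivity) (Finset.sum_nonneg fun i _ => h i)

theorem abs_avg_le_avg : |avg f| ≤ avg fun i => |f i| := by
  rw [avg, avg, abs_mul, abs_of_nonneg (by positivity : (0 : ℝ) ≤ 1 / n)]
  exact mul_le_mul_of_nonneg_left (Finset.abs_sum_le_sum_abs _ _) (by positivity)

theorem abs_avg_le (hn : 0 < n) {c : ℝ} (h : ∀ i, |f i| ≤ c) : |avg f| ≤ c :=
  abs_avg_le_avg.trans ((avg_mono h).trans (avg_const hn c).le)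

theorem avg_mul_le : avg (fun i => f i * g i) ≤ √(avg fun i => f i ^ 2) * √(avg fun i => g i ^ 2) := by
  rw [← Real.sqrt_mul (avg_nonneg fun _ => sq_nonneg _)]
  refine Real.le_sqrt_of_sq_le ?_
  simp only [avg]
  have := Finset.sum_mul_sq_le_sq_mul_sq Finset.univ f g
  have h : (0 : ℝ) ≤ (1 / n) * (1 / n) := by positivity
  nlinarith [mul_le_mul_of_nonneg_left this h]

theorem sq_avg_le (hn : 0 < n) : avg f ^ 2 ≤ avg fun i => f i ^ 2 := by
  have h0 : 0 ≤ avg fun i => (f i - avg f) ^ 2 := avg_nonneg fun _ => sq_nonneg _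
  have e : (avg fun i => (f i - avg f) ^ 2) = (avg fun i => f i ^ 2) - avg f ^ 2 := by
    have : (fun i => (f i - avg f) ^ 2) = fun i => (f i ^ 2 - (2 * avg f) * f i) + avg f ^ 2 := by
      ext i; ring
    rw [this, avg_add (fun i => f i ^ 2 - (2 * avg f) * f i), avg_sub (fun i => f i ^ 2),
      avg_const_mul, avg_const hn]
    ring
  linarith

theorem avg_sq_sub_avg (hn : 0 < n) :
    (avg fun i => (f i - avg f) ^ 2) = (avg fun i => f i ^ 2) - avg f ^ 2 := by
  have : (fun i => (f i - avg f) ^ 2) = fun i => (f i ^ 2 - (2 * avg f) * f i) + avg f ^ 2 := by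
    ext i; ring
  rw [this, avg_add (fun i => f i ^ 2 - (2 * avg f) * f i), avg_sub (fun i => f i ^ 2),
    avg_const_mul, avg_const hn]
  ring

end Avg

theorem abs_dotProduct_le {T : ℕ} {u v : Fin T → ℝ} {a b : ℝ} (hu : ∀ t, |u t| ≤ a)
    (hv : ∀ t, |v t| ≤ b) : |u ⬝ᵥ v| ≤ T * (a * b) := by
  rw [dotProduct]
  refine (Finset.abs_sum_le_sum_abs _ _).trans ?_
  calc ∑ t, |u t * v t| ≤ ∑ _t : Fin T, a * b := Finset.sum_le_sum fun t _ => by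
        rw [abs_mul]
        exact mul_le_mul (hu t) (hv t) (abs_nonneg _) ((abs_nonneg _).trans (hu t))
    _ = _ := by simp

theorem abs_mul_sub_mul_le {a b c d L r : ℝ} (h1 : |a - c| ≤ r) (h2 : |b - d| ≤ r) (ha : |a| ≤ L)
    (hd : |d| ≤ L) : |a * b - c * d| ≤ 2 * L * r := by
  have e : a * b - c * d = a * (b - d) + (a - c) * d := by ring
  have hL : 0 ≤ L := (abs_nonneg _).trans ha
  have hr : 0 ≤ r := (abs_nonneg _).trans h1
  rw [e]
  calc _ ≤ |a * (b - d)| + |(a - c) * d| := abs_add_le _ _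
    _ ≤ L * r + r * L := by
      rw [abs_mul, abs_mul]
      gcongr
    _ = _ := by ring

theorem abs_dotProduct_sub_le {T : ℕ} {u v u' v' : Fin T → ℝ} {L r : ℝ}
    (h1 : ∀ t, |u t - u' t| ≤ r) (h2 : ∀ t, |v t - v' t| ≤ r) (hu : ∀ t, |u t| ≤ L)
    (hv : ∀ t, |v' t| ≤ L) : |u ⬝ᵥ v - u' ⬝ᵥ v'| ≤ T * (2 * L * r) := by
  rw [dotProduct, dotProduct, ← Finset.sum_sub_distrib]
  refine (Finset.abs_sum_le_sum_abs _ _).trans ?_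
  calc _ ≤ ∑ _t : Fin T, 2 * L * r :=
        Finset.sum_le_sum fun t _ => abs_mul_sub_mul_le (h1 t) (h2 t) (hu t) (hv t)
    _ = _ := by simp

/-- The score of one unit with weight `θ`, demeaned assignment `p` and demeaned residual `q`. -/
noncomputable def linScore {T : ℕ} (θ : ℝ) (p q : Fin T → ℝ) (A B : ℝ) (Pm Q : Fin T → ℝ) : ℝ :=
  θ * ((B - Q ⬝ᵥ p) + A * (p ⬝ᵥ q) - Pm ⬝ᵥ q)

theorem avg_linScore {n T : ℕ} (θ : Fin n → ℝ) (p q : Fin n → Fin T → ℝ) (A B : ℝ)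
    (Pm Q : Fin T → ℝ) :
    avg (fun i => linScore (θ i) (p i) (q i) A B Pm Q)
      = B * avg θ - (Q ⬝ᵥ fun t => avg fun i => θ i * p i t) + A * avg (fun i => θ i * (p i ⬝ᵥ q i))
        - Pm ⬝ᵥ fun t => avg fun i => θ i * q i t := by
  have e : (fun i => linScore (θ i) (p i) (q i) A B Pm Q) = fun i =>
      ((B * θ i - ∑ t, Q t * (θ i * p i t)) + A * (θ i * (p i ⬝ᵥ q i)))
        - ∑ t, Pm t * (θ i * q i t) := by
    ext i
    have h1 : ∑ t, Q t * (θ i * p i t) = θ i * (Q ⬝ᵥ p i) := by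
      rw [dotProduct, Finset.mul_sum]; exact Finset.sum_congr rfl fun _ _ => by ring
    have h2 : ∑ t, Pm t * (θ i * q i t) = θ i * (Pm ⬝ᵥ q i) := by
      rw [dotProduct, Finset.mul_sum]; exact Finset.sum_congr rfl fun _ _ => by ring
    rw [h1, h2, linScore]; ring
  rw [e, avg_sub (fun i => (B * θ i - ∑ t, Q t * (θ i * p i t)) + A * (θ i * (p i ⬝ᵥ q i))),
    avg_add (fun i => B * θ i - ∑ t, Q t * (θ i * p i t)), avg_sub (fun i => B * θ i),
    avg_const_mul, avg_const_mul, avg_sum, avg_sum]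
  simp only [avg_const_mul, dotProduct]

/-- The score is linear in (A, B, Pm, Q), so the bound is proportional to their size a. It serves
twice: with a of order one to bound the scores, and with a small to bound the effect of replacing
expectations by averages. -/
theorem abs_linScore_le {T : ℕ} {θ : ℝ} {p q : Fin T → ℝ} {A B : ℝ} {Pm Q : Fin T → ℝ} {L : ℝ}
    {a : ℝ} (hθ : |θ| ≤ L) (hp : ∀ t, |p t| ≤ L) (hq : ∀ t, |q t| ≤ L) (hpq : |p ⬝ᵥ q| ≤ L)
    (hA : |A| ≤ a) (hB : |B| ≤ a) (hP : ∀ t, |Pm t| ≤ a) (hQ : ∀ t, |Q t| ≤ a) :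
    |linScore θ p q A B Pm Q| ≤ L * (1 + L + 2 * T * L) * a := by
  have h1 := abs_dotProduct_le hQ hp
  have h2 := abs_dotProduct_le hP hq
  have hL : 0 ≤ L := (abs_nonneg _).trans hθ
  have ha : 0 ≤ a := (abs_nonneg _).trans hA
  have h3 : |A * (p ⬝ᵥ q)| ≤ a * L := by rw [abs_mul]; gcongr
  rw [linScore, abs_mul]
  have h4 : |(B - Q ⬝ᵥ p) + A * (p ⬝ᵥ q) - Pm ⬝ᵥ q| ≤ a + T * (a * L) + a * L + T * (a * L) := by
    refine (abs_sub _ _).trans (add_le_add ((abs_add_le _ _).trans (add_le_add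
      ((abs_sub _ _).trans (add_le_add hB h1)) h3)) h2)
  calc _ ≤ L * (a + T * (a * L) + a * L + T * (a * L)) := by gcongr
    _ = _ := by ring

theorem linScore_sub {T : ℕ} (θ : ℝ) (p q : Fin T → ℝ) (A B A' B' : ℝ) (Pm Q Pm' Q' : Fin T → ℝ) :
    linScore θ p q A B Pm Q - linScore θ p q A' B' Pm' Q'
      = linScore θ p q (A - A') (B - B') (Pm - Pm') (Q - Q') := by
  simp only [linScore, sub_dotProduct]; ring

/-- Squaring is Lipschitz with constant 2L + 1 on the relevant range; the factor 2 counts the mean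
of squares and the square of the mean. Only a lower bound matters, since an overestimated variance
widens the interval. -/
theorem sampleVariance_ge_of_close {n : ℕ} (hn : 0 < n) {v w : Fin n → ℝ} {L δ : ℝ} (hL : 0 ≤ L)
    (hv : ∀ i, |v i| ≤ L) (hwv : ∀ i, |w i - v i| ≤ δ) (hδ : δ ≤ 1) :
    avg (fun i => v i ^ 2) - avg v ^ 2 - 2 * ((2 * L + 1) * δ)
      ≤ avg (fun i => w i ^ 2) - avg w ^ 2 := by
  have hδ0 : 0 ≤ δ := (abs_nonneg _).trans (hwv ⟨0, hn⟩)
  have key : ∀ a b : ℝ, |a| ≤ L → |b - a| ≤ δ → |b ^ 2 - a ^ 2| ≤ (2 * L + 1) * δ := by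
    intro a b ha hb
    have e : b ^ 2 - a ^ 2 = (2 * a + (b - a)) * (b - a) := by ring
    rw [e, abs_mul]
    have : |2 * a + (b - a)| ≤ 2 * L + 1 := by
      refine (abs_add_le _ _).trans (add_le_add ?_ (hb.trans hδ))
      rw [abs_mul, abs_two]
      linarith
    gcongr
  have h1 : avg (fun i => v i ^ 2) - (2 * L + 1) * δ ≤ avg fun i => w i ^ 2 := by
    have h := abs_avg_le hn fun i => key _ _ (hv i) (hwv i)
    rw [avg_sub] at h
    linarith [(abs_le.1 h).1]
  have h2 : |avg w - avg v| ≤ δ := by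
    rw [← avg_sub]; exact abs_avg_le hn hwv
  have h3 := (abs_le.1 (key _ _ (abs_avg_le hn hv) h2)).2
  linarith

theorem denominator_ge_of_close {T : ℕ} {a b A Wm L r : ℝ} {P Pm : Fin T → ℝ} (d1 : |a - A| ≤ r)
    (d5 : |b - Wm| ≤ r) (d3 : ∀ t, |P t - Pm t| ≤ r) (hb : |b| ≤ L) (hA : |A| ≤ L)
    (hP : ∀ t, |P t| ≤ L) (hPm : ∀ t, |Pm t| ≤ L) :
    Wm * A - Pm ⬝ᵥ Pm - (T + 1) * (2 * L * r) ≤ b * a - P ⬝ᵥ P := by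
  have h1 := (abs_le.1 (abs_mul_sub_mul_le d5 d1 hb hA)).1
  have h2 := (abs_le.1 (abs_dotProduct_sub_le d3 d3 hP hPm)).2
  linarith

/-- The form is bilinear, so its second-order expansion is exact: what remains after the linear part
is (b - B)(a - A) - (P - Pm)·(Q - Qm). The linear part takes the value 2(BA - Pm·Qm) at the base
point, by Euler's identity for degree two. -/
theorem abs_numerator_sub_le {T : ℕ} {a b A B r : ℝ} {P Q Pm Qm : Fin T → ℝ} (d1 : |a - A| ≤ r)
    (d2 : |b - B| ≤ r) (d3 : ∀ t, |P t - Pm t| ≤ r) (d4 : ∀ t, |Q t - Qm t| ≤ r) :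
    |(b * a - P ⬝ᵥ Q) - (B * A - Pm ⬝ᵥ Qm)
      - ((B * a - Qm ⬝ᵥ P + A * b - Pm ⬝ᵥ Q) - 2 * (B * A - Pm ⬝ᵥ Qm))| ≤ (T + 1) * r ^ 2 := by
  have e : (b * a - P ⬝ᵥ Q) - (B * A - Pm ⬝ᵥ Qm)
      - ((B * a - Qm ⬝ᵥ P + A * b - Pm ⬝ᵥ Q) - 2 * (B * A - Pm ⬝ᵥ Qm))
      = (b - B) * (a - A) - (P - Pm) ⬝ᵥ (Q - Qm) := by
    simp only [sub_dotProduct, dotProduct_sub]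
    rw [dotProduct_comm Qm P]
    ring
  have hr0 : 0 ≤ r := (abs_nonneg _).trans d1
  have h1 : |(b - B) * (a - A)| ≤ r ^ 2 := by rw [abs_mul, sq]; gcongr
  have h2 : |(P - Pm) ⬝ᵥ (Q - Qm)| ≤ T * (r * r) := abs_dotProduct_le d3 d4
  rw [e]
  calc _ ≤ _ := abs_sub _ _
    _ ≤ r ^ 2 + T * (r * r) := add_le_add h1 h2
    _ = _ := by ring

/-- The gap (z² - q²)σ² ≥ (z² - q²)ν dominates all terms that carry a factor η. The condition η ≤ 1
lets η² be replaced by η. -/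
theorem sq_add_le_of_margin {q z σ ν L a η c : ℝ} (hq : 0 ≤ q) (hqz : q ≤ z) (hσL : σ ≤ L)
    (hν : ν ≤ σ ^ 2) (ha : 0 ≤ a) (hη : 0 ≤ η) (hη1 : η ≤ 1)
    (h : η * (2 * q * L * a + a ^ 2 + z ^ 2 * c) ≤ (z ^ 2 - q ^ 2) * ν) :
    (q * σ + a * η) ^ 2 ≤ z ^ 2 * (σ ^ 2 - η * c) := by
  have h3 : (z ^ 2 - q ^ 2) * ν ≤ (z ^ 2 - q ^ 2) * σ ^ 2 :=
    mul_le_mul_of_nonneg_left hν (sub_nonneg.2 (pow_le_pow_left₀ hq hqz 2))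
  have h4 : q * σ * (a * η) ≤ q * L * (a * η) := by gcongr
  have h5 : a ^ 2 * η ^ 2 ≤ a ^ 2 * η := by
    have : η ^ 2 ≤ η := by nlinarith
    gcongr
  have e : (q * σ + a * η) ^ 2 = q ^ 2 * σ ^ 2 + 2 * (q * σ * (a * η)) + a ^ 2 * η ^ 2 := by ring
  rw [e]
  linarith

set_option maxHeartbeats 1000000 in
/-- A finite-sample statement: when all the averages are close to their targets, the studentized
statistic built from the plug-in variance is controlled by the oracle one. -/
theorem sq_numerator_le_of_close {n T : ℕ} (hn : 2 ≤ n) {θ : Fin n → ℝ} {p q : Fin n → Fin T → ℝ}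
    {A B Wm : ℝ} {Pm Q : Fin T → ℝ} {L r d₀ η m₂ σ d q₀ z ν₀ C : ℝ} (hL : 1 ≤ L)
    (hθ : ∀ i, |θ i| ≤ L) (hp : ∀ i t, |p i t| ≤ L) (hq : ∀ i t, |q i t| ≤ L)
    (hpq : ∀ i, |p i ⬝ᵥ q i| ≤ L) (hpp : ∀ i, |p i ⬝ᵥ p i| ≤ L)
    (hv : ∀ i, |linScore (θ i) (p i) (q i) A B Pm Q| ≤ L)
    (hA : |A| ≤ L ^ 2) (hPm : ∀ t, |Pm t| ≤ L ^ 2)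
    (hN₀ : |2 * (B * A - Pm ⬝ᵥ Q)| ≤ L)
    (d1 : |avg θ - A| ≤ r) (d2 : |avg (fun i => θ i * (p i ⬝ᵥ q i)) - B| ≤ r)
    (d3 : ∀ t, |avg (fun i => θ i * p i t) - Pm t| ≤ r)
    (d4 : ∀ t, |avg (fun i => θ i * q i t) - Q t| ≤ r)
    (d5 : |avg (fun i => θ i * (p i ⬝ᵥ p i)) - Wm| ≤ r)
    (d6 : |avg (fun i => linScore (θ i) (p i) (q i) A B Pm Q) - 2 * (B * A - Pm ⬝ᵥ Q)| ≤ r)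
    (d7 : |avg (fun i => linScore (θ i) (p i) (q i) A B Pm Q ^ 2) - m₂| ≤ r)
    (hD₀ : d₀ ≤ Wm * A - Pm ⬝ᵥ Pm) (hd₀ : 0 < d₀)
    (hσm : σ ^ 2 ≤ m₂ - (2 * (B * A - Pm ⬝ᵥ Q)) ^ 2) (hσL : σ ≤ L)
    (hν : ν₀ ≤ σ ^ 2) (hq₀ : 0 ≤ q₀) (hqz : q₀ ≤ z)
    (hη1 : η ≤ 1) (hrη : r ≤ η) (hnr : √(n : ℝ) * r ^ 2 ≤ η)
    (hnN : √(n : ℝ) * |B * A - Pm ⬝ᵥ Q| ≤ η)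
    (hclt : √(n : ℝ) * |avg (fun i => linScore (θ i) (p i) (q i) A B Pm Q)
      - 2 * (B * A - Pm ⬝ᵥ Q)| ≤ q₀ * σ)
    (hd : d * (avg (fun i => θ i * (p i ⬝ᵥ p i)) * avg θ
        - (fun t => avg fun i => θ i * p i t) ⬝ᵥ (fun t => avg fun i => θ i * p i t))
      = avg (fun i => θ i * (p i ⬝ᵥ q i)) * avg θ
        - (fun t => avg fun i => θ i * p i t) ⬝ᵥ (fun t => avg fun i => θ i * q i t))
    (hC : C = L * (1 + L + 2 * T * L) + 2 * (T + 3) / d₀ * (2 * (T + 1) * L ^ 4))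
    (hη2 : 4 * (T + 1) * L ^ 2 * η ≤ d₀) (hη3 : C * η ≤ 1)
    (hη4 : η * (2 * q₀ * L * (T + 2) + (T + 2) ^ 2 + z ^ 2 * ((2 * L + 1) * (2 * C + 1)))
      ≤ (z ^ 2 - q₀ ^ 2) * ν₀) :
    0 < avg (fun i => θ i * (p i ⬝ᵥ p i)) * avg θ
        - (fun t => avg fun i => θ i * p i t) ⬝ᵥ (fun t => avg fun i => θ i * p i t) ∧
    n * (avg (fun i => θ i * (p i ⬝ᵥ q i)) * avg θ
        - (fun t => avg fun i => θ i * p i t) ⬝ᵥ (fun t => avg fun i => θ i * q i t)) ^ 2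
      ≤ z ^ 2 * ((avg fun i => (linScore (θ i) (p i) (q i) (avg θ)
            (avg (fun i => θ i * (p i ⬝ᵥ q i))) (fun t => avg fun i => θ i * p i t)
            (fun t => avg fun i => θ i * q i t)
          + d * linScore (θ i) (p i) (p i) (-avg θ) (-avg (fun i => θ i * (p i ⬝ᵥ p i)))
            (-fun t => avg fun i => θ i * p i t) (-fun t => avg fun i => θ i * p i t)) ^ 2)
        - (avg fun i => (linScore (θ i) (p i) (q i) (avg θ)
            (avg (fun i => θ i * (p i ⬝ᵥ q i))) (fun t => avg fun i => θ i * p i t)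
            (fun t => avg fun i => θ i * q i t)
          + d * linScore (θ i) (p i) (p i) (-avg θ) (-avg (fun i => θ i * (p i ⬝ᵥ p i)))
            (-fun t => avg fun i => θ i * p i t) (-fun t => avg fun i => θ i * p i t))) ^ 2) := by
  have hn0 : 0 < n := by omega
  have hL0 : 0 < L := by linarith
  have hr0 : 0 ≤ r := (abs_nonneg _).trans d1
  have hη0 : 0 ≤ η := hr0.trans hrη
  have hT0 : (0 : ℝ) ≤ T := Nat.cast_nonneg _
  have hsn1 : 1 ≤ √(n : ℝ) := by
    rw [Real.one_le_sqrt]; exact_mod_cast hn0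
  have hmul : ∀ a b : ℝ, |a| ≤ L → |b| ≤ L → |a * b| ≤ L ^ 2 := fun a b ha hb => by
    rw [abs_mul, sq]; gcongr
  have bθ : |avg θ| ≤ L := abs_avg_le hn0 hθ
  have bW : |avg (fun i => θ i * (p i ⬝ᵥ p i))| ≤ L ^ 2 :=
    abs_avg_le hn0 fun i => hmul _ _ (hθ i) (hpp i)
  have bP : ∀ t, |avg fun i => θ i * p i t| ≤ L ^ 2 := fun t =>
    abs_avg_le hn0 fun i => hmul _ _ (hθ i) (hp i t)
  have hLL : L ≤ L ^ 2 := by nlinarith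
  have ev := avg_linScore θ p q A B Pm Q
  have bv : |avg (fun i => linScore (θ i) (p i) (q i) A B Pm Q)| ≤ L := abs_avg_le hn0 hv
  set v : Fin n → ℝ := fun i => linScore (θ i) (p i) (q i) A B Pm Q with hvdef
  set mB := avg (fun i => θ i * (p i ⬝ᵥ q i))
  set mW := avg (fun i => θ i * (p i ⬝ᵥ p i))
  set mP : Fin T → ℝ := fun t => avg fun i => θ i * p i t
  set mQ : Fin T → ℝ := fun t => avg fun i => θ i * q i t
  set mθ := avg θ
  set N₀ := B * A - Pm ⬝ᵥ Q
  set D := mW * mθ - mP ⬝ᵥ mP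
  set N := mB * mθ - mP ⬝ᵥ mQ
  -- The smallness condition `hη2` says precisely that the deviation of the denominator is at most
  -- d₀/2.
  have hD : d₀ / 2 ≤ D := by
    have h := denominator_ge_of_close d1 d5 d3 bW hA bP hPm
    have h3 : (T + 1) * (2 * L ^ 2 * r) ≤ (T + 1) * (2 * L ^ 2 * η) := by gcongr
    simp only [D]
    linarith
  have hDpos : 0 < D := by linarith
  have hN : |N - N₀ - (avg v - 2 * N₀)| ≤ (T + 1) * r ^ 2 := by
    rw [ev]; exact abs_numerator_sub_le d1 d2 d3 d4
  have hNabs : |N| ≤ |N₀| + |avg v - 2 * N₀| + (T + 1) * r ^ 2 := by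
    have : N = N₀ + (avg v - 2 * N₀) + (N - N₀ - (avg v - 2 * N₀)) := by ring
    calc |N| = |N₀ + (avg v - 2 * N₀) + (N - N₀ - (avg v - 2 * N₀))| := by rw [← this]
      _ ≤ |N₀ + (avg v - 2 * N₀)| + |N - N₀ - (avg v - 2 * N₀)| := abs_add_le _ _
      _ ≤ _ := add_le_add (abs_add_le _ _) hN
  have hN₀η : |N₀| ≤ η := le_trans (le_mul_of_one_le_left (abs_nonneg _) hsn1) hnN
  have hr2 : (T + 1) * r ^ 2 ≤ (T + 1) * η := by
    have : r ^ 2 ≤ η := le_trans (le_mul_of_one_le_left (sq_nonneg _) hsn1) hnr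
    gcongr
  have hNη : |N| ≤ (T + 3) * η := by linarith
  have hdabs : |d| ≤ 2 * (T + 3) / d₀ * η := by
    have h1 : |d| * D = |N| := by rw [← hd, abs_mul, abs_of_pos hDpos]
    have h2 : |d| * (d₀ / 2) ≤ (T + 3) * η := by
      refine le_trans ?_ hNη
      rw [← h1]; gcongr
    rw [div_mul_eq_mul_div, le_div_iff₀ hd₀]
    linarith
  -- After scaling by √n, the bias costs η, the quadratic remainder costs (T + 1)η, and the linear
  -- part is controlled by the central limit event.
  have hsN : √(n : ℝ) * |N| ≤ q₀ * σ + (T + 2) * η := by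
    have h1 := mul_le_mul_of_nonneg_left hNabs (Real.sqrt_nonneg (n : ℝ))
    have h2 : (T + 1) * (√(n : ℝ) * r ^ 2) ≤ (T + 1) * η := by gcongr
    linarith
  refine ⟨hDpos, ?_⟩
  set w : Fin n → ℝ := fun i => linScore (θ i) (p i) (q i) mθ mB mP mQ
    + d * linScore (θ i) (p i) (p i) (-mθ) (-mW) (-mP) (-mP) with hw
  -- The plug-in score differs from the oracle score for two reasons: expectations become averages,
  -- and τ* becomes τ* + d. The two summands of C correspond to these.
  have hwv : ∀ i, |w i - v i| ≤ C * η := fun i => by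
    have e : w i - v i = linScore (θ i) (p i) (q i) (mθ - A) (mB - B) (mP - Pm) (mQ - Q)
        + d * linScore (θ i) (p i) (p i) (-mθ) (-mW) (-mP) (-mP) := by
      rw [← linScore_sub]; simp only [hw, hvdef]; ring
    have h1 : |linScore (θ i) (p i) (q i) (mθ - A) (mB - B) (mP - Pm) (mQ - Q)|
        ≤ L * (1 + L + 2 * T * L) * r :=
      abs_linScore_le (hθ i) (hp i) (hq i) (hpq i) d1 d2 d3 d4
    have bPneg : ∀ t, |(-mP) t| ≤ L ^ 2 := fun t => by
      rw [Pi.neg_apply, abs_neg]; exact bP t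
    have h2 : |linScore (θ i) (p i) (p i) (-mθ) (-mW) (-mP) (-mP)|
        ≤ L * (1 + L + 2 * T * L) * L ^ 2 :=
      abs_linScore_le (hθ i) (hp i) (hp i) (hpp i) (by rw [abs_neg]; linarith)
        (by rw [abs_neg]; exact bW) bPneg bPneg
    have h3 : L * (1 + L + 2 * T * L) * L ^ 2 ≤ 2 * (T + 1) * L ^ 4 := by
      have : 1 + L + 2 * T * L ≤ 2 * (T + 1) * L := by nlinarith
      calc L * (1 + L + 2 * T * L) * L ^ 2 ≤ L * (2 * (T + 1) * L) * L ^ 2 := by gcongr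
        _ = _ := by ring
    rw [e]
    calc _ ≤ _ := abs_add_le _ _
      _ ≤ L * (1 + L + 2 * T * L) * η
          + 2 * (T + 3) / d₀ * η * (2 * (T + 1) * L ^ 4) := by
        rw [abs_mul]
        refine add_le_add (h1.trans (by gcongr)) ?_
        exact mul_le_mul hdabs (h2.trans h3) (abs_nonneg _) (by positivity)
      _ = _ := by rw [hC]; ring
  have hC0 : 0 ≤ C := by rw [hC]; positivity
  have hva2 : avg v ^ 2 ≤ (2 * N₀) ^ 2 + 2 * L * η := by
    have h1 := abs_le.1 (d6.trans hrη)
    have h2 : |avg v + 2 * N₀| ≤ 2 * L := (abs_add_le _ _).trans (by linarith)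
    have h3 : |(avg v + 2 * N₀) * (avg v - 2 * N₀)| ≤ 2 * L * η := by
      rw [abs_mul]
      exact mul_le_mul h2 (d6.trans hrη) (abs_nonneg _) (by positivity)
    have e : avg v ^ 2 = (2 * N₀) ^ 2 + (avg v + 2 * N₀) * (avg v - 2 * N₀) := by ring
    rw [e]
    linarith [(abs_le.1 h3).2]
  have hd7 := (abs_le.1 (d7.trans hrη)).1
  -- The loss is η from the second moments, 2Lη from the squared mean, and 2(2L + 1)Cη from passing
  -- from oracle to plug-in scores.
  have hvar : σ ^ 2 - η * ((2 * L + 1) * (2 * C + 1)) ≤ avg (fun i => w i ^ 2) - avg w ^ 2 := by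
    have := sampleVariance_ge_of_close hn0 hL0.le hv hwv hη3
    change avg (fun i => v i ^ 2) - avg v ^ 2 - 2 * ((2 * L + 1) * (C * η)) ≤ _ at this
    linarith
  have hfin : (√(n : ℝ) * |N|) ^ 2 ≤ z ^ 2 * (avg (fun i => w i ^ 2) - avg w ^ 2) := by
    have h1 : (√(n : ℝ) * |N|) ^ 2 ≤ (q₀ * σ + (T + 2) * η) ^ 2 := by gcongr
    refine h1.trans ((sq_add_le_of_margin hq₀ hqz hσL hν (by positivity) hη0 hη1 hη4).trans ?_)
    exact mul_le_mul_of_nonneg_left hvar (sq_nonneg z)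
  rwa [mul_pow, sq_abs, Real.sq_sqrt (Nat.cast_nonneg _)] at hfin

/-! ### The centering matrix and the estimator in terms of demeaned vectors -/

theorem centering_mulVec_apply {T : ℕ} (v : Fin T → ℝ) (t : Fin T) :
    (centering T *ᵥ v) t = v t - (1 / (T : ℝ)) * ∑ s, v s := by
  rw [centering, Matrix.sub_mulVec, Matrix.one_mulVec, Matrix.smul_mulVec, Pi.sub_apply,
    Pi.smul_apply, smul_eq_mul]
  simp [Matrix.mulVec, dotProduct]

theorem sum_centering_mulVec {T : ℕ} (hT : 0 < T) (v : Fin T → ℝ) :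
    ∑ t, (centering T *ᵥ v) t = 0 := by
  have : (T : ℝ) ≠ 0 := by exact_mod_cast hT.ne'
  simp only [centering_mulVec_apply, Finset.sum_sub_distrib, Finset.sum_const, Finset.card_univ,
    Fintype.card_fin, nsmul_eq_mul]
  field_simp
  ring

/-- J is a symmetric projection: the image of J sums to zero, so the mean subtracted from the second
vector does not contribute. -/
theorem centering_mulVec_dotProduct {T : ℕ} (hT : 0 < T) (u v : Fin T → ℝ) :
    (centering T *ᵥ u) ⬝ᵥ (centering T *ᵥ v) = (centering T *ᵥ u) ⬝ᵥ v := by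
  have h : ∀ t, (centering T *ᵥ v) t = v t - (1 / (T : ℝ)) * ∑ s, v s := centering_mulVec_apply v
  simp only [dotProduct]
  simp_rw [h, mul_sub, Finset.sum_sub_distrib, ← Finset.sum_mul, sum_centering_mulVec hT]
  simp

theorem dotProduct_centering_mulVec {T : ℕ} (hT : 0 < T) (u v : Fin T → ℝ) :
    u ⬝ᵥ (centering T *ᵥ v) = (centering T *ᵥ u) ⬝ᵥ (centering T *ᵥ v) := by
  rw [dotProduct_comm u, dotProduct_comm (centering T *ᵥ u), centering_mulVec_dotProduct hT]

theorem abs_centering_mulVec_le {T : ℕ} {v : Fin T → ℝ} {a : ℝ} (h : ∀ t, |v t| ≤ a) (t : Fin T) :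
    |(centering T *ᵥ v) t| ≤ 2 * a := by
  rw [centering_mulVec_apply]
  have hT : 0 < T := t.pos
  have := abs_avg_le hT h
  refine (abs_sub _ _).trans ?_
  have h1 := h t
  change |v t| + |avg v| ≤ _
  linarith

/-- The demeaned assignment path `J w`. -/
noncomputable def demeaned {T : ℕ} (w : AssignPath T) : Fin T → ℝ := centering T *ᵥ pathVec w

/-- The demeaned residual `J (Y - m̂ - τ W)`. -/
noncomputable def residual {T : ℕ} (τ : ℝ) (e : UnitEst T) (z : UnitData T) : Fin T → ℝ :=
  centering T *ᵥ (adjusted e z - τ • pathVec (assign z))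

theorem residual_add {T : ℕ} (τ d : ℝ) (e : UnitEst T) (z : UnitData T) :
    residual (τ + d) e z = residual τ e z - d • demeaned (assign z) := by
  simp only [residual, demeaned, Matrix.mulVec_sub, Matrix.mulVec_add, Matrix.mulVec_smul, add_smul]
  module

section Gamma

variable {n T : ℕ} (Pi : AssignPath T → ℝ) (e : Fin n → UnitEst T) (z : Fin n → UnitData T) (τ : ℝ)

theorem gammaWW_eq (hT : 0 < T) : gammaWW Pi e z
    = avg fun i => theta Pi (e i) (z i) * (demeaned (assign (z i)) ⬝ᵥ demeaned (assign (z i))) := by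
  rw [gammaWW, avg]
  congr 2; ext i
  rw [dotProduct_centering_mulVec hT]; rfl

theorem gammaW_eq : gammaW Pi e z
    = fun t => avg fun i => theta Pi (e i) (z i) * demeaned (assign (z i)) t := by
  ext t; simp [gammaW, avg, demeaned]

theorem gammaWY_sub (hT : 0 < T) : gammaWY Pi e z - τ * gammaWW Pi e z
    = avg fun i => theta Pi (e i) (z i) * (demeaned (assign (z i)) ⬝ᵥ residual τ (e i) (z i)) := by
  rw [gammaWW, gammaWY]
  change avg _ - τ * avg _ = _
  rw [← avg_const_mul, ← avg_sub]
  congr 1; ext i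
  rw [demeaned, residual, ← dotProduct_centering_mulVec hT, Matrix.mulVec_sub, Matrix.mulVec_smul,
    dotProduct_sub, dotProduct_smul, smul_eq_mul]
  ring

theorem gammaY_sub : gammaY Pi e z - τ • gammaW Pi e z
    = fun t => avg fun i => theta Pi (e i) (z i) * residual τ (e i) (z i) t := by
  ext t
  have h1 : gammaY Pi e z t
      = avg fun i => theta Pi (e i) (z i) * (centering T *ᵥ adjusted (e i) (z i)) t := by
    simp [gammaY, avg]
  rw [_root_.Pi.sub_apply, _root_.Pi.smul_apply, h1, gammaW_eq, smul_eq_mul, ← avg_const_mul, ← avg_sub]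
  congr 1; ext i
  simp only [residual, demeaned, Matrix.mulVec_sub, Matrix.mulVec_smul, _root_.Pi.sub_apply,
    _root_.Pi.smul_apply, smul_eq_mul]
  ring

theorem score_eq_linScore (hT : 0 < T) (e : UnitEst T) (z : UnitData T) (gθ gww gwy : ℝ)
    (gw gy : Fin T → ℝ) : score Pi e z gθ gww gwy gw gy τ
      = linScore (theta Pi e z) (demeaned (assign z)) (residual τ e z) gθ (gwy - τ * gww) gw
        (gy - τ • gw) := by
  rw [score, linScore, dotProduct_centering_mulVec hT (pathVec (assign z))]
  rfl

/-- Changing τ by d alters the score exactly affinely in d, because in every product only one of the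
two factors depends on τ. The slope is itself a score, with the residual q replaced by the path p.
-/
theorem linScore_shift (θ : ℝ) (p q : Fin T → ℝ) (A B W d : ℝ) (P Q : Fin T → ℝ) :
    linScore θ p (q - d • p) A (B - d * W) P (Q - d • P)
      = linScore θ p q A B P Q + d * linScore θ p p (-A) (-W) (-P) (-P) := by
  simp only [linScore, dotProduct_sub, sub_dotProduct, dotProduct_smul, smul_dotProduct, smul_eq_mul,
    neg_dotProduct]
  ring

theorem plugInScore_add (hT : 0 < T) (d : ℝ) (i : Fin n) : plugInScore Pi e z (τ + d) i
      = linScore (theta Pi (e i) (z i)) (demeaned (assign (z i))) (residual τ (e i) (z i))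
          (gammaTheta Pi e z) (gammaWY Pi e z - τ * gammaWW Pi e z) (gammaW Pi e z)
          (gammaY Pi e z - τ • gammaW Pi e z)
        + d * linScore (theta Pi (e i) (z i)) (demeaned (assign (z i))) (demeaned (assign (z i)))
          (-gammaTheta Pi e z) (-gammaWW Pi e z) (-gammaW Pi e z) (-gammaW Pi e z) := by
  rw [plugInScore, score_eq_linScore Pi _ hT, residual_add, ← linScore_shift]
  congr 1
  · ring
  · rw [add_smul]; abel

end Gamma

theorem eq_zero_of_forall_quadratic_nonneg {b c : ℝ} (h : ∀ s : ℝ, 0 ≤ s * b + s ^ 2 * c) : b = 0 := by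
  by_contra hb
  have hpos : 0 < |b| := abs_pos.2 hb
  have hc : 0 < |c| + 1 := by positivity
  -- A near-minimizer of the quadratic; the extra 1 keeps the denominator positive when c = 0 and
  -- makes c - (|c| + 1) negative.
  have h1 := h (-(b / (|c| + 1)))
  have h2 := neg_le_abs c
  have h3 := le_abs_self c
  have e : -(b / (|c| + 1)) * b + (-(b / (|c| + 1))) ^ 2 * c
      = b ^ 2 / (|c| + 1) ^ 2 * (c - (|c| + 1)) := by field_simp; ring
  rw [e] at h1
  have h4 : 0 < b ^ 2 / (|c| + 1) ^ 2 := by positivity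
  nlinarith

/-- The normal equation for the treatment coefficient of the weighted two-way regression. -/
theorem IsRIPWEstimate.denom_mul {n T : ℕ} (hT : 0 < T) (hn : 0 < n) {Pi : AssignPath T → ℝ}
    {e : Fin n → UnitEst T} {z : Fin n → UnitData T} {τ : ℝ} (h : IsRIPWEstimate Pi e z τ) :
    τ * denom Pi e z
      = gammaWY Pi e z * gammaTheta Pi e z - gammaW Pi e z ⬝ᵥ gammaY Pi e z := by
  obtain ⟨μ, a, g, ha, hg, hmin⟩ := h
  have hT0 : (T : ℝ) ≠ 0 := by exact_mod_cast hT.ne'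
  have hn0 : (n : ℝ) ≠ 0 := by exact_mod_cast hn.ne'
  set θ : Fin n → ℝ := fun i => theta Pi (e i) (z i) with hθ
  set p : Fin n → Fin T → ℝ := fun i => demeaned (assign (z i)) with hp
  set y : Fin n → Fin T → ℝ := fun i => adjusted (e i) (z i) with hy
  set x : Fin n → Fin T → ℝ := fun i => pathVec (assign (z i)) with hx
  set A := gammaTheta Pi e z with hA
  set G := gammaW Pi e z with hG
  have hGeq : G = fun t => avg fun i => θ i * p i t := gammaW_eq Pi e z
  have hGsum : ∑ t, G t = 0 := by
    rw [hGeq, ← avg_sum]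
    simp only [← Finset.mul_sum, hp, demeaned, sum_centering_mulVec hT]
    simp [avg]
  set xbar : Fin n → ℝ := fun i => (1 / (T : ℝ)) * ∑ t, x i t with hxbar
  have hpx : ∀ i t, p i t = x i t - xbar i := fun i t => centering_mulVec_apply _ t
  -- the perturbation direction
  set hdir : Fin n → Fin T → ℝ := fun i t => A * p i t - G t with hdir_def
  set ε : Fin n → Fin T → ℝ := fun i t => y i t - μ - a i - g t - x i t * τ with hε
  have key : ∀ s : ℝ, 0 ≤ s * (-2 * ∑ i, ∑ t, ε i t * hdir i t * θ i)
      + s ^ 2 * ∑ i, ∑ t, hdir i t ^ 2 * θ i := by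
    intro s
    -- The direction A p_it - G_t is A times the residual of W_it after weighted projection on unit
    -- and time effects; multiplying by A avoids a division. It is a combination of the regressors,
    -- and the shifts of a and g are centred to respect the constraints.
    have h1 := hmin (τ + s * A) (μ - s * A * avg xbar)
      (fun i => a i - s * A * (xbar i - avg xbar)) (fun t => g t - s * G t)
      (by
        rw [Finset.sum_sub_distrib, ha, ← Finset.mul_sum, Finset.sum_sub_distrib]
        simp [avg]; field_simp; simp)
      (by rw [Finset.sum_sub_distrib, hg, ← Finset.mul_sum, hGsum]; simp)
    have e1 : loss Pi e z τ μ a g = ∑ i, ∑ t, ε i t ^ 2 * θ i := rfl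
    have e2 : loss Pi e z (τ + s * A) (μ - s * A * avg xbar)
        (fun i => a i - s * A * (xbar i - avg xbar)) (fun t => g t - s * G t)
        = ∑ i, ∑ t, (ε i t - s * hdir i t) ^ 2 * θ i := by
      refine Finset.sum_congr rfl fun i _ => Finset.sum_congr rfl fun t _ => ?_
      have : y i t - (μ - s * A * avg xbar) - (a i - s * A * (xbar i - avg xbar))
          - (g t - s * G t) - x i t * (τ + s * A) = ε i t - s * hdir i t := by
        simp only [hε, hdir_def, hpx]; ring
      rw [← this]
    rw [e1, e2] at h1
    have e3 : ∑ i, ∑ t, (ε i t - s * hdir i t) ^ 2 * θ i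
        = ∑ i, ∑ t, ε i t ^ 2 * θ i + (s * (-2 * ∑ i, ∑ t, ε i t * hdir i t * θ i)
          + s ^ 2 * ∑ i, ∑ t, hdir i t ^ 2 * θ i) := by
      simp only [Finset.mul_sum, ← Finset.sum_add_distrib]
      refine Finset.sum_congr rfl fun i _ => Finset.sum_congr rfl fun t _ => ?_
      ring
    linarith
  have hzero := eq_zero_of_forall_quadratic_nonneg key
  -- evaluate the first-order condition
  have hrow : ∀ i, ∑ t, hdir i t = 0 := fun i => by
    simp only [hdir_def, Finset.sum_sub_distrib, hGsum, ← Finset.mul_sum, hp, demeaned,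
      sum_centering_mulVec hT]
    simp
  -- Vanishing row sums of the direction remove μ and a_i. The time effects g remain for a single
  -- unit and cancel only after averaging over i.
  have hi : ∀ i, ∑ t, ε i t * hdir i t * θ i
      = (A * (θ i * (p i ⬝ᵥ y i)) - ∑ t, G t * (θ i * (centering T *ᵥ y i) t))
        - (A * ∑ t, g t * (θ i * p i t) - (∑ t, g t * G t) * θ i)
        - τ * (A * (θ i * (p i ⬝ᵥ p i)) - ∑ t, G t * (θ i * p i t)) := by
    intro i
    have e1 : ∑ t, ε i t * hdir i t * θ i
        = θ i * (∑ t, y i t * hdir i t - (μ + a i) * ∑ t, hdir i t - ∑ t, g t * hdir i t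
          - τ * ∑ t, x i t * hdir i t) := by
      simp only [Finset.mul_sum, ← Finset.sum_sub_distrib]
      refine Finset.sum_congr rfl fun t _ => ?_
      simp only [hε]; ring
    have e2 : ∀ u : Fin T → ℝ, ∑ t, u t * hdir i t = A * (p i ⬝ᵥ u) - ∑ t, G t * u t := by
      intro u
      simp only [hdir_def, dotProduct, Finset.mul_sum, ← Finset.sum_sub_distrib]
      exact Finset.sum_congr rfl fun t _ => by ring
    have e3 : ∀ u : Fin T → ℝ, ∑ t, G t * (centering T *ᵥ u) t = ∑ t, G t * u t := by
      intro u
      simp only [centering_mulVec_apply, mul_sub, Finset.sum_sub_distrib, ← Finset.sum_mul, hGsum]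
      simp
    have e4 : p i ⬝ᵥ x i = p i ⬝ᵥ p i := (centering_mulVec_dotProduct hT _ _).symm
    have e5 : ∀ u : Fin T → ℝ, ∑ t, G t * (θ i * u t) = θ i * ∑ t, G t * u t := by
      intro u; rw [Finset.mul_sum]; exact Finset.sum_congr rfl fun t _ => by ring
    have e6 : ∑ t, g t * (θ i * p i t) = θ i * (p i ⬝ᵥ g) := by
      rw [dotProduct, Finset.mul_sum]; exact Finset.sum_congr rfl fun t _ => by ring
    have e7 : ∑ t, G t * p i t = ∑ t, G t * x i t := e3 (x i)
    have e8 : ∑ t, G t * g t = ∑ t, g t * G t := Finset.sum_congr rfl fun t _ => mul_comm _ _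
    rw [e1, hrow, e2, e2, e2, e4, e5, e5, e6, e3, e7, e8]
    ring
  have hsum : avg (fun i => ∑ t, ε i t * hdir i t * θ i) = 0 := by
    rw [avg]
    have : ∑ i, ∑ t, ε i t * hdir i t * θ i = 0 := by linarith
    rw [this, mul_zero]
  have hY : gammaY Pi e z = fun t => avg fun i => θ i * (centering T *ᵥ y i) t := by
    have := gammaY_sub Pi e z 0
    simp only [residual, zero_smul, sub_zero] at this
    exact this
  have hWY : gammaWY Pi e z = avg fun i => θ i * (p i ⬝ᵥ y i) := by
    have := gammaWY_sub Pi e z 0 hT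
    simp only [residual, zero_mul, zero_smul, sub_zero, demeaned] at this
    rw [this]
    simp only [centering_mulVec_dotProduct hT]
    rfl
  have hWW := gammaWW_eq Pi e z hT
  have hAavg : avg θ = A := rfl
  have hGt : ∀ t, avg (fun i => θ i * p i t) = G t := fun t => (congrFun hGeq t).symm
  simp only [hi] at hsum
  rw [avg_sub (fun i => _ - _), avg_sub (fun i => _ - _), avg_sub (fun i => A * _), avg_const_mul,
    avg_sum, avg_sub (fun i => A * _), avg_const_mul, avg_sum, avg_const_mul, avg_const_mul,
    avg_sub (fun i => A * _), avg_const_mul, avg_sum] at hsum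
  simp only [avg_const_mul, hGt, hAavg] at hsum
  change gammaWW Pi e z = avg (fun i => θ i * (p i ⬝ᵥ p i)) at hWW
  rw [denom, hWY, hY, hWW, ← hA, ← hG]
  simp only [dotProduct] at hsum ⊢
  linear_combination -hsum

/-- The closed form of the estimator. -/
noncomputable def closedForm {n T : ℕ} (Pi : AssignPath T → ℝ) (e : Fin n → UnitEst T)
    (z : Fin n → UnitData T) : ℝ :=
  (gammaWY Pi e z * gammaTheta Pi e z - gammaW Pi e z ⬝ᵥ gammaY Pi e z) / denom Pi e z

/-- Since 1/(n-1) ≥ 1/n, it suffices to bound the squared statistic by the variance with divisor n;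
the condition n ≥ 2 keeps 1/(n-1) positive. -/
theorem mem_waldInterval_of_sq_le {n T : ℕ} (hn : 2 ≤ n) {Pi : AssignPath T → ℝ}
    {e : Fin n → UnitEst T} {z : Fin n → UnitData T} {τ τhat α : ℝ}
    (hz : 0 ≤ normalQuantile (1 - α / 2)) (hD : 0 < denom Pi e z)
    (h : n * ((τhat - τ) * denom Pi e z) ^ 2 ≤ normalQuantile (1 - α / 2) ^ 2 *
      (avg (fun i => plugInScore Pi e z τhat i ^ 2) - avg (plugInScore Pi e z τhat) ^ 2)) :
    τ ∈ waldInterval Pi e z τhat α := by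
  have hn0 : 0 < n := by omega
  have hn' : (0 : ℝ) < n := by exact_mod_cast hn0
  have hn2 : (2 : ℝ) ≤ n := by exact_mod_cast hn
  set w := plugInScore Pi e z τhat with hw
  set q := normalQuantile (1 - α / 2)
  set D := denom Pi e z
  set s := sigmaHat Pi e z τhat with hs
  have hs0 : 0 ≤ s := Real.sqrt_nonneg _
  have hs2 : avg (fun i => w i ^ 2) - avg w ^ 2 ≤ s ^ 2 := by
    rw [← avg_sq_sub_avg hn0, hs, sigmaHat, Real.sq_sqrt]
    · change (1 / (n : ℝ)) * _ ≤ (1 / ((n : ℝ) - 1)) * _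
      refine mul_le_mul_of_nonneg_right ?_ (Finset.sum_nonneg fun i _ => sq_nonneg _)
      exact one_div_le_one_div_of_le (by linarith) (by linarith)
    · refine mul_nonneg (one_div_nonneg.2 (by linarith)) (Finset.sum_nonneg fun i _ => sq_nonneg _)
  have h1 : (√(n : ℝ) * (|τhat - τ| * D)) ^ 2 ≤ (q * s) ^ 2 := by
    rw [mul_pow, mul_pow, sq_abs, Real.sq_sqrt hn'.le, mul_pow, ← mul_pow _ D]
    exact h.trans (mul_le_mul_of_nonneg_left hs2 (sq_nonneg _))
  have h2 : √(n : ℝ) * (|τhat - τ| * D) ≤ q * s :=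
    (pow_le_pow_iff_left₀ (by positivity) (by positivity) two_ne_zero).1 h1
  have h3 : |τhat - τ| ≤ q * s / (√(n : ℝ) * D) := by
    rw [le_div_iff₀ (mul_pos (Real.sqrt_pos.2 hn') hD)]
    linarith
  have h4 := abs_le.1 h3
  exact ⟨by linarith [h4.2], by linarith [h4.1]⟩

/-! ### Measurability -/

section Measurability

variable {T : ℕ}

theorem measurable_assign : Measurable (assign (T := T)) := measurable_snd.comp measurable_snd

theorem measurable_potential (b : Bool) (t : Fin T) :
    Measurable fun z : UnitData T => potential b z t := by
  cases b
  · exact (measurable_pi_apply t).comp (measurable_fst.comp measurable_snd)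
  · exact (measurable_pi_apply t).comp measurable_fst

theorem measurable_comp_assign {β : Type*} [MeasurableSpace β] (f : AssignPath T → β) :
    Measurable fun z : UnitData T => f (assign z) :=
  (Measurable.of_discrete (f := f)).comp measurable_assign

theorem measurable_eval_assign :
    Measurable fun x : UnitEst T × UnitData T => x.1.1 (assign x.2) := by
  have : Measurable fun x : (AssignPath T → ℝ) × AssignPath T => x.1 x.2 :=
    measurable_from_prod_countable_left fun w => measurable_pi_apply w
  exact this.comp (Measurable.prodMk (measurable_fst.comp measurable_fst)
    (measurable_assign.comp measurable_snd))

theorem measurable_theta (Pi : AssignPath T → ℝ) :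
    Measurable fun x : UnitEst T × UnitData T => theta Pi x.1 x.2 :=
  ((measurable_comp_assign Pi).comp measurable_snd).div measurable_eval_assign

theorem measurable_observed (t : Fin T) : Measurable fun z : UnitData T => observed z t :=
  ((measurable_potential true t).mul (measurable_comp_assign fun w => pathVec w t)).add
    ((measurable_potential false t).mul ((measurable_comp_assign fun w => pathVec w t).const_sub 1))

theorem measurable_adjusted (t : Fin T) :
    Measurable fun x : UnitEst T × UnitData T => adjusted x.1 x.2 t :=
  ((measurable_observed t).comp measurable_snd).sub
    ((measurable_pi_apply t).comp (measurable_snd.comp measurable_fst))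

theorem measurable_residual (τ : ℝ) (t : Fin T) :
    Measurable fun x : UnitEst T × UnitData T => residual τ x.1 x.2 t := by
  have h : ∀ s, Measurable fun x : UnitEst T × UnitData T =>
      (adjusted x.1 x.2 - τ • pathVec (assign x.2)) s := fun s =>
    (measurable_adjusted s).sub
      (((measurable_comp_assign fun w => pathVec w s).comp measurable_snd).const_mul τ)
  simp only [residual, centering_mulVec_apply]
  exact (h t).sub ((Finset.measurable_fun_sum _ fun s _ => h s).const_mul _)

theorem measurable_demeaned (t : Fin T) :
    Measurable fun z : UnitData T => demeaned (assign z) t :=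
  measurable_comp_assign fun w => demeaned w t

theorem measurable_dotProduct {α : Type*} [MeasurableSpace α] {u v : α → Fin T → ℝ}
    (hu : ∀ t, Measurable fun a => u a t) (hv : ∀ t, Measurable fun a => v a t) :
    Measurable fun a => u a ⬝ᵥ v a :=
  Finset.measurable_fun_sum _ fun t _ => (hu t).mul (hv t)

theorem measurable_linScore {α : Type*} [MeasurableSpace α] {θ A B : α → ℝ}
    {p q P Q : α → Fin T → ℝ} (hθ : Measurable θ) (hA : Measurable A) (hB : Measurable B)
    (hp : ∀ t, Measurable fun a => p a t) (hq : ∀ t, Measurable fun a => q a t)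
    (hP : ∀ t, Measurable fun a => P a t) (hQ : ∀ t, Measurable fun a => Q a t) :
    Measurable fun a => linScore (θ a) (p a) (q a) (A a) (B a) (P a) (Q a) :=
  hθ.mul (((hB.sub (measurable_dotProduct hQ hp)).add (hA.mul (measurable_dotProduct hp hq))).sub
    (measurable_dotProduct hP hq))

theorem measurable_avg {α : Type*} [MeasurableSpace α] {n : ℕ} {f : α → Fin n → ℝ}
    (hf : ∀ i, Measurable fun a => f a i) : Measurable fun a => avg (f a) :=
  (Finset.measurable_fun_sum _ fun i _ => hf i).const_mul _

end Measurability

section JointMeasurability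

variable {n T : ℕ} (Pi : AssignPath T → ℝ)

theorem measurable_pair (i : Fin n) :
    Measurable fun x : (Fin n → UnitEst T) × (Fin n → UnitData T) => (x.1 i, x.2 i) := by
  fun_prop

theorem measurable_theta_apply (i : Fin n) : Measurable
    fun x : (Fin n → UnitEst T) × (Fin n → UnitData T) => theta Pi (x.1 i) (x.2 i) :=
  (measurable_theta Pi).comp (measurable_pair i)

theorem measurable_demeaned_apply (i : Fin n) (t : Fin T) : Measurable
    fun x : (Fin n → UnitEst T) × (Fin n → UnitData T) => demeaned (assign (x.2 i)) t :=
  (measurable_demeaned t).comp (measurable_snd.comp (measurable_pair i))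

theorem measurable_residual_apply (τ : ℝ) (i : Fin n) (t : Fin T) : Measurable
    fun x : (Fin n → UnitEst T) × (Fin n → UnitData T) => residual τ (x.1 i) (x.2 i) t := by
  have h := measurable_residual (T := T) τ t
  generalize residual τ = r at *
  exact h.comp (measurable_pair i)

theorem measurable_gammaTheta : Measurable
    fun x : (Fin n → UnitEst T) × (Fin n → UnitData T) => gammaTheta Pi x.1 x.2 :=
  measurable_avg fun i => measurable_theta_apply Pi i

theorem measurable_gammaW (t : Fin T) : Measurable
    fun x : (Fin n → UnitEst T) × (Fin n → UnitData T) => gammaW Pi x.1 x.2 t := by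
  simp only [gammaW_eq]
  exact measurable_avg fun i => (measurable_theta_apply Pi i).mul
    (measurable_demeaned_apply i t)

theorem measurable_gammaWW (hT : 0 < T) : Measurable
    fun x : (Fin n → UnitEst T) × (Fin n → UnitData T) => gammaWW Pi x.1 x.2 := by
  simp only [gammaWW_eq _ _ _ hT]
  exact measurable_avg fun i => (measurable_theta_apply Pi i).mul
    ((measurable_comp_assign fun w => demeaned w ⬝ᵥ demeaned w).comp
      (measurable_snd.comp (measurable_pair i)))

theorem measurable_gammaWY (hT : 0 < T) : Measurable
    fun x : (Fin n → UnitEst T) × (Fin n → UnitData T) => gammaWY Pi x.1 x.2 := by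
  have h := fun x : (Fin n → UnitEst T) × (Fin n → UnitData T) => gammaWY_sub Pi x.1 x.2 0 hT
  simp only [zero_mul, sub_zero] at h
  simp only [h]
  exact measurable_avg fun i => (measurable_theta_apply Pi i).mul
    (measurable_dotProduct (measurable_demeaned_apply i) (measurable_residual_apply 0 i))

theorem measurable_gammaY (t : Fin T) : Measurable
    fun x : (Fin n → UnitEst T) × (Fin n → UnitData T) => gammaY Pi x.1 x.2 t := by
  have h := fun x : (Fin n → UnitEst T) × (Fin n → UnitData T) =>
    congrFun (gammaY_sub Pi x.1 x.2 0) t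
  simp only [zero_smul, sub_zero] at h
  simp only [h]
  exact measurable_avg fun i => (measurable_theta_apply Pi i).mul
    (measurable_residual_apply 0 i t)

theorem measurable_denom (hT : 0 < T) : Measurable
    fun x : (Fin n → UnitEst T) × (Fin n → UnitData T) => denom Pi x.1 x.2 :=
  ((measurable_gammaWW Pi hT).mul (measurable_gammaTheta Pi)).sub
    (measurable_dotProduct (measurable_gammaW Pi) (measurable_gammaW Pi))

theorem measurable_closedForm (hT : 0 < T) : Measurable
    fun x : (Fin n → UnitEst T) × (Fin n → UnitData T) => closedForm Pi x.1 x.2 :=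
  (((measurable_gammaWY Pi hT).mul (measurable_gammaTheta Pi)).sub
    (measurable_dotProduct (measurable_gammaW Pi) (measurable_gammaY Pi))).div
    (measurable_denom Pi hT)

theorem measurable_plugInScore_closedForm (hT : 0 < T) (i : Fin n) : Measurable
    fun x : (Fin n → UnitEst T) × (Fin n → UnitData T) =>
      plugInScore Pi x.1 x.2 (closedForm Pi x.1 x.2) i := by
  -- Expanding at the base point τ = 0, where the score is affine in the estimate, reduces the claim
  -- to measurability of the averages and of the closed form.
  have h := fun x : (Fin n → UnitEst T) × (Fin n → UnitData T) =>
    plugInScore_add Pi x.1 x.2 0 hT (closedForm Pi x.1 x.2) i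
  simp only [zero_add, zero_mul, zero_smul, sub_zero] at h
  simp only [h]
  have hθ := measurable_theta_apply (n := n) Pi i
  have hp := measurable_demeaned_apply (n := n) (T := T) i
  have hq := measurable_residual_apply (n := n) (T := T) 0 i
  refine (measurable_linScore hθ (measurable_gammaTheta Pi) (measurable_gammaWY Pi hT) hp hq
    (measurable_gammaW Pi) (measurable_gammaY Pi)).add ((measurable_closedForm Pi hT).mul
    (measurable_linScore hθ (measurable_gammaTheta Pi).neg (measurable_gammaWW Pi hT).neg hp hp
      (fun t => (measurable_gammaW Pi t).neg) (fun t => (measurable_gammaW Pi t).neg)))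

theorem measurable_sigmaHat_closedForm (hT : 0 < T) : Measurable
    fun x : (Fin n → UnitEst T) × (Fin n → UnitData T) =>
      sigmaHat Pi x.1 x.2 (closedForm Pi x.1 x.2) := by
  have h := measurable_plugInScore_closedForm (n := n) Pi hT
  exact (((Finset.measurable_fun_sum _ fun i _ =>
    ((h i).sub ((Finset.measurable_fun_sum _ fun j _ => h j).const_mul _)).pow_const 2)).const_mul
      _).sqrt

/-- The event that the denominator is positive and the interval around the closed-form estimator
covers `τ`. -/
def coverSet (n : ℕ) {T : ℕ} (Pi : AssignPath T → ℝ) (τ α : ℝ) :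
    Set ((Fin n → UnitEst T) × (Fin n → UnitData T)) :=
  {x | 0 < denom Pi x.1 x.2 ∧ τ ∈ waldInterval Pi x.1 x.2 (closedForm Pi x.1 x.2) α}

/-- A given choice of minimizer need not depend measurably on the data, whereas the closed form
does. Fubini is therefore applied to this event, and the minimizer is compared with the closed form
only at the end. -/
theorem measurableSet_coverSet (hT : 0 < T) (τ α : ℝ) : MeasurableSet (coverSet n Pi τ α) := by
  have h1 : Measurable fun x : (Fin n → UnitEst T) × (Fin n → UnitData T) =>
      normalQuantile (1 - α / 2) * sigmaHat Pi x.1 x.2 (closedForm Pi x.1 x.2)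
        / (√(n : ℝ) * denom Pi x.1 x.2) :=
    ((measurable_sigmaHat_closedForm Pi hT).const_mul _).div ((measurable_denom Pi hT).const_mul _)
  have h2 := measurable_closedForm (n := n) Pi hT
  exact (measurableSet_lt measurable_const (measurable_denom Pi hT)).inter
    ((measurableSet_le (h2.sub h1) measurable_const).inter
      (measurableSet_le measurable_const (h2.add h1)))

end JointMeasurability

/-! ### Bounds for one unit -/

section Bounds

variable {T : ℕ}

theorem observed_apply (z : UnitData T) (t : Fin T) : observed z t = potential (assign z t) z t := by
  cases h : assign z t <;> simp [observed, pathVec, h]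

theorem abs_pathVec_le (w : AssignPath T) (t : Fin T) : |pathVec w t| ≤ 1 := by
  cases h : w t <;> simp [pathVec, h]

theorem abs_demeaned_le (w : AssignPath T) (t : Fin T) : |demeaned w t| ≤ 2 := by
  have := abs_centering_mulVec_le (abs_pathVec_le w) t
  rwa [mul_one] at this

theorem abs_residual_le {τ M R : ℝ} {e : UnitEst T} {z : UnitData T}
    (h : ∀ t b, |potential b z t - e.2 t| < M) (hτ : |τ| ≤ R) (t : Fin T) :
    |residual τ e z t| ≤ 2 * (M + R) := by
  refine abs_centering_mulVec_le (fun s => ?_) t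
  rw [Pi.sub_apply, Pi.smul_apply, smul_eq_mul, adjusted, Pi.sub_apply, observed_apply]
  refine (abs_sub _ _).trans (add_le_add (h s _).le ?_)
  rw [abs_mul]
  exact (mul_le_of_le_one_right (abs_nonneg _) (abs_pathVec_le _ _)).trans hτ

theorem IsReshaped.eq_zero {Pi : AssignPath T → ℝ} {S : Finset (AssignPath T)}
    (h : IsReshaped Pi S) {w : AssignPath T} (hw : w ∉ S) : Pi w = 0 :=
  le_antisymm (not_lt.1 fun hlt => hw ((h.support w).1 hlt)) (h.nonneg w)

theorem IsReshaped.le_one {Pi : AssignPath T → ℝ} {S : Finset (AssignPath T)}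
    (h : IsReshaped Pi S) (w : AssignPath T) : Pi w ≤ 1 := by
  rw [← h.sum_eq_one]
  exact Finset.single_le_sum (fun w _ => h.nonneg w) (Finset.mem_univ w)

/-- Outside S the numerator vanishes, so the value of f there, possibly zero, plays no role. -/
theorem abs_ratio_le {Pi : AssignPath T → ℝ} {S : Finset (AssignPath T)} (h : IsReshaped Pi S)
    {c : ℝ} (hc : 0 < c) {f : AssignPath T → ℝ} (hf : ∀ w ∈ S, c < f w) (w : AssignPath T) :
    |Pi w / f w| ≤ 1 / c := by
  by_cases hw : w ∈ S
  · have hfw := hf w hw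
    rw [abs_div, abs_of_nonneg (h.nonneg w), abs_of_pos (hc.trans hfw)]
    exact div_le_div₀ zero_le_one (h.le_one w) hc hfw.le
  · rw [h.eq_zero hw]; simp; positivity

end Bounds

/-! ### Coverage for estimates held fixed: one sample size -/

theorem measureReal_exists_dev_le {Ω : Type*} [MeasurableSpace Ω] {P : Measure Ω}
    [IsProbabilityMeasure P] {ι : Type*} [Fintype ι] {n : ℕ} (hn : 0 < n) {X : ι → Fin n → Ω → ℝ}
    (hm : ∀ k i, Measurable (X k i)) (hind : ∀ k, iIndepFun (X k) P) {K : ℝ}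
    (hK : ∀ k i, ∀ᵐ ω ∂P, |X k i ω| ≤ K) {r : ℝ} (hr : 0 < r) :
    P.real {ω | ∃ k, r < |avg (fun i => X k i ω) - avg fun i => ∫ ω', X k i ω' ∂P|}
      ≤ Fintype.card ι * (K ^ 2 / (n * r ^ 2)) := by
  have e : {ω | ∃ k, r < |avg (fun i => X k i ω) - avg fun i => ∫ ω', X k i ω' ∂P|}
      = ⋃ k, {ω | r < |avg (fun i => X k i ω) - avg fun i => ∫ ω', X k i ω' ∂P|} := by
    ext ω; simp
  rw [e]
  refine (measureReal_iUnion_fintype_le _).trans ?_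
  refine (Finset.sum_le_sum fun k _ =>
    measureReal_abs_mean_sub_gt_le hn (hm k) (hind k) (hK k) hr).trans ?_
  simp

section FixedEstimates

variable {Ω : Type*} [MeasurableSpace Ω] (P : Measure Ω) {n T : ℕ} (Pi : AssignPath T → ℝ)
  (e : Fin n → UnitEst T) (Z : Ω → Fin n → UnitData T) (τ : ℝ)

/-- The expectation of `Γ_wy - τ Γ_ww`. -/
noncomputable def meanWY : ℝ :=
  ∫ ω, gammaWY Pi e (Z ω) ∂P - τ * ∫ ω, gammaWW Pi e (Z ω) ∂P

/-- The expectation of `Γ_w`. -/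
noncomputable def meanW : Fin T → ℝ := fun t => ∫ ω, gammaW Pi e (Z ω) t ∂P

/-- The expectation of `Γ_y - τ Γ_w`. -/
noncomputable def meanY : Fin T → ℝ := (fun t => ∫ ω, gammaY Pi e (Z ω) t ∂P) - τ • meanW P Pi e Z

/-- The bias `E[Γ_wy - τ Γ_ww] E[Γ_θ] - E[Γ_w]ᵀ E[Γ_y - τ Γ_w]`. -/
noncomputable def biasTerm : ℝ :=
  meanWY P Pi e Z τ * (∫ ω, gammaTheta Pi e (Z ω) ∂P) - meanW P Pi e Z ⬝ᵥ meanY P Pi e Z τ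

/-- The population denominator `E[Γ_ww] E[Γ_θ] - E[Γ_w]ᵀ E[Γ_w]`. -/
noncomputable def meanDenom : ℝ :=
  (∫ ω, gammaWW Pi e (Z ω) ∂P) * (∫ ω, gammaTheta Pi e (Z ω) ∂P)
    - meanW P Pi e Z ⬝ᵥ meanW P Pi e Z

/-- Bounds on the weights, demeaned assignments and residuals of all units. -/
structure UnitBounds (L : ℝ) (ω : Ω) : Prop where
  theta_le : ∀ i, |theta Pi (e i) (Z ω i)| ≤ L
  demeaned_le : ∀ i t, |demeaned (assign (Z ω i)) t| ≤ L
  residual_le : ∀ i t, |residual τ (e i) (Z ω i) t| ≤ L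
  cross_le : ∀ i, |demeaned (assign (Z ω i)) ⬝ᵥ residual τ (e i) (Z ω i)| ≤ L
  square_le : ∀ i, |demeaned (assign (Z ω i)) ⬝ᵥ demeaned (assign (Z ω i))| ≤ L

theorem oracleScore_eq (hT : 0 < T) (i : Fin n) (ω : Ω) : oracleScore P Pi e Z τ i ω
    = linScore (theta Pi (e i) (Z ω i)) (demeaned (assign (Z ω i))) (residual τ (e i) (Z ω i))
      (∫ ω, gammaTheta Pi e (Z ω) ∂P) (meanWY P Pi e Z τ) (meanW P Pi e Z)
      (meanY P Pi e Z τ) := by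
  rw [oracleScore, score_eq_linScore _ _ hT]; rfl

variable {P Pi e Z τ}

theorem measurable_unit (hZ : Measurable Z) {f : UnitData T → ℝ} (hf : Measurable f) (i : Fin n) :
    Measurable fun ω => f (Z ω i) :=
  hf.comp ((measurable_pi_apply i).comp hZ)

theorem measurable_theta_fixed (e : UnitEst T) : Measurable fun z => theta Pi e z :=
  measurable_comp_assign fun w => Pi w / e.1 w

theorem measurable_residual_fixed (e : UnitEst T) (t : Fin T) :
    Measurable fun z => residual τ e z t := by
  have h := measurable_residual (T := T) τ t
  generalize residual τ = r at *
  exact h.comp measurable_prodMk_left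

theorem integral_avg {f : Fin n → Ω → ℝ} (hf : ∀ i, Integrable (f i) P) :
    ∫ ω, avg (fun i => f i ω) ∂P = avg fun i => ∫ ω, f i ω ∂P := by
  simp only [avg]
  rw [integral_const_mul, integral_finsetSum _ fun i _ => hf i]

theorem integrable_avg {f : Fin n → Ω → ℝ} (hf : ∀ i, Integrable (f i) P) :
    Integrable (fun ω => avg fun i => f i ω) P :=
  (integrable_finsetSum _ fun i _ => hf i).const_mul _

/-- The five families of summands whose averages enter the estimator, together with the squared
scores. -/
noncomputable def summand (Pi : AssignPath T → ℝ) (τ : ℝ) (A B : ℝ) (Pm Q : Fin T → ℝ) :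
    Fin 5 ⊕ Fin T ⊕ Fin T → UnitEst T → UnitData T → ℝ
  | .inl j, e, z => ![theta Pi e z, theta Pi e z * (demeaned (assign z) ⬝ᵥ residual τ e z),
      theta Pi e z * (demeaned (assign z) ⬝ᵥ demeaned (assign z)),
      linScore (theta Pi e z) (demeaned (assign z)) (residual τ e z) A B Pm Q,
      linScore (theta Pi e z) (demeaned (assign z)) (residual τ e z) A B Pm Q ^ 2] j
  | .inr (.inl t), e, z => theta Pi e z * demeaned (assign z) t
  | .inr (.inr t), e, z => theta Pi e z * residual τ e z t

theorem measurable_summand (A B : ℝ) (Pm Q : Fin T → ℝ) (k : Fin 5 ⊕ Fin T ⊕ Fin T)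
    (e : UnitEst T) : Measurable fun z => summand Pi τ A B Pm Q k e z := by
  have hθ := measurable_theta_fixed (Pi := Pi) e
  have hp := measurable_demeaned (T := T)
  have hq := measurable_residual_fixed (τ := τ) e
  have hv : Measurable fun z =>
      linScore (theta Pi e z) (demeaned (assign z)) (residual τ e z) A B Pm Q :=
    measurable_linScore hθ measurable_const measurable_const hp hq (fun _ => measurable_const)
      (fun _ => measurable_const)
  rcases k with j | t | t
  · fin_cases j
    · exact hθ
    · exact hθ.mul (measurable_dotProduct hp hq)
    · exact hθ.mul (measurable_dotProduct hp hp)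
    · exact hv
    · exact hv.pow_const 2
  · exact hθ.mul (hp t)
  · exact hθ.mul (hq t)

theorem UnitBounds.abs_summand_le {Ω : Type*} {Z : Ω → Fin n → UnitData T} {L K : ℝ} {ω : Ω}
    (h : UnitBounds Pi e Z τ L ω) (hL : 1 ≤ L)
    {A B : ℝ} {Pm Q : Fin T → ℝ} (hLK : L ≤ K) (hA : |A| ≤ L ^ 2) (hB : |B| ≤ L ^ 2)
    (hP : ∀ t, |Pm t| ≤ L ^ 2) (hQ : ∀ t, |Q t| ≤ L ^ 2)
    (hK : L * (1 + L + 2 * T * L) * L ^ 2 ≤ K) (k : Fin 5 ⊕ Fin T ⊕ Fin T) (i : Fin n) :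
    |summand Pi τ A B Pm Q k (e i) (Z ω i)| ≤ K ^ 2 := by
  have hL0 : 0 ≤ L := by linarith
  have hmul : ∀ a b : ℝ, |a| ≤ L → |b| ≤ L → |a * b| ≤ K ^ 2 := fun a b ha hb => by
    rw [abs_mul, sq]
    exact mul_le_mul (ha.trans hLK) (hb.trans hLK) (abs_nonneg _) (hL0.trans hLK)
  have hKK : K ≤ K ^ 2 := by nlinarith
  have hv := (abs_linScore_le (h.theta_le i) (h.demeaned_le i) (h.residual_le i) (h.cross_le i)
    hA hB hP hQ).trans hK
  rcases k with j | t | t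
  · fin_cases j
    · exact (h.theta_le i).trans (hLK.trans hKK)
    · exact hmul _ _ (h.theta_le i) (h.cross_le i)
    · exact hmul _ _ (h.theta_le i) (h.square_le i)
    · exact hv.trans hKK
    · change |_ ^ 2| ≤ _
      rw [abs_pow]
      exact pow_le_pow_left₀ (abs_nonneg _) hv 2
  · exact hmul _ _ (h.theta_le i) (h.demeaned_le i t)
  · exact hmul _ _ (h.theta_le i) (h.residual_le i t)

theorem integral_linear_combination {f g : Ω → ℝ} {F G : Fin T → Ω → ℝ} (hf : Integrable f P)
    (hg : Integrable g P) (hF : ∀ t, Integrable (F t) P) (hG : ∀ t, Integrable (G t) P)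
    (a b : ℝ) (u v : Fin T → ℝ) :
    ∫ ω, (b * f ω - ∑ t, v t * F t ω + a * g ω - ∑ t, u t * G t ω) ∂P
      = b * ∫ ω, f ω ∂P - ∑ t, v t * ∫ ω, F t ω ∂P + a * ∫ ω, g ω ∂P
        - ∑ t, u t * ∫ ω, G t ω ∂P := by
  have h1 : Integrable (fun ω => ∑ t, v t * F t ω) P :=
    integrable_finsetSum _ fun t _ => (hF t).const_mul _
  have h2 : Integrable (fun ω => ∑ t, u t * G t ω) P :=
    integrable_finsetSum _ fun t _ => (hG t).const_mul _
  have h3 : Integrable (fun ω => b * f ω - ∑ t, v t * F t ω) P := (hf.const_mul b).sub h1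
  have h4 : Integrable (fun ω => b * f ω - ∑ t, v t * F t ω + a * g ω) P :=
    h3.add (hg.const_mul a)
  rw [integral_sub h4 h2, integral_add h3 (hg.const_mul a), integral_sub (hf.const_mul b) h1,
    integral_finsetSum _ fun t _ => (hF t).const_mul _,
    integral_finsetSum _ fun t _ => (hG t).const_mul _]
  simp only [integral_const_mul]

section Expectations

variable [IsProbabilityMeasure P]

/-- The constants in the score are arbitrary here, so L is enlarged to dominate them before the
uniform bound is applied. -/
theorem integrable_summand (hZ : Measurable Z) {L : ℝ} (hL : 1 ≤ L)
    (hb : ∀ᵐ ω ∂P, UnitBounds Pi e Z τ L ω) (A B : ℝ) (Pm Q : Fin T → ℝ)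
    (k : Fin 5 ⊕ Fin T ⊕ Fin T) (i : Fin n) :
    Integrable (fun ω => summand Pi τ A B Pm Q k (e i) (Z ω i)) P := by
  set a := max (max |A| |B|) (max (∑ t, |Pm t|) (∑ t, |Q t|)) with ha
  have hPa : ∀ t, |Pm t| ≤ a := fun t =>
    (Finset.single_le_sum (fun t _ => abs_nonneg (Pm t)) (Finset.mem_univ t)).trans
      ((le_max_left _ _).trans (le_max_right _ _))
  have hQa : ∀ t, |Q t| ≤ a := fun t =>
    (Finset.single_le_sum (fun t _ => abs_nonneg (Q t)) (Finset.mem_univ t)).trans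
      ((le_max_right _ _).trans (le_max_right _ _))
  have hAa : |A| ≤ a := (le_max_left _ _).trans (le_max_left _ _)
  have hBa : |B| ≤ a := (le_max_right _ _).trans (le_max_left _ _)
  set L' := max L (a + 1)
  have hLL' : L ≤ L' := le_max_left _ _
  have haL : a ≤ L' ^ 2 := by
    have : a + 1 ≤ L' := le_max_right _ _
    have : 1 ≤ L' := hL.trans hLL'
    nlinarith
  refine integrable_of_ae_abs_le (measurable_unit hZ (measurable_summand A B Pm Q k (e i)) i)
    (K := (max L' (L' * (1 + L' + 2 * T * L') * L' ^ 2)) ^ 2) ?_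
  filter_upwards [hb] with ω hω
  have hω' : UnitBounds Pi e Z τ L' ω :=
    ⟨fun i => (hω.theta_le i).trans hLL', fun i t => (hω.demeaned_le i t).trans hLL',
      fun i t => (hω.residual_le i t).trans hLL', fun i => (hω.cross_le i).trans hLL',
      fun i => (hω.square_le i).trans hLL'⟩
  exact hω'.abs_summand_le (hL.trans hLL') (le_max_left _ _) (hAa.trans haL) (hBa.trans haL)
    (fun t => (hPa t).trans haL) (fun t => (hQa t).trans haL) (le_max_right _ _) k i

theorem integral_gammaTheta (hZ : Measurable Z) {L : ℝ} (hL : 1 ≤ L)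
    (hb : ∀ᵐ ω ∂P, UnitBounds Pi e Z τ L ω) :
    ∫ ω, gammaTheta Pi e (Z ω) ∂P = avg fun i => ∫ ω, theta Pi (e i) (Z ω i) ∂P :=
  integral_avg fun i => integrable_summand hZ hL hb 0 0 0 0 (.inl 0) i

theorem integral_gammaWW (hT : 0 < T) (hZ : Measurable Z) {L : ℝ} (hL : 1 ≤ L)
    (hb : ∀ᵐ ω ∂P, UnitBounds Pi e Z τ L ω) :
    ∫ ω, gammaWW Pi e (Z ω) ∂P = avg fun i => ∫ ω, theta Pi (e i) (Z ω i) *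
      (demeaned (assign (Z ω i)) ⬝ᵥ demeaned (assign (Z ω i))) ∂P := by
  simp only [gammaWW_eq _ _ _ hT]
  exact integral_avg fun i => integrable_summand hZ hL hb 0 0 0 0 (.inl 2) i

theorem meanW_eq (hZ : Measurable Z) {L : ℝ} (hL : 1 ≤ L)
    (hb : ∀ᵐ ω ∂P, UnitBounds Pi e Z τ L ω) (t : Fin T) :
    meanW P Pi e Z t
      = avg fun i => ∫ ω, theta Pi (e i) (Z ω i) * demeaned (assign (Z ω i)) t ∂P := by
  simp only [meanW, gammaW_eq]
  exact integral_avg fun i => integrable_summand hZ hL hb 0 0 0 0 (.inr (.inl t)) i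

theorem meanWY_eq (hT : 0 < T) (hZ : Measurable Z) {L : ℝ} (hL : 1 ≤ L)
    (hb : ∀ᵐ ω ∂P, UnitBounds Pi e Z τ L ω) :
    meanWY P Pi e Z τ = avg fun i => ∫ ω, theta Pi (e i) (Z ω i) *
      (demeaned (assign (Z ω i)) ⬝ᵥ residual τ (e i) (Z ω i)) ∂P := by
  have i1 : Integrable (fun ω => gammaWY Pi e (Z ω) - τ * gammaWW Pi e (Z ω)) P := by
    simp only [gammaWY_sub _ _ _ _ hT]
    exact integrable_avg fun i => integrable_summand hZ hL hb 0 0 0 0 (.inl 1) i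
  have i2 : Integrable (fun ω => gammaWW Pi e (Z ω)) P := by
    simp only [gammaWW_eq _ _ _ hT]
    exact integrable_avg fun i => integrable_summand hZ hL hb 0 0 0 0 (.inl 2) i
  have i3 : Integrable (fun ω => gammaWY Pi e (Z ω)) P := by
    refine (i1.add (i2.const_mul τ)).congr (ae_of_all _ fun ω => ?_)
    simp
  rw [meanWY, ← integral_const_mul, ← integral_sub i3 (i2.const_mul τ)]
  simp only [gammaWY_sub _ _ _ _ hT]
  exact integral_avg fun i => integrable_summand hZ hL hb 0 0 0 0 (.inl 1) i

theorem meanY_eq (hZ : Measurable Z) {L : ℝ} (hL : 1 ≤ L)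
    (hb : ∀ᵐ ω ∂P, UnitBounds Pi e Z τ L ω) (t : Fin T) :
    meanY P Pi e Z τ t
      = avg fun i => ∫ ω, theta Pi (e i) (Z ω i) * residual τ (e i) (Z ω i) t ∂P := by
  have hsub : ∀ ω, gammaY Pi e (Z ω) t - τ * gammaW Pi e (Z ω) t
      = avg fun i => theta Pi (e i) (Z ω i) * residual τ (e i) (Z ω i) t := fun ω =>
    congrFun (gammaY_sub Pi e (Z ω) τ) t
  have i1 : Integrable (fun ω => gammaY Pi e (Z ω) t - τ * gammaW Pi e (Z ω) t) P := by
    simp only [hsub]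
    exact integrable_avg fun i => integrable_summand hZ hL hb 0 0 0 0 (.inr (.inr t)) i
  have i2 : Integrable (fun ω => gammaW Pi e (Z ω) t) P := by
    simp only [gammaW_eq]
    exact integrable_avg fun i => integrable_summand hZ hL hb 0 0 0 0 (.inr (.inl t)) i
  have i3 : Integrable (fun ω => gammaY Pi e (Z ω) t) P := by
    refine (i1.add (i2.const_mul τ)).congr (ae_of_all _ fun ω => ?_)
    simp
  change ∫ ω, gammaY Pi e (Z ω) t ∂P - τ * ∫ ω, gammaW Pi e (Z ω) t ∂P = _
  rw [← integral_const_mul, ← integral_sub i3 (i2.const_mul τ)]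
  simp only [hsub]
  exact integral_avg fun i => integrable_summand hZ hL hb 0 0 0 0 (.inr (.inr t)) i

theorem abs_avg_integral_mul_le (hn : 0 < n) {L : ℝ} {f g : Fin n → Ω → ℝ}
    (hf : ∀ᵐ ω ∂P, ∀ i, |f i ω| ≤ L) (hg : ∀ᵐ ω ∂P, ∀ i, |g i ω| ≤ L) :
    |avg fun i => ∫ ω, f i ω * g i ω ∂P| ≤ L ^ 2 := by
  refine abs_avg_le hn fun i => abs_integral_le_of_ae_abs_le ?_
  filter_upwards [hf, hg] with ω h1 h2
  rw [abs_mul, sq]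
  exact mul_le_mul (h1 i) (h2 i) (abs_nonneg _) ((abs_nonneg _).trans (h1 i))

/-- Euler's identity: the derivative of a quadratic form at a point, applied to that same point, is
twice its value. The oracle scores are thus not centred, and their mean carries the bias. -/
theorem avg_integral_oracleScore (hT : 0 < T) (hZ : Measurable Z) {L : ℝ} (hL : 1 ≤ L)
    (hb : ∀ᵐ ω ∂P, UnitBounds Pi e Z τ L ω) :
    avg (fun i => ∫ ω, oracleScore P Pi e Z τ i ω ∂P) = 2 * biasTerm P Pi e Z τ := by
  set A := ∫ ω, gammaTheta Pi e (Z ω) ∂P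
  set B := meanWY P Pi e Z τ
  set Pm := meanW P Pi e Z
  set Q := meanY P Pi e Z τ
  have hv : ∀ i, Integrable (fun ω => oracleScore P Pi e Z τ i ω) P := fun i => by
    simp only [oracleScore_eq P Pi e Z τ hT]
    exact integrable_summand hZ hL hb A B Pm Q (.inl 3) i
  have hs := fun k => integrable_summand hZ hL hb 0 0 0 0 k
  rw [← integral_avg hv]
  simp only [oracleScore_eq P Pi e Z τ hT, avg_linScore, dotProduct]
  have a0 : Integrable (fun ω => avg fun i => theta Pi (e i) (Z ω i)) P :=
    integrable_avg fun i => hs (.inl 0) i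
  have a1 : Integrable (fun ω => avg fun i => theta Pi (e i) (Z ω i) *
      (demeaned (assign (Z ω i)) ⬝ᵥ residual τ (e i) (Z ω i))) P :=
    integrable_avg fun i => hs (.inl 1) i
  have a2 : ∀ t, Integrable (fun ω => avg fun i => theta Pi (e i) (Z ω i) *
      demeaned (assign (Z ω i)) t) P := fun t => integrable_avg fun i => hs (.inr (.inl t)) i
  have a3 : ∀ t, Integrable (fun ω => avg fun i => theta Pi (e i) (Z ω i) *
      residual τ (e i) (Z ω i) t) P := fun t => integrable_avg fun i => hs (.inr (.inr t)) i
  have c0 : ∫ ω, avg (fun i => theta Pi (e i) (Z ω i)) ∂P = A := rfl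
  have c1 : ∫ ω, avg (fun i => theta Pi (e i) (Z ω i) *
      (demeaned (assign (Z ω i)) ⬝ᵥ residual τ (e i) (Z ω i))) ∂P = B :=
    (integral_avg fun i => hs (.inl 1) i).trans (meanWY_eq hT hZ hL hb).symm
  have c2 : ∀ t, ∫ ω, avg (fun i => theta Pi (e i) (Z ω i) * demeaned (assign (Z ω i)) t) ∂P
      = Pm t := fun t =>
    (integral_avg fun i => hs (.inr (.inl t)) i).trans (meanW_eq hZ hL hb t).symm
  have c3 : ∀ t, ∫ ω, avg (fun i => theta Pi (e i) (Z ω i) * residual τ (e i) (Z ω i) t) ∂P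
      = Q t := fun t =>
    (integral_avg fun i => hs (.inr (.inr t)) i).trans (meanY_eq hZ hL hb t).symm
  simp only [dotProduct] at a1 c1
  refine (integral_linear_combination a0 a1 a2 a3 A B Pm Q).trans ?_
  simp only [c0, c1, c2, c3, biasTerm, dotProduct]
  have : ∑ t, Q t * Pm t = ∑ t, Pm t * Q t := Finset.sum_congr rfl fun t _ => mul_comm _ _
  rw [this]
  ring

end Expectations

end FixedEstimates

/-- When all averages entering the estimator, and those of the scores and their squares, are within
r of their means, the central limit event forces coverage by a deterministic argument. The
exceptional event costs a union of Chebyshev bounds. -/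
theorem measureReal_le_cover_add {Ω : Type*} [MeasurableSpace Ω] {P : Measure Ω}
    [IsProbabilityMeasure P] {n T : ℕ} {Pi : AssignPath T → ℝ} {e : Fin n → UnitEst T}
    {Z : Ω → Fin n → UnitData T} {τ α : ℝ} (hT : 0 < T) (hn : 2 ≤ n) (hZ : Measurable Z)
    (hind : iIndepFun (fun (i : Fin n) ω => Z ω i) P) {L K r d₀ η q₀ ν₀ C : ℝ} (hL : 1 ≤ L)
    (hLK : L ≤ K) (hK : L * (1 + L + 2 * T * L) * L ^ 2 ≤ K)
    (hb : ∀ᵐ ω ∂P, UnitBounds Pi e Z τ L ω) (hD₀ : d₀ ≤ meanDenom P Pi e Z) (hd₀ : 0 < d₀)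
    (hν : ν₀ ≤ avg fun i => variance (oracleScore P Pi e Z τ i) P)
    (hq₀ : 0 ≤ q₀) (hqz : q₀ ≤ normalQuantile (1 - α / 2))
    (hr : 0 < r) (hη1 : η ≤ 1) (hrη : r ≤ η) (hnr : √(n : ℝ) * r ^ 2 ≤ η)
    (hnN : √(n : ℝ) * |biasTerm P Pi e Z τ| ≤ η)
    (hC : C = K * (1 + K + 2 * T * K) + 2 * (T + 3) / d₀ * (2 * (T + 1) * K ^ 4))
    (hη2 : 4 * (T + 1) * K ^ 2 * η ≤ d₀) (hη3 : C * η ≤ 1)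
    (hη4 : η * (2 * q₀ * K * (T + 2) + (T + 2) ^ 2
        + normalQuantile (1 - α / 2) ^ 2 * ((2 * K + 1) * (2 * C + 1)))
      ≤ (normalQuantile (1 - α / 2) ^ 2 - q₀ ^ 2) * ν₀) :
    P.real {ω | |∑ i, (oracleScore P Pi e Z τ i ω - ∫ ω', oracleScore P Pi e Z τ i ω' ∂P)|
        < q₀ * √(∑ i, variance (oracleScore P Pi e Z τ i) P)}
      ≤ P.real {ω | (e, Z ω) ∈ coverSet n Pi τ α}
        + Fintype.card (Fin 5 ⊕ Fin T ⊕ Fin T) * ((K ^ 2) ^ 2 / (n * r ^ 2)) := by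
  have hn0 : 0 < n := by omega
  have hn' : (0 : ℝ) < n := by exact_mod_cast hn0
  have hK1 : 1 ≤ K := hL.trans hLK
  set A := ∫ ω, gammaTheta Pi e (Z ω) ∂P with hA
  set B := meanWY P Pi e Z τ with hB
  set Pm := meanW P Pi e Z with hPm
  set Q := meanY P Pi e Z τ with hQ
  have bA : |A| ≤ L ^ 2 := by
    rw [hA, integral_gammaTheta hZ hL hb]
    refine (abs_avg_le hn0 (c := L) fun i => abs_integral_le_of_ae_abs_le ?_).trans (by nlinarith)
    filter_upwards [hb] with ω h using h.theta_le i
  have bB : |B| ≤ L ^ 2 := by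
    rw [hB, meanWY_eq hT hZ hL hb]
    exact abs_avg_integral_mul_le hn0 (hb.mono fun ω h => h.theta_le)
      (hb.mono fun ω h => h.cross_le)
  have bP : ∀ t, |Pm t| ≤ L ^ 2 := fun t => by
    rw [hPm, meanW_eq hZ hL hb]
    exact abs_avg_integral_mul_le hn0 (hb.mono fun ω h => h.theta_le)
      (hb.mono fun ω h i => h.demeaned_le i t)
  have bQ : ∀ t, |Q t| ≤ L ^ 2 := fun t => by
    rw [hQ, meanY_eq hZ hL hb]
    exact abs_avg_integral_mul_le hn0 (hb.mono fun ω h => h.theta_le)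
      (hb.mono fun ω h i => h.residual_le i t)
  have hLK2 : L ^ 2 ≤ K ^ 2 := by gcongr
  set V : Fin n → Ω → ℝ := oracleScore P Pi e Z τ with hV
  have hVeq : ∀ i ω, V i ω = linScore (theta Pi (e i) (Z ω i)) (demeaned (assign (Z ω i)))
      (residual τ (e i) (Z ω i)) A B Pm Q := oracleScore_eq P Pi e Z τ hT
  have hVm : ∀ i, Measurable (V i) := fun i => by
    have : V i = fun ω => summand Pi τ A B Pm Q (.inl 3) (e i) (Z ω i) := funext (hVeq i)
    rw [this]
    exact measurable_unit hZ (measurable_summand A B Pm Q (.inl 3) (e i)) i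
  have hVK : ∀ i, ∀ᵐ ω ∂P, |V i ω| ≤ K := fun i => by
    filter_upwards [hb] with ω h
    rw [hVeq]
    exact (abs_linScore_le (h.theta_le i) (h.demeaned_le i) (h.residual_le i) (h.cross_le i)
      bA bB bP bQ).trans hK
  have hVmean : avg (fun i => ∫ ω, V i ω ∂P) = 2 * biasTerm P Pi e Z τ :=
    avg_integral_oracleScore hT hZ hL hb
  have hbias : biasTerm P Pi e Z τ = B * A - Pm ⬝ᵥ Q := rfl
  -- the average variance
  set s2 := avg fun i => variance (V i) P with hs2
  have hs20 : 0 ≤ s2 := avg_nonneg fun i => variance_nonneg _ _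
  have hs2K : s2 ≤ K ^ 2 :=
    (avg_mono fun i => variance_le_of_ae_abs_le (hVm i) (hVK i)).trans (avg_const hn0 _).le
  have hsσ : √s2 ^ 2 = s2 := Real.sq_sqrt hs20
  -- Jensen: the average of the squared means is at least the square of the average mean. For units
  -- with different laws the inequality can be strict, which is the source of conservativeness.
  have hs2m : √s2 ^ 2 ≤ avg (fun i => ∫ ω, V i ω ^ 2 ∂P) - (2 * (B * A - Pm ⬝ᵥ Q)) ^ 2 := by
    rw [hsσ, ← hbias, ← hVmean]
    have e1 : s2 = avg (fun i => ∫ ω, V i ω ^ 2 ∂P) - avg fun i => (∫ ω, V i ω ∂P) ^ 2 := by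
      rw [← avg_sub, hs2]
      congr 1; ext i
      rw [variance_eq_sub (memLp_two_of_ae_abs_le (hVm i) (hVK i))]
      rfl
    have e2 := sq_avg_le hn0 (f := fun i => ∫ ω, V i ω ∂P)
    linarith
  have hsum : √(∑ i, variance (V i) P) = √(n : ℝ) * √s2 := by
    rw [← Real.sqrt_mul hn'.le]
    congr 1
    rw [hs2, avg]; field_simp
  -- the exceptional event
  have hX := measureReal_exists_dev_le (P := P) (ι := Fin 5 ⊕ Fin T ⊕ Fin T) hn0
    (X := fun k i ω => summand Pi τ A B Pm Q k (e i) (Z ω i)) (K := K ^ 2) (r := r)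
    (fun k i => measurable_unit hZ (measurable_summand A B Pm Q k (e i)) i)
    (fun k => hind.comp (fun i z => summand Pi τ A B Pm Q k (e i) z)
      fun i => measurable_summand A B Pm Q k (e i))
    (fun k i => hb.mono fun ω h => h.abs_summand_le hL hLK bA bB bP bQ hK k i) hr
  refine le_trans ?_ (add_le_add_right hX _)
  refine le_trans (ENNReal.toReal_mono (measure_ne_top _ _) (measure_mono_ae ?_))
    (measureReal_union_le _ _)
  filter_upwards [hb] with ω hω hclt
  have hclt' : |∑ i, (V i ω - ∫ ω', V i ω' ∂P)| < q₀ * √(∑ i, variance (V i) P) := hclt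
  change ω ∈ {ω | (e, Z ω) ∈ coverSet n Pi τ α} ∪ _
  rw [Set.mem_union]
  by_cases hdev : ∃ k, r < |avg (fun i => summand Pi τ A B Pm Q k (e i) (Z ω i))
      - avg fun i => ∫ ω', summand Pi τ A B Pm Q k (e i) (Z ω' i) ∂P|
  · exact Or.inr hdev
  left
  push Not at hdev
  have hVavg : avg (fun i => V i ω) - 2 * (B * A - Pm ⬝ᵥ Q)
      = (1 / (n : ℝ)) * ∑ i, (V i ω - ∫ ω', V i ω' ∂P) := by
    rw [← hbias, ← hVmean, ← avg_sub]; rfl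
  have hclt2 : √(n : ℝ) * |avg (fun i => V i ω) - 2 * (B * A - Pm ⬝ᵥ Q)| ≤ q₀ * √s2 := by
    rw [hVavg, abs_mul, abs_of_pos (by positivity)]
    rw [hsum] at hclt'
    have hsn : 0 < √(n : ℝ) := Real.sqrt_pos.2 hn'
    have e : √(n : ℝ) * (1 / n) = 1 / √(n : ℝ) := by
      have := Real.mul_self_sqrt hn'.le
      field_simp
      linarith [Real.sq_sqrt hn'.le]
    rw [← mul_assoc, e, one_div, ← div_eq_inv_mul, div_le_iff₀ hsn]
    linarith
  have hdenom : denom Pi e (Z ω) = gammaWW Pi e (Z ω) * gammaTheta Pi e (Z ω)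
    - gammaW Pi e (Z ω) ⬝ᵥ gammaW Pi e (Z ω) := rfl
  have d1 : |avg (fun i => theta Pi (e i) (Z ω i)) - A| ≤ r := by
    have := hdev (.inl 0)
    rwa [hA, integral_gammaTheta hZ hL hb]
  have d2 : |avg (fun i => theta Pi (e i) (Z ω i) *
      (demeaned (assign (Z ω i)) ⬝ᵥ residual τ (e i) (Z ω i))) - B| ≤ r := by
    have := hdev (.inl 1)
    rwa [hB, meanWY_eq hT hZ hL hb]
  have d3 : ∀ t, |avg (fun i => theta Pi (e i) (Z ω i) * demeaned (assign (Z ω i)) t) - Pm t|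
      ≤ r := fun t => by
    have := hdev (.inr (.inl t))
    rwa [hPm, meanW_eq hZ hL hb]
  have d4 : ∀ t, |avg (fun i => theta Pi (e i) (Z ω i) * residual τ (e i) (Z ω i) t) - Q t|
      ≤ r := fun t => by
    have := hdev (.inr (.inr t))
    rwa [hQ, meanY_eq hZ hL hb]
  have d5 : |avg (fun i => theta Pi (e i) (Z ω i) *
      (demeaned (assign (Z ω i)) ⬝ᵥ demeaned (assign (Z ω i)))) - ∫ ω, gammaWW Pi e (Z ω) ∂P|
      ≤ r := by
    have := hdev (.inl 2)
    rwa [integral_gammaWW hT hZ hL hb]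
  have d6 : |avg (fun i => V i ω) - 2 * (B * A - Pm ⬝ᵥ Q)| ≤ r := by
    have := hdev (.inl 3)
    rw [← hbias, ← hVmean]
    simp only [hVeq]
    exact this
  have d7 : |avg (fun i => V i ω ^ 2) - avg (fun i => ∫ ω, V i ω ^ 2 ∂P)| ≤ r := by
    have := hdev (.inl 4)
    simp only [hVeq]
    exact this
  have hN₀ : |2 * (B * A - Pm ⬝ᵥ Q)| ≤ K := by
    rw [← hbias, ← hVmean]
    exact abs_avg_le hn0 fun i => abs_integral_le_of_ae_abs_le (hVK i)
  have hvK : ∀ i, |linScore (theta Pi (e i) (Z ω i)) (demeaned (assign (Z ω i)))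
      (residual τ (e i) (Z ω i)) A B Pm Q| ≤ K := fun i =>
    (abs_linScore_le (hω.theta_le i) (hω.demeaned_le i) (hω.residual_le i) (hω.cross_le i)
      bA bB bP bQ).trans hK
  simp only [hVeq] at hclt2 d6 d7
  simp only [hVeq] at hs2m
  set d := closedForm Pi e (Z ω) - τ with hd
  have eP := gammaW_eq Pi e (Z ω)
  have eW := gammaWW_eq Pi e (Z ω) hT
  have eB := gammaWY_sub Pi e (Z ω) τ hT
  have eQ := gammaY_sub Pi e (Z ω) τ
  have eθ : gammaTheta Pi e (Z ω) = avg fun i => theta Pi (e i) (Z ω i) := rfl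
  have hmulK : ∀ a b : ℝ, |a| ≤ L → |b| ≤ L → |a * b| ≤ K ^ 2 := fun a b ha hb => by
    rw [abs_mul, sq]
    exact mul_le_mul (ha.trans hLK) (hb.trans hLK) (abs_nonneg _) (by linarith)
  have hDge := denominator_ge_of_close d1 d5 d3
    (abs_avg_le hn0 fun i => hmulK _ _ (hω.theta_le i) (hω.square_le i)) (bA.trans hLK2)
    (fun t => abs_avg_le hn0 fun i => hmulK _ _ (hω.theta_le i) (hω.demeaned_le i t))
    (fun t => (bP t).trans hLK2)
  rw [← eP, ← eW] at hDge
  have hDpos : 0 < denom Pi e (Z ω) := by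
    have h1 : (T + 1) * (2 * K ^ 2 * r) ≤ (T + 1) * (2 * K ^ 2 * η) := by gcongr
    have h2 : meanDenom P Pi e Z = (∫ ω, gammaWW Pi e (Z ω) ∂P) * A - Pm ⬝ᵥ Pm := rfl
    rw [hdenom, eθ]
    linarith
  -- The bound K takes the role of L here because it also dominates the oracle scores.
  have key := fun d hd => sq_numerator_le_of_close (d := d) hn hK1
    (fun i => (hω.theta_le i).trans hLK)
    (fun i t => (hω.demeaned_le i t).trans hLK) (fun i t => (hω.residual_le i t).trans hLK)
    (fun i => (hω.cross_le i).trans hLK) (fun i => (hω.square_le i).trans hLK) hvK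
    (bA.trans hLK2) (fun t => (bP t).trans hLK2) hN₀ d1 d2 d3 d4 d5 d6 d7 hD₀ hd₀ hs2m
    (Real.sqrt_le_iff.2 ⟨by linarith, hs2K⟩) (by rw [hsσ]; exact hν) hq₀ hqz hη1 hrη hnr hnN hclt2
    hd hC hη2 hη3 hη4
  rw [← eP, ← eW, ← eB, ← eQ, ← eθ] at key
  change ∀ d, d * denom Pi e (Z ω) = _ → 0 < denom Pi e (Z ω) ∧ _ at key
  have hdN : d * denom Pi e (Z ω) = (gammaWY Pi e (Z ω) - τ * gammaWW Pi e (Z ω))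
      * gammaTheta Pi e (Z ω)
      - gammaW Pi e (Z ω) ⬝ᵥ (gammaY Pi e (Z ω) - τ • gammaW Pi e (Z ω)) := by
    have h1 : closedForm Pi e (Z ω) * denom Pi e (Z ω) = gammaWY Pi e (Z ω) * gammaTheta Pi e (Z ω)
        - gammaW Pi e (Z ω) ⬝ᵥ gammaY Pi e (Z ω) := div_mul_cancel₀ _ hDpos.ne'
    rw [hd, sub_mul, h1, hdenom, dotProduct_sub, dotProduct_smul, smul_eq_mul]
    ring
  have hfin := (key d hdN).2
  refine ⟨hDpos, mem_waldInterval_of_sq_le hn (hq₀.trans hqz) hDpos ?_⟩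
  have hτ : closedForm Pi e (Z ω) = τ + d := by rw [hd]; ring
  have ew : plugInScore Pi e (Z ω) (closedForm Pi e (Z ω)) = fun i =>
      linScore (theta Pi (e i) (Z ω i)) (demeaned (assign (Z ω i))) (residual τ (e i) (Z ω i))
          (gammaTheta Pi e (Z ω)) (gammaWY Pi e (Z ω) - τ * gammaWW Pi e (Z ω)) (gammaW Pi e (Z ω))
          (gammaY Pi e (Z ω) - τ • gammaW Pi e (Z ω))
        + d * linScore (theta Pi (e i) (Z ω i)) (demeaned (assign (Z ω i)))
          (demeaned (assign (Z ω i))) (-gammaTheta Pi e (Z ω)) (-gammaWW Pi e (Z ω))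
          (-gammaW Pi e (Z ω)) (-gammaW Pi e (Z ω)) := by
    ext i; rw [hτ, plugInScore_add Pi _ _ _ hT]
  change (n : ℝ) * (d * denom Pi e (Z ω)) ^ 2 ≤ _
  rw [ew, hdN]
  exact hfin

/-! ### Coverage along a sequence of fixed estimates -/

/-- The radius n^(-3/8) lies strictly between n^(-1/2) and n^(-1/4): it is large enough for
Chebyshev, since n r² = n^(1/4), and small enough for the quadratic remainder, since √n r² =
n^(-1/4). -/
theorem tendsto_rate_sq : Tendsto (fun n : ℕ => √(n : ℝ) * ((n : ℝ) ^ (-(3 / 8) : ℝ)) ^ 2) atTop (𝓝 0)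
    ∧ Tendsto (fun n : ℕ => 1 / ((n : ℝ) * ((n : ℝ) ^ (-(3 / 8) : ℝ)) ^ 2)) atTop (𝓝 0) := by
  have h : Tendsto (fun n : ℕ => (n : ℝ) ^ (-(1 / 4) : ℝ)) atTop (𝓝 0) :=
    (tendsto_rpow_neg_atTop (by norm_num)).comp tendsto_natCast_atTop_atTop
  constructor
  · refine h.congr' ?_
    filter_upwards [eventually_gt_atTop 0] with n hn
    have hn' : (0 : ℝ) < n := by exact_mod_cast hn
    rw [Real.sqrt_eq_rpow, ← Real.rpow_natCast, ← Real.rpow_mul hn'.le, ← Real.rpow_add hn']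
    norm_num
  · refine h.congr' ?_
    filter_upwards [eventually_gt_atTop 0] with n hn
    have hn' : (0 : ℝ) < n := by exact_mod_cast hn
    rw [← Real.rpow_natCast, ← Real.rpow_mul hn'.le]
    have e : (n : ℝ) * (n : ℝ) ^ (-(3 / 8) * ((2 : ℕ) : ℝ)) = (n : ℝ) ^ (1 / 4 : ℝ) := by
      rw [← Real.rpow_one_add' hn'.le (by norm_num)]
      norm_num
    rw [e, Real.rpow_neg hn'.le]
    exact (one_div _).symm

theorem eventually_mul_le_nhdsGT (a : ℝ) {b : ℝ} (hb : 0 < b) : ∀ᶠ η in 𝓝[>] (0 : ℝ), a * η ≤ b := by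
  have : Tendsto (fun η : ℝ => a * η) (𝓝[>] 0) (𝓝 (a * 0)) :=
    (tendsto_nhdsWithin_of_tendsto_nhds tendsto_id).const_mul a
  rw [mul_zero] at this
  exact (this.eventually (gt_mem_nhds hb)).mono fun _ h => h.le

/-- Asymptotic coverage for a sequence of estimates held fixed. -/
theorem eventually_le_cover_fixed {T : ℕ} (hT : 0 < T) {Ω : ℕ → Type*}
    [∀ n, MeasurableSpace (Ω n)] (P : (n : ℕ) → Measure (Ω n)) [∀ n, IsProbabilityMeasure (P n)]
    {Z : (n : ℕ) → Ω n → Fin n → UnitData T} (hZ : ∀ n, Measurable (Z n))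
    (hind : ∀ n, iIndepFun (fun (i : Fin n) ω => Z n ω i) (P n)) {Pi : AssignPath T → ℝ}
    {e : (n : ℕ) → Fin n → UnitEst T} {τ : ℕ → ℝ} {L d₀ ν₀ : ℝ} (hL : 1 ≤ L) (hd₀ : 0 < d₀)
    (hν₀ : 0 < ν₀) (hb : ∀ᶠ n in atTop, ∀ᵐ ω ∂(P n), UnitBounds Pi (e n) (Z n) (τ n) L ω)
    (hD₀ : ∀ᶠ n in atTop, d₀ ≤ meanDenom (P n) Pi (e n) (Z n))
    (hν : ∀ᶠ n in atTop,
      ν₀ ≤ avg fun i => variance (oracleScore (P n) Pi (e n) (Z n) (τ n) i) (P n))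
    (hbias : Tendsto (fun n : ℕ => √(n : ℝ) * |biasTerm (P n) Pi (e n) (Z n) (τ n)|) atTop (𝓝 0))
    {α : ℝ} (hα : α ∈ Set.Ioo (0 : ℝ) 1) {ε : ℝ} (hε : 0 < ε) :
    ∀ᶠ n in atTop, 1 - α - ε ≤ (P n).real {ω | (e n, Z n ω) ∈ coverSet n Pi (τ n) α} := by
  set z := normalQuantile (1 - α / 2) with hz
  have hzpos : 0 < z := normalQuantile_pos (by linarith [hα.2]) (by linarith [hα.1])
  obtain ⟨q, hq0, hqz, hq⟩ := exists_lt_gaussianReal_Ioo hzpos (show 0 < ε / 3 by linarith)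
  have hzα : 1 - α ≤ (gaussianReal 0 1).real (Set.Ioo (-z) z) :=
    le_gaussianReal_Ioo_normalQuantile hα
  set K := max L (L * (1 + L + 2 * T * L) * L ^ 2) with hKdef
  set C := K * (1 + K + 2 * T * K) + 2 * (T + 3) / d₀ * (2 * (T + 1) * K ^ 4) with hC
  -- The tolerance η is fixed independently of n; each requirement holds for all small η > 0, the
  -- last one because q < z.
  obtain ⟨η, hη0, hη1, hη2, hη3, hη4⟩ : ∃ η : ℝ, 0 < η ∧ η ≤ 1 ∧ 4 * (T + 1) * K ^ 2 * η ≤ d₀ ∧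
      C * η ≤ 1 ∧ η * (2 * q * K * (T + 2) + (T + 2) ^ 2 + z ^ 2 * ((2 * K + 1) * (2 * C + 1)))
        ≤ (z ^ 2 - q ^ 2) * ν₀ := by
    have hpos : 0 < (z ^ 2 - q ^ 2) * ν₀ := mul_pos (by nlinarith) hν₀
    obtain ⟨η, h0, h1, h2, h3, h4⟩ := ((eventually_mem_nhdsWithin (a := (0 : ℝ)) (s := Set.Ioi 0)).and
      ((eventually_mul_le_nhdsGT 1 one_pos).and
      ((eventually_mul_le_nhdsGT (4 * (T + 1) * K ^ 2) hd₀).and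
      ((eventually_mul_le_nhdsGT C one_pos).and (eventually_mul_le_nhdsGT
        (2 * q * K * (T + 2) + (T + 2) ^ 2 + z ^ 2 * ((2 * K + 1) * (2 * C + 1))) hpos))))).exists
    exact ⟨η, h0, by linarith, h2, h3, by linarith⟩
  set r : ℕ → ℝ := fun n => (n : ℝ) ^ (-(3 / 8) : ℝ) with hr
  have hr0 : Tendsto r atTop (𝓝 0) :=
    (tendsto_rpow_neg_atTop (by norm_num)).comp tendsto_natCast_atTop_atTop
  have hrate := tendsto_rate_sq
  have hdev : Tendsto (fun n : ℕ => Fintype.card (Fin 5 ⊕ Fin T ⊕ Fin T) *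
      ((K ^ 2) ^ 2 / (n * r n ^ 2))) atTop (𝓝 0) := by
    have := (hrate.2.const_mul ((K ^ 2) ^ 2)).const_mul
      (Fintype.card (Fin 5 ⊕ Fin T ⊕ Fin T) : ℝ)
    rw [mul_zero, mul_zero] at this
    exact this.congr fun n => by rw [mul_one_div]
  have hVeq : ∀ n i, oracleScore (P n) Pi (e n) (Z n) (τ n) i = fun ω => summand Pi (τ n)
      (∫ ω, gammaTheta Pi (e n) (Z n ω) ∂(P n)) (meanWY (P n) Pi (e n) (Z n) (τ n))
      (meanW (P n) Pi (e n) (Z n)) (meanY (P n) Pi (e n) (Z n) (τ n)) (.inl 3) (e n i) (Z n ω i) :=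
    fun n i => funext fun ω => oracleScore_eq _ _ _ _ _ hT i ω
  have hclt := eventually_gaussian_le_of_bounded P
    (X := fun n => oracleScore (P n) Pi (e n) (Z n) (τ n))
    (fun n i => by
      rw [hVeq]; exact measurable_unit (hZ n) (measurable_summand _ _ _ _ _ _) i)
    (fun n => by
      rw [funext (hVeq n)]
      exact (hind n).comp (fun i z => summand Pi (τ n) _ _ _ _ (.inl 3) (e n i) z)
        fun i => measurable_summand _ _ _ _ _ _)
    (K := K) (by
      filter_upwards [hb, eventually_gt_atTop 0] with n hbn hn i
      filter_upwards [hbn] with ω h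
      rw [oracleScore_eq _ _ _ _ _ hT]
      refine (abs_linScore_le (a := L ^ 2) (h.theta_le i) (h.demeaned_le i) (h.residual_le i)
        (h.cross_le i) ?_ ?_ (fun t => ?_) (fun t => ?_)).trans (le_max_right _ _)
      · rw [integral_gammaTheta (hZ n) hL hbn]
        refine (abs_avg_le hn (c := L) fun i => abs_integral_le_of_ae_abs_le ?_).trans
          (by nlinarith)
        filter_upwards [hbn] with ω h using h.theta_le i
      · rw [meanWY_eq hT (hZ n) hL hbn]
        exact abs_avg_integral_mul_le hn (hbn.mono fun ω h => h.theta_le)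
          (hbn.mono fun ω h => h.cross_le)
      · rw [meanW_eq (hZ n) hL hbn]
        exact abs_avg_integral_mul_le hn (hbn.mono fun ω h => h.theta_le)
          (hbn.mono fun ω h i => h.demeaned_le i t)
      · rw [meanY_eq (hZ n) hL hbn]
        exact abs_avg_integral_mul_le hn (hbn.mono fun ω h => h.theta_le)
          (hbn.mono fun ω h i => h.residual_le i t))
    hν₀ hν (q := q) (show 0 < ε / 3 by linarith)
  filter_upwards [hclt, hb, hD₀, hν, eventually_ge_atTop 2, hr0.eventually (gt_mem_nhds hη0),
    hrate.1.eventually (gt_mem_nhds hη0), hbias.eventually (gt_mem_nhds hη0),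
    hdev.eventually (gt_mem_nhds (show 0 < ε / 3 by linarith))]
    with n h1 h2 h3 h4 h5 h6 h7 h8 h9
  have hrn : 0 < r n := Real.rpow_pos_of_pos (by exact_mod_cast (by omega : 0 < n)) _
  have := measureReal_le_cover_add hT h5 (hZ n) (hind n) hL (le_max_left _ _) (le_max_right _ _) h2
    h3 hd₀ h4 hq0.le hqz.le hrn hη1 h6.le h7.le h8.le hC hη2 hη3 hη4
  -- Three losses of ε/3: from z to q in the Gaussian mass, from the central limit theorem, and from
  -- the exceptional event.
  linarith

/-! ### Expectations under one unit law -/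

theorem propensity_nonneg {T : ℕ} (ν : Measure (UnitData T)) (w : AssignPath T) :
    0 ≤ propensity ν w := measureReal_nonneg

section UnitLaw

variable {T : ℕ} {ν : Measure (UnitData T)} [IsProbabilityMeasure ν]

theorem integral_comp_assign (g : AssignPath T → ℝ) :
    ∫ z, g (assign z) ∂ν = ∑ w, propensity ν w * g w := by
  have : IsProbabilityMeasure (ν.map (assign (T := T))) :=
    Measure.isProbabilityMeasure_map measurable_assign.aemeasurable
  rw [← integral_map measurable_assign.aemeasurable (f := g)
    (Measurable.of_discrete).aestronglyMeasurable, integral_fintype (Integrable.of_finite)]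
  refine Finset.sum_congr rfl fun w _ => ?_
  rw [map_measureReal_apply measurable_assign (measurableSet_singleton w)]
  rfl

theorem sum_propensity : ∑ w, propensity ν w = 1 := by
  have := integral_comp_assign (ν := ν) fun _ => 1
  simpa using this.symm

/-- W takes finitely many values, and on each event {W = w} the conditional expectation may be
replaced by the constant mean. Ignorability in mean thus suffices; independence of outcomes and
assignment is not needed. -/
theorem integral_assign_mul_potential (h_ign : LatentMeanIgnorable ν) (b : Bool) (t : Fin T)
    (hint : Integrable (fun z => potential b z t) ν) (g : AssignPath T → ℝ) :
    ∫ z, g (assign z) * potential b z t ∂ν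
      = ∑ w, propensity ν w * (g w * ∫ z, potential b z t ∂ν) := by
  classical
  have hms : ∀ w : AssignPath T, MeasurableSet {z : UnitData T | assign z = w} := fun w =>
    measurable_assign (measurableSet_singleton w)
  have e : ∀ z : UnitData T, g (assign z) * potential b z t
      = ∑ w, g w * Set.indicator {z | assign z = w} (fun z => potential b z t) z := by
    intro z
    rw [Finset.sum_eq_single (assign z)]
    · simp
    · intro w _ hw
      rw [Set.indicator_of_notMem (by simpa using hw.symm), mul_zero]
    · simp
  simp only [e]
  rw [integral_finsetSum _ fun w _ => (hint.indicator (hms w)).const_mul _]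
  refine Finset.sum_congr rfl fun w _ => ?_
  rw [integral_const_mul, integral_indicator (hms w)]
  have hset : ∫ z in {z | assign z = w}, potential b z t ∂ν
      = propensity ν w * ∫ z, potential b z t ∂ν := by
    have hle : MeasurableSpace.comap (assign (T := T)) inferInstance
        ≤ (inferInstance : MeasurableSpace (UnitData T)) := measurable_assign.comap_le
    rw [← setIntegral_condExp hle hint
      (⟨{w}, measurableSet_singleton w, rfl⟩ : MeasurableSet[MeasurableSpace.comap
        (assign (T := T)) inferInstance] {z | assign z = w}),
      setIntegral_congr_ae (hms w) ((h_ign b t).mono fun z hz _ => hz), setIntegral_const]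
    rfl
  rw [hset]; ring

/-- The conditional mean of `Y - m̂ - τ W` given `W = w`. -/
noncomputable def condMean (ν : Measure (UnitData T)) (e : UnitEst T) (τ : ℝ) (w : AssignPath T) :
    Fin T → ℝ :=
  fun t => baseMean ν t + pathVec w t * effect ν t - e.2 t - τ * pathVec w t

theorem integral_assign_mul_adjusted (h_ign : LatentMeanIgnorable ν) (t : Fin T)
    (hint : ∀ b, Integrable (fun z => potential b z t) ν) (e : UnitEst T) (τ : ℝ)
    (g : AssignPath T → ℝ) :
    Integrable (fun z => g (assign z) * (adjusted e z - τ • pathVec (assign z)) t) ν ∧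
    ∫ z, g (assign z) * (adjusted e z - τ • pathVec (assign z)) t ∂ν
      = ∑ w, propensity ν w * (g w * condMean ν e τ w t) := by
  have hI : ∀ (b : Bool) (f : AssignPath T → ℝ),
      Integrable (fun z => f (assign z) * potential b z t) ν := fun b f => by
    refine (hint b).bdd_mul (c := ∑ w, |f w|)
      (measurable_comp_assign f).aestronglyMeasurable (ae_of_all _ fun z => ?_)
    rw [Real.norm_eq_abs]
    exact Finset.single_le_sum (f := fun w => |f w|) (fun w _ => abs_nonneg _)
      (Finset.mem_univ (assign z))
  have hF : ∀ f : AssignPath T → ℝ, Integrable (fun z => f (assign z)) ν := fun f =>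
    Integrable.of_bound (measurable_comp_assign f).aestronglyMeasurable (∑ w, |f w|)
      (ae_of_all _ fun z => by
        rw [Real.norm_eq_abs]
        exact Finset.single_le_sum (f := fun w => |f w|) (fun w _ => abs_nonneg _)
          (Finset.mem_univ (assign z)))
  have i1 := hI true fun w => g w * pathVec w t
  have i2 := hI false fun w => g w * (1 - pathVec w t)
  have i3 := hF fun w => g w * (e.2 t + τ * pathVec w t)
  have i12 : Integrable (fun z => g (assign z) * pathVec (assign z) t * potential true z t
      + g (assign z) * (1 - pathVec (assign z) t) * potential false z t) ν := i1.add i2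
  have hexp : ∀ z : UnitData T, g (assign z) * (adjusted e z - τ • pathVec (assign z)) t
      = g (assign z) * pathVec (assign z) t * potential true z t
        + g (assign z) * (1 - pathVec (assign z) t) * potential false z t
        - g (assign z) * (e.2 t + τ * pathVec (assign z) t) := fun z => by
    simp only [adjusted, observed, Pi.sub_apply, Pi.smul_apply, smul_eq_mul]
    ring
  simp only [hexp]
  refine ⟨i12.sub i3, ?_⟩
  rw [integral_sub i12 i3, integral_add i1 i2,
    integral_assign_mul_potential h_ign true t (hint true) (fun w => g w * pathVec w t),
    integral_assign_mul_potential h_ign false t (hint false) (fun w => g w * (1 - pathVec w t)),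
    integral_comp_assign fun w => g w * (e.2 t + τ * pathVec w t), ← Finset.sum_add_distrib,
    ← Finset.sum_sub_distrib]
  refine Finset.sum_congr rfl fun w _ => ?_
  have he : effect ν t = ∫ z, potential true z t ∂ν - ∫ z, potential false z t ∂ν :=
    integral_sub (hint true) (hint false)
  rw [condMean, he, baseMean]
  ring

theorem integral_assign_mul_residual (h_ign : LatentMeanIgnorable ν)
    (hint : ∀ b t, Integrable (fun z => potential b z t) ν) (e : UnitEst T) (τ : ℝ) (t : Fin T)
    (g : AssignPath T → ℝ) :
    Integrable (fun z => g (assign z) * residual τ e z t) ν ∧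
    ∫ z, g (assign z) * residual τ e z t ∂ν
      = ∑ w, propensity ν w * (g w * (centering T *ᵥ condMean ν e τ w) t) := by
  have h := fun s => integral_assign_mul_adjusted h_ign s (fun b => hint b s) e τ g
  have e1 : ∀ z : UnitData T, g (assign z) * residual τ e z t
      = g (assign z) * (adjusted e z - τ • pathVec (assign z)) t
        - (1 / (T : ℝ)) * ∑ s, g (assign z) * (adjusted e z - τ • pathVec (assign z)) s := fun z => by
    rw [residual, centering_mulVec_apply, mul_sub, ← Finset.mul_sum]; ring
  have hs : Integrable (fun z => (1 / (T : ℝ)) *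
      ∑ s, g (assign z) * (adjusted e z - τ • pathVec (assign z)) s) ν :=
    (integrable_finsetSum _ fun s _ => (h s).1).const_mul _
  simp only [e1]
  refine ⟨(h t).1.sub hs, ?_⟩
  rw [integral_sub (h t).1 hs, integral_const_mul, integral_finsetSum _ fun s _ => (h s).1, (h t).2,
    Finset.sum_congr rfl fun s _ => (h s).2, Finset.sum_comm, Finset.mul_sum,
    ← Finset.sum_sub_distrib]
  refine Finset.sum_congr rfl fun w _ => ?_
  rw [centering_mulVec_apply, mul_sub, mul_sub, ← Finset.mul_sum, ← Finset.mul_sum]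
  ring

theorem integral_assign_mul_dot_residual (h_ign : LatentMeanIgnorable ν)
    (hint : ∀ b t, Integrable (fun z => potential b z t) ν) (e : UnitEst T) (τ : ℝ)
    (g : AssignPath T → ℝ) (p : AssignPath T → Fin T → ℝ) :
    ∫ z, g (assign z) * (p (assign z) ⬝ᵥ residual τ e z) ∂ν
      = ∑ w, propensity ν w * (g w * (p w ⬝ᵥ (centering T *ᵥ condMean ν e τ w))) := by
  have h := fun t => integral_assign_mul_residual h_ign hint e τ t fun w => g w * p w t
  have e1 : ∀ z : UnitData T, g (assign z) * (p (assign z) ⬝ᵥ residual τ e z)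
      = ∑ t, g (assign z) * p (assign z) t * residual τ e z t := fun z => by
    rw [dotProduct, Finset.mul_sum]; exact Finset.sum_congr rfl fun t _ => by ring
  simp only [e1]
  rw [integral_finsetSum _ fun t _ => (h t).1, Finset.sum_congr rfl fun t _ => (h t).2,
    Finset.sum_comm]
  refine Finset.sum_congr rfl fun w _ => ?_
  rw [dotProduct, Finset.mul_sum, Finset.mul_sum]
  exact Finset.sum_congr rfl fun t _ => by ring

end UnitLaw

/-! ### Weighted sums over assignment paths -/

/-- The reshaped weight `π(w) Π(w) / π̂(w)` of the path `w`. -/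
noncomputable def pathWeight {T : ℕ} (Pi : AssignPath T → ℝ) (ν : Measure (UnitData T))
    (e : UnitEst T) (w : AssignPath T) : ℝ :=
  propensity ν w * (Pi w / e.1 w)

/-- The root mean squared error of the propensity estimate, under the law of one unit. -/
noncomputable def propErr {T : ℕ} (ν : Measure (UnitData T)) (e : UnitEst T) : ℝ :=
  √(∑ w, propensity ν w * (e.1 w - propensity ν w) ^ 2)

/-- On S the difference is (π - π̂)Π/π̂. Since π(w) > c, the error at a single path is at most 1/√c
times the root mean squared error under π; the remaining 1/c bounds Π/π̂. Outside S both weights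
vanish. -/
theorem abs_pathWeight_sub_le {T : ℕ} {Pi : AssignPath T → ℝ} {S : Finset (AssignPath T)}
    (hPi : IsReshaped Pi S) {ν : Measure (UnitData T)} {e : UnitEst T} {c : ℝ} (hc : 0 < c)
    (ho : ∀ w ∈ S, c < propensity ν w) (he : ∀ w ∈ S, c < e.1 w) (w : AssignPath T) :
    |pathWeight Pi ν e w - Pi w| ≤ 1 / (c * √c) * propErr ν e := by
  by_cases hw : w ∈ S
  · have h1 := ho w hw
    have h2 := he w hw
    have h2' : e.1 w ≠ 0 := (hc.trans h2).ne'
    have e1 : pathWeight Pi ν e w - Pi w = (propensity ν w - e.1 w) * (Pi w / e.1 w) := by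
      rw [pathWeight]; field_simp
    have h3 : |propensity ν w - e.1 w| * √c ≤ propErr ν e := by
      rw [propErr]
      refine Real.le_sqrt_of_sq_le ?_
      rw [mul_pow, sq_abs, Real.sq_sqrt hc.le]
      refine le_trans ?_ (Finset.single_le_sum
        (f := fun w => propensity ν w * (e.1 w - propensity ν w) ^ 2)
        (fun w _ => mul_nonneg (propensity_nonneg ν w) (sq_nonneg _)) (Finset.mem_univ w))
      have : (propensity ν w - e.1 w) ^ 2 = (e.1 w - propensity ν w) ^ 2 := by ring
      rw [this, mul_comm]
      exact mul_le_mul_of_nonneg_right h1.le (sq_nonneg _)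
    have hsc : 0 < √c := Real.sqrt_pos.2 hc
    rw [e1, abs_mul]
    calc |propensity ν w - e.1 w| * |Pi w / e.1 w|
        ≤ |propensity ν w - e.1 w| * (1 / c) :=
          mul_le_mul_of_nonneg_left (abs_ratio_le hPi hc he w) (abs_nonneg _)
      _ = 1 / (c * √c) * (|propensity ν w - e.1 w| * √c) := by field_simp
      _ ≤ _ := by gcongr
  · rw [pathWeight, hPi.eq_zero hw]
    simp only [zero_div, mul_zero, sub_zero, abs_zero]
    exact mul_nonneg (by positivity) (Real.sqrt_nonneg _)

/-- The algebra of double robustness. Replacing the weights `lam` by `Pi` changes the form by terms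
that each contain a weight error and a residual, either in the same unit or as a product of two
averages. Cauchy–Schwarz bounds both kinds by the product of root mean squares. -/
theorem bilinear_sub_le {n T : ℕ} (hn : 0 < n) {W : Type*} [Fintype W] {lam : Fin n → W → ℝ}
    {Pi : W → ℝ} {p : W → Fin T → ℝ} {r : Fin n → W → Fin T → ℝ} {dP dY : Fin n → ℝ} {k a : ℝ}
    (hk : 0 ≤ k) (hPi0 : ∀ w, 0 ≤ Pi w) (hPi1 : ∑ w, Pi w = 1) (hp : ∀ w t, |p w t| ≤ 2)
    (hr : ∀ i w t, |r i w t| ≤ 2 * dY i) (hlam : ∀ i w, |lam i w - Pi w| ≤ k * dP i)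
    (hdP : ∀ i, 0 ≤ dP i) (hdY : ∀ i, 0 ≤ dY i) (ha : ∀ i, ∑ w, |lam i w| ≤ a) :
    |(avg (fun i => ∑ w, lam i w * (p w ⬝ᵥ r i w)) * avg (fun i => ∑ w, lam i w)
        - (fun t => avg fun i => ∑ w, lam i w * p w t) ⬝ᵥ
          (fun t => avg fun i => ∑ w, lam i w * r i w t))
      - (avg (fun i => ∑ w, Pi w * (p w ⬝ᵥ r i w))
        - (fun t => ∑ w, Pi w * p w t) ⬝ᵥ (fun t => avg fun i => ∑ w, Pi w * r i w t))|
      ≤ Fintype.card W * k * (8 * T * (a + 1))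
        * (√(avg fun i => dP i ^ 2) * √(avg fun i => dY i ^ 2)) := by
  set N : ℝ := (Fintype.card W : ℝ) with hN
  set X := √(avg fun i => dP i ^ 2) * √(avg fun i => dY i ^ 2) with hX
  have hT0 : (0 : ℝ) ≤ T := Nat.cast_nonneg _
  have hN0 : 0 ≤ N := Nat.cast_nonneg _
  have hX1 : avg (fun i => dP i * dY i) ≤ X := avg_mul_le
  have hX2 : avg dP * avg dY ≤ X :=
    mul_le_mul (Real.le_sqrt_of_sq_le (sq_avg_le hn)) (Real.le_sqrt_of_sq_le (sq_avg_le hn))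
      (avg_nonneg hdY) (Real.sqrt_nonneg _)
  have a0 : 0 ≤ a := (Finset.sum_nonneg fun w _ => abs_nonneg _).trans (ha ⟨0, hn⟩)
  -- a weighted sum against `lam - Pi` is small
  have hdiff : ∀ (f : Fin n → W → ℝ) (b : Fin n → ℝ), (∀ i w, |f i w| ≤ b i) →
      |avg (fun i => ∑ w, lam i w * f i w) - avg (fun i => ∑ w, Pi w * f i w)|
        ≤ N * k * avg fun i => dP i * b i := by
    intro f b hf
    rw [← avg_sub]
    refine abs_avg_le_avg.trans ?_
    rw [← avg_const_mul]
    refine avg_mono fun i => ?_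
    rw [← Finset.sum_sub_distrib]
    refine (Finset.abs_sum_le_sum_abs _ _).trans ?_
    calc _ ≤ ∑ _w : W, k * dP i * b i := Finset.sum_le_sum fun w _ => by
          rw [← sub_mul, abs_mul]
          exact mul_le_mul (hlam i w) (hf i w) (abs_nonneg _) (mul_nonneg hk (hdP i))
      _ = _ := by
          rw [Finset.sum_const, Finset.card_univ, nsmul_eq_mul]; ring
  have hPisum : ∀ (f : W → ℝ) (b : ℝ), (∀ w, |f w| ≤ b) → |∑ w, Pi w * f w| ≤ b := by
    intro f b hf
    refine (Finset.abs_sum_le_sum_abs _ _).trans ?_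
    calc _ ≤ ∑ w, Pi w * b := Finset.sum_le_sum fun w _ => by
          rw [abs_mul, abs_of_nonneg (hPi0 w)]
          exact mul_le_mul_of_nonneg_left (hf w) (hPi0 w)
      _ = b := by rw [← Finset.sum_mul, hPi1, one_mul]
  have hpr : ∀ i w, |p w ⬝ᵥ r i w| ≤ T * (2 * (2 * dY i)) := fun i w =>
    abs_dotProduct_le (hp w) (hr i w)
  set A := avg fun i => ∑ w, lam i w with hA
  set B := avg fun i => ∑ w, lam i w * (p w ⬝ᵥ r i w)
  set B₀ := avg fun i => ∑ w, Pi w * (p w ⬝ᵥ r i w)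
  set Pm : Fin T → ℝ := fun t => avg fun i => ∑ w, lam i w * p w t
  set P₀ : Fin T → ℝ := fun t => ∑ w, Pi w * p w t
  set Q : Fin T → ℝ := fun t => avg fun i => ∑ w, lam i w * r i w t
  set Q₀ : Fin T → ℝ := fun t => avg fun i => ∑ w, Pi w * r i w t
  have bA : |A| ≤ a := abs_avg_le hn fun i => (Finset.abs_sum_le_sum_abs _ _).trans (ha i)
  have bA1 : |A - 1| ≤ N * k * avg dP := by
    have h := hdiff (fun _ _ => 1) (fun _ => 1) (fun _ _ => by simp)
    simp only [mul_one, hPi1, avg_const hn] at h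
    exact h
  have bB : |B - B₀| ≤ N * k * (T * 4 * X) := by
    refine (hdiff _ _ hpr).trans (mul_le_mul_of_nonneg_left ?_ (by positivity))
    have : (fun i => dP i * (T * (2 * (2 * dY i)))) = fun i => T * 4 * (dP i * dY i) := by
      ext i; ring
    rw [this, avg_const_mul]
    gcongr
  have bB₀ : |B₀| ≤ T * 4 * avg dY := by
    refine abs_avg_le_avg.trans ?_
    rw [← avg_const_mul]
    exact avg_mono fun i => (hPisum _ _ (hpr i)).trans (by linarith)
  have bPm : ∀ t, |Pm t| ≤ 2 * a := fun t => by
    refine abs_avg_le hn fun i => (Finset.abs_sum_le_sum_abs _ _).trans ?_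
    calc _ ≤ ∑ w, |lam i w| * 2 := Finset.sum_le_sum fun w _ => by
          rw [abs_mul]; exact mul_le_mul_of_nonneg_left (hp w t) (abs_nonneg _)
      _ ≤ _ := by rw [← Finset.sum_mul]; linarith [ha i]
  have bP : ∀ t, |(Pm - P₀) t| ≤ N * k * (2 * avg dP) := fun t => by
    have h := hdiff (fun _ w => p w t) (fun _ => 2) (fun _ w => hp w t)
    rw [avg_const hn] at h
    have : (fun i => dP i * 2) = fun i => 2 * dP i := by ext i; ring
    rw [this, avg_const_mul] at h
    exact h
  have bQ : ∀ t, |(Q - Q₀) t| ≤ N * k * (2 * X) := fun t => by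
    refine (hdiff (fun i w => r i w t) (fun i => 2 * dY i) (fun i w => hr i w t)).trans
      (mul_le_mul_of_nonneg_left ?_ (by positivity))
    have : (fun i => dP i * (2 * dY i)) = fun i => 2 * (dP i * dY i) := by ext i; ring
    rw [this, avg_const_mul]
    gcongr
  have bQ₀ : ∀ t, |Q₀ t| ≤ 2 * avg dY := fun t => by
    refine abs_avg_le_avg.trans ?_
    rw [← avg_const_mul]
    exact avg_mono fun i => hPisum _ _ fun w => hr i w t
  -- The weights `Pi` sum to one, so the factor A is compared with 1. The splitting pairs each
  -- weight error with a factor that is bounded or of the size of the residuals.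
  have e : (B * A - Pm ⬝ᵥ Q) - (B₀ - P₀ ⬝ᵥ Q₀)
      = (B - B₀) * A + B₀ * (A - 1) - Pm ⬝ᵥ (Q - Q₀) - (Pm - P₀) ⬝ᵥ Q₀ := by
    simp only [sub_dotProduct, dotProduct_sub]; ring
  have t1 : |(B - B₀) * A| ≤ N * k * (T * 4 * X) * a := by
    rw [abs_mul]; gcongr
  have t2 : |B₀ * (A - 1)| ≤ N * k * (T * 4 * X) := by
    rw [abs_mul]
    calc |B₀| * |A - 1| ≤ (T * 4 * avg dY) * (N * k * avg dP) :=
          mul_le_mul bB₀ bA1 (abs_nonneg _) ((abs_nonneg _).trans bB₀)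
      _ = N * k * (T * 4) * (avg dP * avg dY) := by ring
      _ ≤ N * k * (T * 4) * X := by gcongr
      _ = _ := by ring
  have t3 : |Pm ⬝ᵥ (Q - Q₀)| ≤ T * (2 * a * (N * k * (2 * X))) := abs_dotProduct_le bPm bQ
  have t4 : |(Pm - P₀) ⬝ᵥ Q₀| ≤ N * k * (T * 4) * X := by
    refine (abs_dotProduct_le bP bQ₀).trans ?_
    calc _ = N * k * (T * 4) * (avg dP * avg dY) := by ring
      _ ≤ N * k * (T * 4) * X := by gcongr
  rw [e]
  calc _ ≤ |(B - B₀) * A| + |B₀ * (A - 1)| + |Pm ⬝ᵥ (Q - Q₀)| + |(Pm - P₀) ⬝ᵥ Q₀| :=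
        (abs_sub _ _).trans (add_le_add ((abs_sub _ _).trans
          (add_le_add (abs_add_le _ _) le_rfl)) le_rfl)
    _ ≤ N * k * (T * 4 * X) * a + N * k * (T * 4 * X) + T * (2 * a * (N * k * (2 * X)))
        + N * k * (T * 4) * X := by linarith
    _ = _ := by ring

/-! ### The denominator -/

/-- Lagrange's identity: a weighted variance as a sum over pairs. With nonnegative weights every
term is nonnegative, so positivity and monotonicity in the weights become visible. -/
theorem denominator_eq_pairs {W : Type*} [Fintype W] {T : ℕ} (lam : W → ℝ) (p : W → Fin T → ℝ) :
    (∑ w, lam w * (p w ⬝ᵥ p w)) * (∑ w, lam w)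
      - (fun t => ∑ w, lam w * p w t) ⬝ᵥ (fun t => ∑ w, lam w * p w t)
      = 1 / 2 * ∑ w, ∑ w', lam w * lam w' * ((p w - p w') ⬝ᵥ (p w - p w')) := by
  have h1 : ∑ w, ∑ w', lam w * lam w' * ((p w - p w') ⬝ᵥ (p w - p w'))
      = ∑ w, ∑ w', lam w * (p w ⬝ᵥ p w) * lam w' + ∑ w, ∑ w', lam w * (lam w' * (p w' ⬝ᵥ p w'))
        - 2 * ∑ w, ∑ w', lam w * lam w' * (p w ⬝ᵥ p w') := by
    simp only [Finset.mul_sum, ← Finset.sum_add_distrib, ← Finset.sum_sub_distrib]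
    refine Finset.sum_congr rfl fun w _ => Finset.sum_congr rfl fun w' _ => ?_
    simp only [sub_dotProduct, dotProduct_sub]
    rw [dotProduct_comm (p w') (p w)]
    ring
  have h2 : (fun t => ∑ w, lam w * p w t) ⬝ᵥ (fun t => ∑ w, lam w * p w t)
      = ∑ w, ∑ w', lam w * lam w' * (p w ⬝ᵥ p w') := by
    simp only [dotProduct]
    simp_rw [Finset.sum_mul_sum]
    simp only [Finset.mul_sum]
    rw [Finset.sum_comm]
    refine Finset.sum_congr rfl fun w _ => ?_
    rw [Finset.sum_comm]
    exact Finset.sum_congr rfl fun w' _ => Finset.sum_congr rfl fun t _ => by ring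
  rw [h1, h2, ← Finset.sum_mul_sum, ← Finset.sum_mul_sum]
  ring

/-- J annihilates only constants, so equal images force w - w' to be constant. Where w is 1 the
difference is 0 or 1, and where w is 0 it is 0 or -1; a nonconstant w has both kinds of periods, so
the difference is 0. -/
theorem demeaned_ne {T : ℕ} {w w' : AssignPath T} (h0 : w ≠ fun _ => false)
    (h1 : w ≠ fun _ => true) (hne : w ≠ w') : demeaned w ≠ demeaned w' := by
  intro h
  have hk : ∀ t s, pathVec w t - pathVec w' t = pathVec w s - pathVec w' s := by
    intro t s
    have ht := congrFun h t
    have hs := congrFun h s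
    simp only [demeaned, centering_mulVec_apply] at ht hs
    linarith
  obtain ⟨t, ht⟩ : ∃ t, w t = true := by
    by_contra! hh
    exact h0 (funext fun t => by simpa using hh t)
  obtain ⟨s, hs⟩ : ∃ s, w s = false := by
    by_contra! hh
    exact h1 (funext fun s => by simpa using hh s)
  apply hne
  ext u
  have a1 := hk t s
  have a2 := hk u t
  simp only [pathVec, ht, hs] at a1 a2
  have h01 : ∀ b : Bool, (if b then (1 : ℝ) else 0) = 0 ∨ (if b then (1 : ℝ) else 0) = 1 := by
    intro b; cases b <;> simp
  have a3 : (if w' t then (1 : ℝ) else 0) = 1 := by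
    rcases h01 (w' t) with h | h <;> rcases h01 (w' s) with h' | h' <;> rw [h] at a1 ⊢ <;>
      rw [h'] at a1 <;> norm_num at a1
  rw [a3] at a2
  cases hu : w u <;> cases hu' : w' u <;> rw [hu, hu'] at a2 <;> norm_num at a2

/-- The variance of the demeaned path under the reshaped distribution, written over pairs. -/
noncomputable def pathSpread {T : ℕ} (Pi : AssignPath T → ℝ) : ℝ :=
  1 / 2 * ∑ w, ∑ w', Pi w * Pi w' *
    ((demeaned w - demeaned w') ⬝ᵥ (demeaned w - demeaned w'))

theorem pathSpread_pos {T : ℕ} {Pi : AssignPath T → ℝ} {S : Finset (AssignPath T)}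
    (hPi : IsReshaped Pi S) (hS_card : 2 ≤ S.card)
    (hS : ∃ w ∈ S, w ≠ (fun _ => false) ∧ w ≠ (fun _ => true)) : 0 < pathSpread Pi := by
  obtain ⟨w, hw, h0, h1⟩ := hS
  obtain ⟨w', hw', hne⟩ := Finset.exists_mem_ne (by omega : 1 < S.card) w
  have hnn : ∀ a b : AssignPath T, 0 ≤ Pi a * Pi b *
      ((demeaned a - demeaned b) ⬝ᵥ (demeaned a - demeaned b)) := fun a b =>
    mul_nonneg (mul_nonneg (hPi.nonneg _) (hPi.nonneg _))
      (Finset.sum_nonneg fun t _ => mul_self_nonneg _)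
  refine mul_pos (by norm_num) (Finset.sum_pos' (fun a _ => Finset.sum_nonneg fun b _ => hnn a b)
    ⟨w, Finset.mem_univ _, Finset.sum_pos' (fun b _ => hnn w b) ⟨w', Finset.mem_univ _, ?_⟩⟩)
  refine mul_pos (mul_pos ((hPi.support w).2 hw) ((hPi.support w').2 hw')) ?_
  refine lt_of_le_of_ne (Finset.sum_nonneg fun t _ => mul_self_nonneg _) fun h => ?_
  have := dotProduct_self_eq_zero.1 h.symm
  exact demeaned_ne h0 h1 hne.symm (sub_eq_zero.1 this)

theorem pathSpread_mul_le {T : ℕ} {Pi lam : AssignPath T → ℝ} (hPi : ∀ w, 0 ≤ Pi w) {c : ℝ}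
    (hc : 0 ≤ c) (h : ∀ w, c * Pi w ≤ lam w) :
    c ^ 2 * pathSpread Pi ≤ (∑ w, lam w * (demeaned w ⬝ᵥ demeaned w)) * (∑ w, lam w)
      - (fun t => ∑ w, lam w * demeaned w t) ⬝ᵥ (fun t => ∑ w, lam w * demeaned w t) := by
  rw [denominator_eq_pairs, pathSpread, mul_left_comm, Finset.mul_sum]
  refine mul_le_mul_of_nonneg_left (Finset.sum_le_sum fun w _ => ?_) (by norm_num)
  rw [Finset.mul_sum]
  refine Finset.sum_le_sum fun w' _ => ?_
  rw [← mul_assoc]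
  refine mul_le_mul_of_nonneg_right ?_ (Finset.sum_nonneg fun t _ => mul_self_nonneg _)
  calc c ^ 2 * (Pi w * Pi w') = (c * Pi w) * (c * Pi w') := by ring
    _ ≤ _ := mul_le_mul (h w) (h w') (mul_nonneg hc (hPi _))
        ((mul_nonneg hc (hPi _)).trans (h w))

/-! ### Orthogonality from the DATE equation -/

theorem dotProduct_avg_sum {n T : ℕ} {W : Type*} [Fintype W] (u : Fin T → ℝ) (lam : Fin n → W → ℝ)
    (r : Fin n → W → Fin T → ℝ) :
    (u ⬝ᵥ fun t => avg fun i => ∑ w, lam i w * r i w t)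
      = avg fun i => ∑ w, lam i w * (u ⬝ᵥ r i w) := by
  simp only [dotProduct, ← avg_const_mul]
  rw [← avg_sum]
  congr 1; ext i
  simp only [Finset.mul_sum]
  rw [Finset.sum_comm]
  exact Finset.sum_congr rfl fun w _ => Finset.sum_congr rfl fun t _ => by ring

theorem DateEquation.apply {T : ℕ} {Pi : AssignPath T → ℝ} {ξ : Fin T → ℝ}
    (h : DateEquation Pi ξ) (t : Fin T) :
    ∑ w, Pi w * (pathVec w t * (centering T *ᵥ (pathVec w - reshapedMean Pi)) t)
      = ξ t * ∑ w, Pi w * (pathVec w ⬝ᵥ (centering T *ᵥ (pathVec w - reshapedMean Pi))) := by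
  have h' := congrFun h t
  simp only [Finset.sum_apply, _root_.Pi.smul_apply, smul_eq_mul, Matrix.sub_mulVec,
    _root_.Pi.sub_apply, Matrix.mulVec_diagonal, Matrix.vecMulVec_mulVec, _root_.Pi.zero_apply,
    mul_sub, Finset.sum_sub_distrib] at h'
  rw [Finset.mul_sum]
  have e : ∀ w, ξ t * (Pi w * (pathVec w ⬝ᵥ (centering T *ᵥ (pathVec w - reshapedMean Pi))))
      = Pi w * (MulOpposite.op (pathVec w ⬝ᵥ (centering T *ᵥ (pathVec w - reshapedMean Pi)))
        • ξ) t := by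
    intro w
    simp only [_root_.Pi.smul_apply, MulOpposite.smul_eq_mul_unop, MulOpposite.unop_op]
    ring
  simp only [e]
  exact sub_eq_zero.1 h'

/-- Under Π the vector JW - E[JW] has mean zero, which removes the part v that does not depend on
the path. For the part W_t δ_t, the DATE equation says that E[W_t (J(W - E W))_t] is proportional to
ξ_t, so what remains is a multiple of the ξ-weighted average of δ, which is zero. -/
theorem date_orthogonality {n T : ℕ} (hT : 0 < T) {Pi : AssignPath T → ℝ} (hsum : ∑ w, Pi w = 1)
    {ξ : Fin T → ℝ} (hdate : DateEquation Pi ξ) (v δ : Fin n → Fin T → ℝ)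
    (hδ : ∑ t, ξ t * avg (fun i => δ i t) = 0) :
    avg (fun i => ∑ w, Pi w * (demeaned w ⬝ᵥ
        (centering T *ᵥ (v i + fun t => pathVec w t * δ i t))))
      - (fun t => ∑ w, Pi w * demeaned w t) ⬝ᵥ (fun t => avg fun i =>
        ∑ w, Pi w * (centering T *ᵥ (v i + fun t => pathVec w t * δ i t)) t) = 0 := by
  set P₀ : Fin T → ℝ := fun t => ∑ w, Pi w * demeaned w t with hP₀
  have hP₀C : P₀ = centering T *ᵥ reshapedMean Pi := by
    ext t
    rw [reshapedMean, Matrix.mulVec_sum]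
    simp [hP₀, demeaned, Matrix.mulVec_smul]
  have hg : ∀ w, demeaned w - P₀ = centering T *ᵥ (pathVec w - reshapedMean Pi) := fun w => by
    rw [Matrix.mulVec_sub, hP₀C, demeaned]
  rw [dotProduct_avg_sum P₀ (fun _ => Pi), ← avg_sub]
  -- The proportionality constant in the DATE equation; it is the same for every unit.
  set κ := ∑ w, Pi w * (pathVec w ⬝ᵥ (centering T *ᵥ (pathVec w - reshapedMean Pi))) with hκ
  have hi : ∀ i, ∑ w, Pi w * (demeaned w ⬝ᵥ
        (centering T *ᵥ (v i + fun t => pathVec w t * δ i t)))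
      - ∑ w, Pi w * (P₀ ⬝ᵥ (centering T *ᵥ (v i + fun t => pathVec w t * δ i t)))
      = κ * ∑ t, ξ t * δ i t := by
    intro i
    have h1 : ∀ t, ∑ w, Pi w * (demeaned w - P₀) t = 0 := fun t => by
      simp only [_root_.Pi.sub_apply, mul_sub, Finset.sum_sub_distrib, ← Finset.sum_mul, hsum,
        one_mul]
      exact sub_self _
    have h2 : ∀ w, (demeaned w - P₀) ⬝ᵥ (centering T *ᵥ (v i + fun t => pathVec w t * δ i t))
        = ∑ t, v i t * (demeaned w - P₀) t
          + ∑ t, δ i t * (pathVec w t * (demeaned w - P₀) t) := fun w => by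
      rw [hg, centering_mulVec_dotProduct hT, dotProduct, ← Finset.sum_add_distrib]
      refine Finset.sum_congr rfl fun t _ => ?_
      simp only [_root_.Pi.add_apply]; ring
    have h3 : ∑ w, Pi w * ∑ t, v i t * (demeaned w - P₀) t = 0 := by
      simp only [Finset.mul_sum]
      rw [Finset.sum_comm]
      refine Finset.sum_eq_zero fun t _ => ?_
      rw [← mul_zero (v i t), ← h1 t, Finset.mul_sum]
      exact Finset.sum_congr rfl fun w _ => by ring
    have h4 : ∑ w, Pi w * ∑ t, δ i t * (pathVec w t * (demeaned w - P₀) t)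
        = κ * ∑ t, ξ t * δ i t := by
      simp only [Finset.mul_sum]
      rw [Finset.sum_comm]
      refine Finset.sum_congr rfl fun t _ => ?_
      have h5 := hdate.apply t
      rw [← hκ] at h5
      simp only [hg]
      calc _ = δ i t * ∑ w, Pi w * (pathVec w t *
            (centering T *ᵥ (pathVec w - reshapedMean Pi)) t) := by
            rw [Finset.mul_sum]; exact Finset.sum_congr rfl fun w _ => by ring
        _ = _ := by rw [h5]; ring
    rw [← Finset.sum_sub_distrib]
    simp only [← mul_sub, ← sub_dotProduct, h2]
    simp only [mul_add, Finset.sum_add_distrib, h3, h4, zero_add]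
  simp only [hi]
  rw [avg_const_mul, avg_sum]
  simp only [avg_const_mul, hδ, mul_zero]

/-! ### Bias and denominator for fixed estimates -/

theorem centering_mulVec_const {T : ℕ} (hT : 0 < T) (k : ℝ) :
    centering T *ᵥ (fun _ : Fin T => k) = 0 := by
  have : (T : ℝ) ≠ 0 := by exact_mod_cast hT.ne'
  ext t
  rw [centering_mulVec_apply]
  simp [this]

/-- The accuracy of the outcome model of one unit. -/
noncomputable def outErr {n T : ℕ} (ν : Fin n → Measure (UnitData T)) (ξ : Fin T → ℝ)
    (e : Fin n → UnitEst T) (i : Fin n) : ℝ :=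
  √(∑ t, ((e i).2 t - centeredMean ν i t) ^ 2) + √(∑ t, (effect (ν i) t - date ξ ν) ^ 2)

theorem abs_le_sqrt_sum_sq {ι : Type*} [Fintype ι] (f : ι → ℝ) (t : ι) : |f t| ≤ √(∑ t, f t ^ 2) := by
  refine Real.le_sqrt_of_sq_le ?_
  rw [sq_abs]
  exact Finset.single_le_sum (f := fun t => f t ^ 2) (fun t _ => sq_nonneg _) (Finset.mem_univ t)

/-- Double centering changes the baseline mean by a unit constant, which J kills, and by a time
effect common to all units, which survives as the last term. That term drops out of the bias because
the regression contains time effects. -/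
theorem centering_condMean {n T : ℕ} (hT : 0 < T) (ν : Fin n → Measure (UnitData T))
    (e : Fin n → UnitEst T) (τ : ℝ) (i : Fin n) (w : AssignPath T) :
    centering T *ᵥ condMean (ν i) (e i) τ w
      = centering T *ᵥ ((fun t => centeredMean ν i t - (e i).2 t)
          + fun t => pathVec w t * (effect (ν i) t - τ))
        + centering T *ᵥ fun t => avg fun j => baseMean (ν j) t := by
  have e1 : condMean (ν i) (e i) τ w = (((fun t => centeredMean ν i t - (e i).2 t)
      + fun t => pathVec w t * (effect (ν i) t - τ)) + fun t => avg fun j => baseMean (ν j) t)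
      + fun _ => (1 / (T : ℝ)) * ∑ s, baseMean (ν i) s
        - (1 / ((n : ℝ) * (T : ℝ))) * ∑ j, ∑ s, baseMean (ν j) s := by
    ext t
    simp only [condMean, centeredMean, avg, Pi.add_apply]
    ring
  rw [e1, Matrix.mulVec_add, centering_mulVec_const hT, add_zero, Matrix.mulVec_add]

theorem abs_centered_residual_le {n T : ℕ} (ν : Fin n → Measure (UnitData T)) (ξ : Fin T → ℝ)
    (e : Fin n → UnitEst T) (i : Fin n) (w : AssignPath T) (t : Fin T) :
    |(centering T *ᵥ ((fun t => centeredMean ν i t - (e i).2 t)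
          + fun t => pathVec w t * (effect (ν i) t - date ξ ν))) t| ≤ 2 * outErr ν ξ e i := by
  refine abs_centering_mulVec_le (fun s => ?_) t
  rw [Pi.add_apply, outErr]
  refine (abs_add_le _ _).trans (add_le_add ?_ ?_)
  · rw [abs_sub_comm]
    exact abs_le_sqrt_sum_sq (fun t => (e i).2 t - centeredMean ν i t) s
  · rw [abs_mul]
    exact (mul_le_of_le_one_left (abs_nonneg _) (abs_pathVec_le w s)).trans
      (abs_le_sqrt_sum_sq (fun t => effect (ν i) t - date ξ ν) s)

theorem integral_unit {Ω : Type*} [MeasurableSpace Ω] {P : Measure Ω} {n T : ℕ}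
    {Z : Ω → Fin n → UnitData T} {ν : Fin n → Measure (UnitData T)} (hZ : Measurable Z)
    (hlaw : ∀ i, P.map (fun ω => Z ω i) = ν i) (i : Fin n) {f : UnitData T → ℝ}
    (hf : Measurable f) : ∫ ω, f (Z ω i) ∂P = ∫ z, f z ∂(ν i) := by
  have h : Measurable fun ω => Z ω i := (measurable_pi_apply i).comp hZ
  rw [← hlaw i, integral_map h.aemeasurable hf.aestronglyMeasurable]

section Population

variable {Ω : Type*} [MeasurableSpace Ω] {P : Measure Ω} {n T : ℕ}
  {Pi : AssignPath T → ℝ} {e : Fin n → UnitEst T} {Z : Ω → Fin n → UnitData T} {τ : ℝ}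
  {ν : Fin n → Measure (UnitData T)} [∀ i, IsProbabilityMeasure (ν i)]

theorem integral_unit_assign (hZ : Measurable Z) (hlaw : ∀ i, P.map (fun ω => Z ω i) = ν i)
    (i : Fin n) (f : AssignPath T → ℝ) :
    ∫ ω, theta Pi (e i) (Z ω i) * f (assign (Z ω i)) ∂P
      = ∑ w, pathWeight Pi (ν i) (e i) w * f w := by
  have h := integral_unit hZ hlaw i (f := fun z => theta Pi (e i) z * f (assign z))
    ((measurable_theta_fixed (e i)).mul (measurable_comp_assign f))
  refine h.trans ((integral_comp_assign fun w => Pi w / (e i).1 w * f w).trans ?_)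
  exact Finset.sum_congr rfl fun w _ => by rw [pathWeight, mul_assoc]

variable [IsProbabilityMeasure P]

theorem integral_gammaTheta_eq (hZ : Measurable Z) (hlaw : ∀ i, P.map (fun ω => Z ω i) = ν i)
    {L : ℝ} (hL : 1 ≤ L) (hb : ∀ᵐ ω ∂P, UnitBounds Pi e Z τ L ω) :
    ∫ ω, gammaTheta Pi e (Z ω) ∂P = avg fun i => ∑ w, pathWeight Pi (ν i) (e i) w := by
  rw [integral_gammaTheta hZ hL hb]
  congr 1; ext i
  have := integral_unit_assign (Pi := Pi) (e := e) hZ hlaw i fun _ => 1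
  simpa using this

theorem meanW_eq_avg (hZ : Measurable Z) (hlaw : ∀ i, P.map (fun ω => Z ω i) = ν i)
    {L : ℝ} (hL : 1 ≤ L) (hb : ∀ᵐ ω ∂P, UnitBounds Pi e Z τ L ω) :
    meanW P Pi e Z = fun t => avg fun i => ∑ w, pathWeight Pi (ν i) (e i) w * demeaned w t := by
  ext t
  rw [meanW_eq hZ hL hb]
  congr 1; ext i
  exact integral_unit_assign hZ hlaw i fun w => demeaned w t

/-- A uniform lower bound for the population denominator. -/
theorem le_meanDenom (hT : 0 < T) (hn : 0 < n) (hZ : Measurable Z)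
    (hlaw : ∀ i, P.map (fun ω => Z ω i) = ν i) {L : ℝ} (hL : 1 ≤ L)
    (hb : ∀ᵐ ω ∂P, UnitBounds Pi e Z τ L ω) {S : Finset (AssignPath T)} (hPi : IsReshaped Pi S)
    {c : ℝ} (hc : 0 < c) (ho : ∀ i, ∀ w ∈ S, c < propensity (ν i) w)
    (he : ∀ i, ∀ w ∈ S, c < (e i).1 w) (he1 : ∀ i w, (e i).1 w ≤ 1) :
    c ^ 2 * pathSpread Pi ≤ meanDenom P Pi e Z := by
  -- On the support π exceeds c, and π̂ ≤ 1 means that dividing by it does not decrease Π.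
  have hlam : ∀ w, c * Pi w ≤ avg fun i => pathWeight Pi (ν i) (e i) w := by
    intro w
    rw [← avg_const hn (c * Pi w)]
    refine avg_mono fun i => ?_
    by_cases hw : w ∈ S
    · rw [pathWeight]
      have h2 := hc.trans (he i w hw)
      refine mul_le_mul (ho i w hw).le ?_ (hPi.nonneg w) (propensity_nonneg _ _)
      exact le_div_self (hPi.nonneg w) h2 (he1 i w)
    · rw [pathWeight, hPi.eq_zero hw]; simp
  have h := pathSpread_mul_le hPi.nonneg hc.le hlam
  have e1 : ∀ f : AssignPath T → ℝ, ∑ w, avg (fun i => pathWeight Pi (ν i) (e i) w) * f w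
      = avg fun i => ∑ w, pathWeight Pi (ν i) (e i) w * f w := by
    intro f
    rw [avg_sum]
    refine Finset.sum_congr rfl fun w _ => ?_
    rw [mul_comm, ← avg_const_mul]
    congr 1; ext i; ring
  have hWW : ∫ ω, gammaWW Pi e (Z ω) ∂P
      = avg fun i => ∑ w, pathWeight Pi (ν i) (e i) w * (demeaned w ⬝ᵥ demeaned w) := by
    rw [integral_gammaWW hT hZ hL hb]
    congr 1; ext i
    exact integral_unit_assign hZ hlaw i fun w => demeaned w ⬝ᵥ demeaned w
  rw [meanDenom, hWW, integral_gammaTheta_eq hZ hlaw hL hb, meanW_eq_avg hZ hlaw hL hb]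
  rw [e1] at h
  simp only [e1] at h
  rwa [← avg_sum] at h

/-- The bias is at most a constant times the product of the accuracies of the two estimates. -/
theorem abs_biasTerm_le (hT : 0 < T) (hn : 0 < n) (hZ : Measurable Z)
    (hlaw : ∀ i, P.map (fun ω => Z ω i) = ν i) {ξ : Fin T → ℝ} (hξ : ∑ t, ξ t = 1) {L : ℝ}
    (hL : 1 ≤ L) (hb : ∀ᵐ ω ∂P, UnitBounds Pi e Z (date ξ ν) L ω) {S : Finset (AssignPath T)}
    (hPi : IsReshaped Pi S) (hdate : DateEquation Pi ξ) {c : ℝ} (hc : 0 < c)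
    (ho : ∀ i, ∀ w ∈ S, c < propensity (ν i) w) (he : ∀ i, ∀ w ∈ S, c < (e i).1 w)
    (h_ign : ∀ i, LatentMeanIgnorable (ν i))
    (hint : ∀ i b t, Integrable (fun z => potential b z t) (ν i)) :
    |biasTerm P Pi e Z (date ξ ν)|
      ≤ Fintype.card (AssignPath T) * (1 / (c * √c)) * (8 * T * (1 / c + 1))
        * (√(avg fun i => propErr (ν i) (e i) ^ 2) * √(avg fun i => outErr ν ξ e i ^ 2)) := by
  set τ := date ξ ν with hτ
  set lam : Fin n → AssignPath T → ℝ := fun i => pathWeight Pi (ν i) (e i) with hlam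
  set r : Fin n → AssignPath T → Fin T → ℝ := fun i w =>
    centering T *ᵥ ((fun t => centeredMean ν i t - (e i).2 t)
      + fun t => pathVec w t * (effect (ν i) t - τ)) with hr
  set β : Fin T → ℝ := centering T *ᵥ fun t => avg fun j => baseMean (ν j) t with hβ
  have hC : ∀ i w, centering T *ᵥ condMean (ν i) (e i) τ w = r i w + β :=
    fun i w => centering_condMean hT ν e τ i w
  have hA := integral_gammaTheta_eq hZ hlaw hL hb
  have hP := meanW_eq_avg hZ hlaw hL hb
  have hB : meanWY P Pi e Z τ = avg (fun i => ∑ w, lam i w * (demeaned w ⬝ᵥ r i w))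
      + meanW P Pi e Z ⬝ᵥ β := by
    rw [meanWY_eq hT hZ hL hb, hP, dotProduct_comm, dotProduct_avg_sum, ← avg_add]
    congr 1; ext i
    refine (integral_unit hZ hlaw i (f := fun z => theta Pi (e i) z *
      (demeaned (assign z) ⬝ᵥ residual τ (e i) z)) ((measurable_theta_fixed (e i)).mul
      (measurable_dotProduct measurable_demeaned (measurable_residual_fixed (e i))))).trans ?_
    refine (integral_assign_mul_dot_residual (h_ign i) (hint i) (e i) τ
      (fun w => Pi w / (e i).1 w) demeaned).trans ?_
    rw [← Finset.sum_add_distrib]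
    refine Finset.sum_congr rfl fun w _ => ?_
    rw [hC, dotProduct_add, dotProduct_comm (demeaned w) β, hlam]
    simp only [pathWeight]
    ring
  have hQ : meanY P Pi e Z τ = (fun t => avg fun i => ∑ w, lam i w * r i w t)
      + (∫ ω, gammaTheta Pi e (Z ω) ∂P) • β := by
    ext t
    rw [meanY_eq hZ hL hb, _root_.Pi.add_apply, _root_.Pi.smul_apply, smul_eq_mul, hA, mul_comm,
      ← avg_const_mul, ← avg_add]
    congr 1; ext i
    refine (integral_unit hZ hlaw i (f := fun z => theta Pi (e i) z * residual τ (e i) z t)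
      ((measurable_theta_fixed (e i)).mul (measurable_residual_fixed (e i) t))).trans ?_
    refine (integral_assign_mul_residual (h_ign i) (hint i) (e i) τ t
      (fun w => Pi w / (e i).1 w)).2.trans ?_
    rw [Finset.mul_sum, ← Finset.sum_add_distrib]
    refine Finset.sum_congr rfl fun w _ => ?_
    rw [hC, hlam, _root_.Pi.add_apply]
    simp only [pathWeight]
    ring
  -- The common time effect β adds E[Γ_w]·β to one factor and E[Γ_θ]β to the other; the two
  -- contributions cancel.
  have hN : biasTerm P Pi e Z τ = avg (fun i => ∑ w, lam i w * (demeaned w ⬝ᵥ r i w))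
        * avg (fun i => ∑ w, lam i w)
      - (fun t => avg fun i => ∑ w, lam i w * demeaned w t) ⬝ᵥ
        (fun t => avg fun i => ∑ w, lam i w * r i w t) := by
    rw [biasTerm, hB, hQ, dotProduct_add, dotProduct_smul, smul_eq_mul, hA, hP]
    ring
  have hδ : ∑ t, ξ t * avg (fun i => effect (ν i) t - τ) = 0 := by
    have : ∀ t, avg (fun i => effect (ν i) t - τ) = avg (fun i => effect (ν i) t) - τ := fun t => by
      rw [avg_sub, avg_const hn]
    simp only [this, mul_sub, Finset.sum_sub_distrib, ← Finset.sum_mul, hξ, one_mul]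
    exact sub_self _
  have hzero := date_orthogonality hT hPi.sum_eq_one hdate
    (fun i t => centeredMean ν i t - (e i).2 t) (fun i t => effect (ν i) t - τ) hδ
  have h := bilinear_sub_le hn (lam := lam) (Pi := Pi) (p := demeaned) (r := r)
    (dP := fun i => propErr (ν i) (e i)) (dY := outErr ν ξ e) (k := 1 / (c * √c)) (a := 1 / c)
    (by positivity) hPi.nonneg hPi.sum_eq_one abs_demeaned_le
    (fun i w t => abs_centered_residual_le ν ξ e i w t)
    (fun i w => abs_pathWeight_sub_le hPi hc (ho i) (he i) w) (fun i => Real.sqrt_nonneg _)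
    (fun i => add_nonneg (Real.sqrt_nonneg _) (Real.sqrt_nonneg _))
    (fun i => by
      calc ∑ w, |lam i w| ≤ ∑ w, propensity (ν i) w * (1 / c) :=
            Finset.sum_le_sum fun w _ => by
              simp only [hlam, pathWeight]
              rw [abs_mul, abs_of_nonneg (propensity_nonneg _ _)]
              exact mul_le_mul_of_nonneg_left (abs_ratio_le hPi hc (he i) w)
                (propensity_nonneg _ _)
        _ = 1 / c := by rw [← Finset.sum_mul, sum_propensity, one_mul])
  rw [← hN] at h
  change |biasTerm P Pi e Z τ - (_ - _)| ≤ _ at h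
  rw [hzero, sub_zero] at h
  exact h

end Population

/-! ### Independent estimates -/

section Independence

variable {Ω α β : Type*} [MeasurableSpace Ω] [MeasurableSpace α] [MeasurableSpace β]
  {P : Measure Ω} [IsProbabilityMeasure P] {X : Ω → α} {Y : Ω → β}

/-- By independence the joint law is a product, so a joint almost sure property holds for almost
every value of X and, at that value held fixed, for almost every Y. -/
theorem ae_ae_of_indepFun (hX : Measurable X) (hY : Measurable Y) (h : IndepFun X Y P)
    {S : Set (α × β)} (hS : MeasurableSet S) (hae : ∀ᵐ ω ∂P, (X ω, Y ω) ∈ S) :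
    ∀ᵐ ω ∂P, ∀ᵐ ω' ∂P, (X ω, Y ω') ∈ S := by
  have h1 : ∀ᵐ p ∂(P.map fun ω => (X ω, Y ω)), p ∈ S :=
    (ae_map_iff (hX.prodMk hY).aemeasurable hS).2 hae
  rw [(indepFun_iff_map_prod_eq_prod_map_map hX.aemeasurable hY.aemeasurable).1 h] at h1
  have h2 := ae_of_ae_map hX.aemeasurable (Measure.ae_ae_of_ae_prod h1)
  filter_upwards [h2] with ω hω
  exact ae_of_ae_map hY.aemeasurable hω

/-- Fubini writes the probability as the integral of its sections, and the sections are at least v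
on G. Monotonicity of the outer measure is enough, so G may be any set. -/
theorem mul_measureReal_le_of_forall_mem (hX : Measurable X) (hY : Measurable Y)
    (h : IndepFun X Y P) {S : Set (α × β)} (hS : MeasurableSet S) {G : Set Ω} {v : ℝ}
    (hv : 0 ≤ v) (hG : ∀ ω ∈ G, v ≤ P.real {ω' | (X ω, Y ω') ∈ S}) :
    v * P.real G ≤ P.real {ω | (X ω, Y ω) ∈ S} := by
  have e1 : P {ω | (X ω, Y ω) ∈ S} = ∫⁻ ω, P {ω' | (X ω, Y ω') ∈ S} ∂P := by
    have : P {ω | (X ω, Y ω) ∈ S} = (P.map fun ω => (X ω, Y ω)) S :=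
      (Measure.map_apply (hX.prodMk hY) hS).symm
    rw [this, (indepFun_iff_map_prod_eq_prod_map_map hX.aemeasurable hY.aemeasurable).1 h,
      Measure.prod_apply hS, lintegral_map (measurable_measure_prodMk_left hS) hX]
    refine lintegral_congr fun ω => ?_
    rw [Measure.map_apply hY (measurable_prodMk_left hS)]
    rfl
  have hmeas : Measurable fun ω => P {ω' | (X ω, Y ω') ∈ S} := by
    have h1 := (measurable_measure_prodMk_left (ν := P.map Y) hS).comp hX
    have h2 : (fun ω => P {ω' | (X ω, Y ω') ∈ S})
        = (fun x => (P.map Y) (Prod.mk x ⁻¹' S)) ∘ X :=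
      funext fun ω => (Measure.map_apply hY (measurable_prodMk_left hS)).symm
    rw [h2]
    exact h1
  have h2 : ENNReal.ofReal v * P G ≤ P {ω | (X ω, Y ω) ∈ S} := by
    rw [e1]
    refine le_trans ?_ (mul_meas_ge_le_lintegral hmeas (ENNReal.ofReal v))
    gcongr
    intro ω hω
    exact (ENNReal.ofReal_le_iff_le_toReal (measure_ne_top _ _)).2 (hG ω hω)
  have h3 := ENNReal.toReal_mono (measure_ne_top _ _) h2
  rwa [ENNReal.toReal_mul, ENNReal.toReal_ofReal hv] at h3

end Independence

theorem integral_mul_le_sqrt_mul_sqrt {Ω : Type*} [MeasurableSpace Ω] {P : Measure Ω}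
    {f g : Ω → ℝ} (hf : Measurable f) (hg : Measurable g) (hf0 : ∀ ω, 0 ≤ f ω)
    (hg0 : ∀ ω, 0 ≤ g ω) (hf2 : Integrable (fun ω => f ω ^ 2) P)
    (hg2 : Integrable (fun ω => g ω ^ 2) P) :
    ∫ ω, f ω * g ω ∂P ≤ √(∫ ω, f ω ^ 2 ∂P) * √(∫ ω, g ω ^ 2 ∂P) := by
  have h := integral_mul_le_Lp_mul_Lq_of_nonneg (μ := P) Real.HolderConjugate.two_two
    (ae_of_all _ hf0) (ae_of_all _ hg0)
    (by simpa using (memLp_two_iff_integrable_sq hf.aestronglyMeasurable).2 hf2)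
    (by simpa using (memLp_two_iff_integrable_sq hg.aestronglyMeasurable).2 hg2)
  simpa [Real.sqrt_eq_rpow] using h

/-- At each n select a good value that violates Q if one exists, and any good value otherwise. The
hypothesis applied to this worst sequence shows that violations eventually stop, which turns a
statement about sequences into a uniform one. -/
theorem eventually_forall_of_selection {E : ℕ → Type*} [∀ n, Nonempty (E n)]
    {Good Q : (n : ℕ) → E n → Prop} (hne : ∀ᶠ n in atTop, ∃ e, Good n e)
    (h : ∀ e : (n : ℕ) → E n, (∀ᶠ n in atTop, Good n (e n)) → ∀ᶠ n in atTop, Q n (e n)) :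
    ∀ᶠ n in atTop, ∀ e, Good n e → Q n e := by
  classical
  have hex : ∀ n, ∃ e : E n, ((∃ e, Good n e) → Good n e) ∧
      (Q n e → ∀ e', Good n e' → Q n e') := by
    intro n
    by_cases hb : ∃ e, Good n e ∧ ¬ Q n e
    · obtain ⟨e, he, hq⟩ := hb
      exact ⟨e, fun _ => he, fun h => absurd h hq⟩
    · push Not at hb
      by_cases hg : ∃ e, Good n e
      · exact ⟨hg.choose, fun _ => hg.choose_spec, fun _ => hb⟩
      · exact ⟨Classical.arbitrary _, fun h => absurd h hg, fun _ => hb⟩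
  choose e he1 he2 using hex
  filter_upwards [h e (hne.mono fun n hn => he1 n hn)] with n hn
  exact he2 n hn

/-! ### Expected accuracy of the estimates -/

section Accuracy

variable {Ω : Type*} [MeasurableSpace Ω] {P : Measure Ω} [IsProbabilityMeasure P] {n T : ℕ}
  {est : Ω → Fin n → UnitEst T} {Z : Ω → Fin n → UnitData T} {ν : Fin n → Measure (UnitData T)}

theorem measurable_propErr_sq (hest : Measurable est) (i : Fin n) (w : AssignPath T) :
    Measurable fun ω => ((est ω i).1 w - propensity (ν i) w) ^ 2 :=
  ((((measurable_pi_apply w).comp measurable_fst).comp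
    ((measurable_pi_apply i).comp hest)).sub_const _).pow_const 2

/-- Independence lets W be averaged out first, with the estimates fixed, under the law π; the
indicator of each path then contributes the factor π(w). -/
theorem integral_propErr_sq (hest : Measurable est) (hZ : Measurable Z)
    (hlaw : ∀ i, P.map (fun ω => Z ω i) = ν i) (hind : IndepFun est Z P)
    (hprob : ∀ᵐ ω ∂P, ∀ i w, (est ω i).1 w ∈ Set.Icc (0 : ℝ) 1) (i : Fin n) :
    Integrable (fun ω => propErr (ν i) (est ω i) ^ 2) P ∧
    ∫ ω, propErr (ν i) (est ω i) ^ 2 ∂P = deltaPi P ν est Z i ^ 2 := by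
  classical
  have hm := fun w => measurable_propErr_sq (ν := ν) hest i w
  have hi : ∀ w, Integrable (fun ω => ((est ω i).1 w - propensity (ν i) w) ^ 2) P := fun w => by
    refine integrable_of_ae_abs_le (hm w) (K := (1 + |propensity (ν i) w|) ^ 2) ?_
    filter_upwards [hprob] with ω hω
    have h1 := hω i w
    rw [abs_pow]
    refine pow_le_pow_left₀ (abs_nonneg _) ((abs_sub _ _).trans ?_) 2
    rw [abs_of_nonneg h1.1]
    linarith [h1.2]
  have e1 : ∀ ω, propErr (ν i) (est ω i) ^ 2
      = ∑ w, propensity (ν i) w * ((est ω i).1 w - propensity (ν i) w) ^ 2 := fun ω =>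
    Real.sq_sqrt (Finset.sum_nonneg fun w _ => mul_nonneg (propensity_nonneg _ _) (sq_nonneg _))
  simp only [e1]
  refine ⟨integrable_finsetSum _ fun w _ => (hi w).const_mul _, ?_⟩
  set ind : AssignPath T → Ω → ℝ := fun w ω => if assign (Z ω i) = w then 1 else 0 with hind_def
  have hindm : ∀ w, Measurable (ind w) := fun w =>
    (measurable_comp_assign fun a => if a = w then (1 : ℝ) else 0).comp
      ((measurable_pi_apply i).comp hZ)
  have e2 : ∀ ω, ((est ω i).1 (assign (Z ω i)) - propensity (ν i) (assign (Z ω i))) ^ 2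
      = ∑ w, ind w ω * ((est ω i).1 w - propensity (ν i) w) ^ 2 := fun ω => by
    simp [hind_def]
  have hprod : ∀ w, Integrable (fun ω => ind w ω * ((est ω i).1 w - propensity (ν i) w) ^ 2) P :=
    fun w => (hi w).bdd_mul (c := 1) (hindm w).aestronglyMeasurable (ae_of_all _ fun ω => by
      simp only [hind_def]; split_ifs <;> simp)
  have hmul : ∀ w, ∫ ω, ind w ω * ((est ω i).1 w - propensity (ν i) w) ^ 2 ∂P
      = propensity (ν i) w * ∫ ω, ((est ω i).1 w - propensity (ν i) w) ^ 2 ∂P := fun w => by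
    have hI : IndepFun (ind w) (fun ω => ((est ω i).1 w - propensity (ν i) w) ^ 2) P :=
      hind.symm.comp (φ := fun z : Fin n → UnitData T => if assign (z i) = w then (1 : ℝ) else 0)
        (ψ := fun e : Fin n → UnitEst T => ((e i).1 w - propensity (ν i) w) ^ 2)
        ((measurable_comp_assign fun a => if a = w then (1 : ℝ) else 0).comp
          (measurable_pi_apply i)) (measurable_propErr_sq measurable_id i w)
    rw [hI.integral_fun_mul_eq_mul_integral (hindm w).aestronglyMeasurable
      (hm w).aestronglyMeasurable]
    congr 1
    have hs : MeasurableSet {z : UnitData T | assign z = w} :=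
      measurable_assign (measurableSet_singleton w)
    have : ind w = Set.indicator ((fun ω => Z ω i) ⁻¹' {z | assign z = w}) 1 := by
      ext ω; simp [hind_def, Set.indicator_apply]
    have hZi : Measurable fun ω => Z ω i := (measurable_pi_apply i).comp hZ
    rw [this, integral_indicator_one (hZi hs), ← map_measureReal_apply hZi hs, hlaw i]
    rfl
  rw [deltaPi, Real.sq_sqrt (integral_nonneg fun ω => sq_nonneg _)]
  simp only [e2]
  rw [integral_finsetSum _ fun w _ => hprod w, integral_finsetSum _ fun w _ => (hi w).const_mul _]
  simp only [hmul, integral_const_mul]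

/-- The root is taken inside the expectation in `outErr` and outside in `deltaY`. Squaring removes
it through (a + b)² ≤ 2a² + 2b², and 2a² + 2b² ≤ 2(a + b)² for nonnegative terms gives the factor 2.
The bound R only secures integrability and does not enter the estimate. -/
theorem integral_outErr_sq_le (hest : Measurable est) (ξ : Fin T → ℝ) {R : ℝ}
    (hR : ∀ᵐ ω ∂P, ∀ i t, |(est ω i).2 t - centeredMean ν i t| ≤ R) (i : Fin n) :
    Measurable (fun ω => outErr ν ξ (est ω) i) ∧
    Integrable (fun ω => outErr ν ξ (est ω) i ^ 2) P ∧
    ∫ ω, outErr ν ξ (est ω) i ^ 2 ∂P ≤ 2 * deltaY P ξ ν est i ^ 2 := by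
  set D := √(∑ t, (effect (ν i) t - date ξ ν) ^ 2) with hD
  have hsm : Measurable fun ω => ∑ t, ((est ω i).2 t - centeredMean ν i t) ^ 2 :=
    Finset.measurable_fun_sum _ fun t _ => ((((measurable_pi_apply t).comp measurable_snd).comp
      ((measurable_pi_apply i).comp hest)).sub_const _).pow_const 2
  have hs0 : ∀ ω, 0 ≤ ∑ t, ((est ω i).2 t - centeredMean ν i t) ^ 2 := fun ω =>
    Finset.sum_nonneg fun t _ => sq_nonneg _
  have hsi : Integrable (fun ω => ∑ t, ((est ω i).2 t - centeredMean ν i t) ^ 2) P := by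
    refine integrable_of_ae_abs_le hsm (K := ∑ _t : Fin T, R ^ 2) ?_
    filter_upwards [hR] with ω hω
    rw [abs_of_nonneg (hs0 ω)]
    refine Finset.sum_le_sum fun t _ => ?_
    rw [← sq_abs]
    exact pow_le_pow_left₀ (abs_nonneg _) (hω i t) 2
  have hm : Measurable fun ω => outErr ν ξ (est ω) i := hsm.sqrt.add_const _
  have hle : ∀ ω, outErr ν ξ (est ω) i ^ 2
      ≤ 2 * (∑ t, ((est ω i).2 t - centeredMean ν i t) ^ 2) + 2 * D ^ 2 := fun ω => by
    rw [outErr, ← hD]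
    nlinarith [Real.sq_sqrt (hs0 ω), sq_nonneg
      (√(∑ t, ((est ω i).2 t - centeredMean ν i t) ^ 2) - D)]
  have hbi : Integrable (fun ω =>
      2 * (∑ t, ((est ω i).2 t - centeredMean ν i t) ^ 2) + 2 * D ^ 2) P :=
    (hsi.const_mul 2).add (integrable_const _)
  have hi : Integrable (fun ω => outErr ν ξ (est ω) i ^ 2) P :=
    hbi.mono' (hm.pow_const 2).aestronglyMeasurable (ae_of_all _ fun ω => by
      rw [Real.norm_eq_abs, abs_of_nonneg (sq_nonneg _)]; exact hle ω)
  refine ⟨hm, hi, (integral_mono hi hbi hle).trans ?_⟩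
  rw [integral_add (hsi.const_mul 2) (integrable_const _), integral_const_mul, deltaY, ← hD]
  have h0 : 0 ≤ ∫ ω, ∑ t, ((est ω i).2 t - centeredMean ν i t) ^ 2 ∂P := integral_nonneg hs0
  have h1 := Real.sqrt_nonneg (∫ ω, ∑ t, ((est ω i).2 t - centeredMean ν i t) ^ 2 ∂P)
  have h2 : 0 ≤ D := Real.sqrt_nonneg _
  simp only [integral_const, probReal_univ, one_smul]
  nlinarith [Real.sq_sqrt h0, mul_nonneg h1 h2]

/-- The expected product of the two root mean square errors is at most a constant times the product
of the rates. -/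
theorem integral_errors_le (hest : Measurable est) (hZ : Measurable Z)
    (hlaw : ∀ i, P.map (fun ω => Z ω i) = ν i) (hind : IndepFun est Z P)
    (hprob : ∀ᵐ ω ∂P, ∀ i w, (est ω i).1 w ∈ Set.Icc (0 : ℝ) 1) (ξ : Fin T → ℝ) {R : ℝ}
    (hR : ∀ᵐ ω ∂P, ∀ i t, |(est ω i).2 t - centeredMean ν i t| ≤ R) :
    Integrable (fun ω => √(avg fun i => propErr (ν i) (est ω i) ^ 2)
      * √(avg fun i => outErr ν ξ (est ω) i ^ 2)) P ∧
    ∫ ω, √(avg fun i => propErr (ν i) (est ω i) ^ 2)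
        * √(avg fun i => outErr ν ξ (est ω) i ^ 2) ∂P
      ≤ √2 * (rootMeanSq (deltaPi P ν est Z) * rootMeanSq (deltaY P ξ ν est)) := by
  have hp := integral_propErr_sq hest hZ hlaw hind hprob
  have ho := integral_outErr_sq_le (P := P) hest ξ hR
  have hpm : ∀ i, Measurable fun ω => propErr (ν i) (est ω i) ^ 2 := fun i =>
    ((Finset.measurable_fun_sum _ fun w _ =>
      (measurable_propErr_sq hest i w).const_mul _).sqrt).pow_const 2
  have m1 : Measurable fun ω => √(avg fun i => propErr (ν i) (est ω i) ^ 2) :=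
    (measurable_avg hpm).sqrt
  have m2 : Measurable fun ω => √(avg fun i => outErr ν ξ (est ω) i ^ 2) :=
    (measurable_avg fun i => (ho i).1.pow_const 2).sqrt
  have s1 : ∀ ω, √(avg fun i => propErr (ν i) (est ω i) ^ 2) ^ 2
      = avg fun i => propErr (ν i) (est ω i) ^ 2 := fun ω =>
    Real.sq_sqrt (avg_nonneg fun i => sq_nonneg _)
  have s2 : ∀ ω, √(avg fun i => outErr ν ξ (est ω) i ^ 2) ^ 2
      = avg fun i => outErr ν ξ (est ω) i ^ 2 := fun ω =>
    Real.sq_sqrt (avg_nonneg fun i => sq_nonneg _)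
  have i1 : Integrable (fun ω => √(avg fun i => propErr (ν i) (est ω i) ^ 2) ^ 2) P := by
    simp only [s1]; exact integrable_avg fun i => (hp i).1
  have i2 : Integrable (fun ω => √(avg fun i => outErr ν ξ (est ω) i ^ 2) ^ 2) P := by
    simp only [s2]; exact integrable_avg fun i => (ho i).2.1
  refine ⟨MemLp.integrable_mul ((memLp_two_iff_integrable_sq m1.aestronglyMeasurable).2 i1)
    ((memLp_two_iff_integrable_sq m2.aestronglyMeasurable).2 i2), ?_⟩
  refine (integral_mul_le_sqrt_mul_sqrt m1 m2 (fun _ => Real.sqrt_nonneg _)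
    (fun _ => Real.sqrt_nonneg _) i1 i2).trans ?_
  simp only [s1, s2]
  rw [integral_avg fun i => (hp i).1, integral_avg fun i => (ho i).2.1]
  have h1 : avg (fun i => ∫ ω, propErr (ν i) (est ω i) ^ 2 ∂P)
      = avg fun i => deltaPi P ν est Z i ^ 2 := by
    congr 1; ext i; exact (hp i).2
  have h2 : avg (fun i => ∫ ω, outErr ν ξ (est ω) i ^ 2 ∂P)
      ≤ 2 * avg fun i => deltaY P ξ ν est i ^ 2 := by
    rw [← avg_const_mul]; exact avg_mono fun i => (ho i).2.2
  calc _ ≤ √(avg fun i => deltaPi P ν est Z i ^ 2) * √(2 * avg fun i => deltaY P ξ ν est i ^ 2) := by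
        rw [h1]; gcongr
    _ = _ := by
        rw [Real.sqrt_mul zero_le_two]
        change _ = √2 * (√(avg _) * √(avg _))
        ring

end Accuracy

/-! ### Admissible values of the estimates -/

theorem measurableSet_bounded {T : ℕ} (m : Fin T → ℝ) (M : ℝ) :
    MeasurableSet {z : UnitData T | ∀ t b, |potential b z t - m t| < M} := by
  simp only [Set.ofPred_forall]
  exact MeasurableSet.iInter fun t => MeasurableSet.iInter fun b =>
    measurableSet_lt ((measurable_potential b t).sub_const _).abs measurable_const

section Bounded

variable {T : ℕ} {ν : Measure (UnitData T)} [IsProbabilityMeasure ν] {m : Fin T → ℝ} {M : ℝ}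

theorem integrable_potential (h : ∀ᵐ z ∂ν, ∀ t b, |potential b z t - m t| < M) (b : Bool)
    (t : Fin T) : Integrable (fun z => potential b z t) ν := by
  refine integrable_of_ae_abs_le (measurable_potential b t) (K := M + |m t|) ?_
  filter_upwards [h] with z hz
  have := abs_add_le (potential b z t - m t) (m t)
  rw [sub_add_cancel] at this
  linarith [hz t b]

theorem abs_effect_le (h : ∀ᵐ z ∂ν, ∀ t b, |potential b z t - m t| < M) (t : Fin T) :
    |effect ν t| ≤ 2 * M := by
  refine abs_integral_le_of_ae_abs_le ?_
  filter_upwards [h] with z hz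
  have := abs_sub (potential true z t - m t) (potential false z t - m t)
  rw [sub_sub_sub_cancel_right] at this
  linarith [hz t true, hz t false]

theorem abs_sub_baseMean_le (h : ∀ᵐ z ∂ν, ∀ t b, |potential b z t - m t| < M) (t : Fin T) :
    |m t - baseMean ν t| ≤ M := by
  have e : baseMean ν t - m t = ∫ z, (potential false z t - m t) ∂ν := by
    rw [integral_sub (integrable_potential h false t) (integrable_const _)]
    simp [baseMean]
  rw [abs_sub_comm, e]
  refine abs_integral_le_of_ae_abs_le ?_
  filter_upwards [h] with z hz
  exact (hz t false).le

end Bounded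

theorem abs_date_le {n T : ℕ} (hn : 0 < n) {ξ : Fin T → ℝ} (hξ0 : ∀ t, 0 ≤ ξ t)
    (hξ : ∑ t, ξ t = 1) {ν : Fin n → Measure (UnitData T)} {K : ℝ}
    (h : ∀ i t, |effect (ν i) t| ≤ K) : |date ξ ν| ≤ K := by
  refine (Finset.abs_sum_le_sum_abs _ _).trans ?_
  calc _ ≤ ∑ t, ξ t * K := Finset.sum_le_sum fun t _ => by
        rw [abs_mul, abs_of_nonneg (hξ0 t)]
        exact mul_le_mul_of_nonneg_left (abs_avg_le hn fun i => h i t) (hξ0 t)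
    _ = K := by rw [← Finset.sum_mul, hξ, one_mul]

/-- The constant is a sum of the separate bounds: 1/c for the weight, 2 for the demeaned path, 6M =
2(M + 2M) for the residual, 12TM for their product, and 4T for the squared path. -/
theorem unitBounds_of_bounded {Ω : Type*} {n T : ℕ} {Pi : AssignPath T → ℝ}
    {S : Finset (AssignPath T)} (hPi : IsReshaped Pi S) {e : Fin n → UnitEst T}
    {Z : Ω → Fin n → UnitData T} {τ c M : ℝ} (hc : 0 < c) (hM : 0 < M)
    (he : ∀ i, ∀ w ∈ S, c < (e i).1 w) (hτ : |τ| ≤ 2 * M) {ω : Ω}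
    (h : ∀ i t b, |potential b (Z ω i) t - (e i).2 t| < M) :
    UnitBounds Pi e Z τ (2 + 1 / c + 6 * M + 12 * T * M + 4 * T) ω := by
  have hT : (0 : ℝ) ≤ T := Nat.cast_nonneg _
  have hTM : 0 ≤ T * M := mul_nonneg hT hM.le
  have hc' : 0 < 1 / c := one_div_pos.2 hc
  have hr : ∀ i t, |residual τ (e i) (Z ω i) t| ≤ 6 * M := fun i t =>
    (abs_residual_le (h i) hτ t).trans (by linarith)
  refine ⟨fun i => ?_, fun i t => ?_, fun i t => ?_, fun i => ?_, fun i => ?_⟩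
  · exact (abs_ratio_le hPi hc (he i) _).trans (by linarith)
  · exact (abs_demeaned_le _ t).trans (by linarith)
  · exact (hr i t).trans (by linarith)
  · exact (abs_dotProduct_le (abs_demeaned_le _) (hr i)).trans (by linarith)
  · exact (abs_dotProduct_le (abs_demeaned_le _) (abs_demeaned_le _)).trans (by linarith)

/-- Values of the estimates at which all almost sure assumptions hold. -/
structure Admissible {Ω : Type*} [MeasurableSpace Ω] (P : Measure Ω) {n T : ℕ}
    (Pi : AssignPath T → ℝ) (S : Finset (AssignPath T)) (c M ν₀ τ : ℝ)
    (Z : Ω → Fin n → UnitData T) (e : Fin n → UnitEst T) : Prop where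
  le_one : ∀ i w, (e i).1 w ≤ 1
  overlap : ∀ i, ∀ w ∈ S, c < (e i).1 w
  bounded : ∀ᵐ ω ∂P, ∀ i t b, |potential b (Z ω i) t - (e i).2 t| < M
  variance_le : ν₀ ≤ avg fun i => variance (oracleScore P Pi e Z τ i) P

/-- The product of the root mean square errors of the estimates. -/
noncomputable def errProd {n T : ℕ} (ν : Fin n → Measure (UnitData T)) (ξ : Fin T → ℝ)
    (e : Fin n → UnitEst T) : ℝ :=
  √(avg fun i => propErr (ν i) (e i) ^ 2) * √(avg fun i => outErr ν ξ e i ^ 2)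

section Single

variable {Ω : Type*} [MeasurableSpace Ω] {P : Measure Ω} {n T : ℕ}
  {Pi : AssignPath T → ℝ} {S : Finset (AssignPath T)} {c M ν₀ τ : ℝ} {Z : Ω → Fin n → UnitData T}
  {e : Fin n → UnitEst T} {ν : Fin n → Measure (UnitData T)}

theorem Admissible.ae_unit (h : Admissible P Pi S c M ν₀ τ Z e) (hZ : Measurable Z)
    (hlaw : ∀ i, P.map (fun ω => Z ω i) = ν i) (i : Fin n) :
    ∀ᵐ z ∂(ν i), ∀ t b, |potential b z t - (e i).2 t| < M := by
  rw [← hlaw i]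
  refine (ae_map_iff ((measurable_pi_apply i).comp hZ).aemeasurable
    (measurableSet_bounded _ M)).2 ?_
  filter_upwards [h.bounded] with ω hω
  exact hω i

theorem Admissible.unitBounds {ξ : Fin T → ℝ} [∀ i, IsProbabilityMeasure (ν i)]
    (h : Admissible P Pi S c M ν₀ (date ξ ν) Z e) (hn : 0 < n) (hZ : Measurable Z)
    (hlaw : ∀ i, P.map (fun ω => Z ω i) = ν i) (hPi : IsReshaped Pi S) (hc : 0 < c) (hM : 0 < M)
    (hξ0 : ∀ t, 0 ≤ ξ t) (hξ : ∑ t, ξ t = 1) :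
    ∀ᵐ ω ∂P, UnitBounds Pi e Z (date ξ ν) (2 + 1 / c + 6 * M + 12 * T * M + 4 * T) ω := by
  filter_upwards [h.bounded] with ω hω
  exact unitBounds_of_bounded hPi hc hM h.overlap
    (abs_date_le hn hξ0 hξ fun i t => abs_effect_le (h.ae_unit hZ hlaw i) t) hω

variable [IsProbabilityMeasure P] {est : Ω → Fin n → UnitEst T}

/-- The boundedness assumption concerns estimates and data jointly; independence converts it into
boundedness of the data for almost every fixed value of the estimates. -/
theorem ae_admissible (hest : Measurable est) (hZ : Measurable Z) (hind : IndepFun est Z P)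
    (hprob : ∀ᵐ ω ∂P, ∀ i w, (est ω i).1 w ∈ Set.Icc (0 : ℝ) 1)
    (hov : ∀ᵐ ω ∂P, ∀ i, ∀ w ∈ S, c < (est ω i).1 w)
    (hbdd : ∀ᵐ ω ∂P, ∀ i t b, |potential b (Z ω i) t - (est ω i).2 t| < M)
    (hvar : ∀ᵐ ω ∂P, ν₀ ≤ avg fun i => variance (oracleScore P Pi (est ω) Z τ i) P) :
    ∀ᵐ ω ∂P, Admissible P Pi S c M ν₀ τ Z (est ω) := by
  have hS : MeasurableSet {x : (Fin n → UnitEst T) × (Fin n → UnitData T) |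
      ∀ i t b, |potential b (x.2 i) t - (x.1 i).2 t| < M} := by
    simp only [Set.ofPred_forall]
    refine MeasurableSet.iInter fun i => MeasurableSet.iInter fun t => MeasurableSet.iInter fun b =>
      measurableSet_lt (Measurable.abs (Measurable.sub ?_ ?_)) measurable_const
    · exact (measurable_potential b t).comp ((measurable_pi_apply i).comp measurable_snd)
    · exact (measurable_pi_apply t).comp
        (measurable_snd.comp ((measurable_pi_apply i).comp measurable_fst))
  filter_upwards [hprob, hov, ae_ae_of_indepFun hest hZ hind hS hbdd, hvar] with ω h1 h2 h3 h4
  exact ⟨fun i w => (h1 i w).2, h2, h3, h4⟩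

/-- With large probability the estimates take admissible values with a small product of errors. -/
theorem one_sub_le_measureReal_admissible (hn : 0 < n) (hest : Measurable est) (hZ : Measurable Z)
    (hlaw : ∀ i, P.map (fun ω => Z ω i) = ν i) [∀ i, IsProbabilityMeasure (ν i)]
    (hind : IndepFun est Z P)
    (hprob : ∀ᵐ ω ∂P, ∀ i w, (est ω i).1 w ∈ Set.Icc (0 : ℝ) 1) (ξ : Fin T → ℝ)
    (had : ∀ᵐ ω ∂P, Admissible P Pi S c M ν₀ τ Z (est ω)) {β : ℝ}
    (hβ : √(n : ℝ) * (√2 * (rootMeanSq (deltaPi P ν est Z) * rootMeanSq (deltaY P ξ ν est))) = β) :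
    1 - √β ≤ P.real {ω | Admissible P Pi S c M ν₀ τ Z (est ω) ∧
      √(n : ℝ) * errProd ν ξ (est ω) < √β + 1 / n} := by
  have hR : ∀ᵐ ω ∂P, ∀ i t, |(est ω i).2 t - centeredMean ν i t|
      ≤ M + ∑ i, ∑ t, |baseMean (ν i) t - centeredMean ν i t| := by
    filter_upwards [had] with ω hω i t
    have h1 := abs_sub_baseMean_le (hω.ae_unit hZ hlaw i) t
    have h2 := abs_sub_le ((est ω i).2 t) (baseMean (ν i) t) (centeredMean ν i t)
    have h3 : |baseMean (ν i) t - centeredMean ν i t|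
        ≤ ∑ i, ∑ t, |baseMean (ν i) t - centeredMean ν i t| :=
      (Finset.single_le_sum (f := fun t => |baseMean (ν i) t - centeredMean ν i t|)
        (fun t _ => abs_nonneg _) (Finset.mem_univ t)).trans
        (Finset.single_le_sum (f := fun i => ∑ t, |baseMean (ν i) t - centeredMean ν i t|)
        (fun i _ => Finset.sum_nonneg fun t _ => abs_nonneg _) (Finset.mem_univ i))
    linarith
  obtain ⟨hi, hle⟩ := integral_errors_le hest hZ hlaw hind hprob ξ hR
  set X : Ω → ℝ := fun ω => √(n : ℝ) * errProd ν ξ (est ω) with hX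
  have hXi : Integrable X P := hi.const_mul _
  have hX0 : ∀ ω, 0 ≤ X ω := fun ω =>
    mul_nonneg (Real.sqrt_nonneg _) (mul_nonneg (Real.sqrt_nonneg _) (Real.sqrt_nonneg _))
  have hXle : ∫ ω, X ω ∂P ≤ β := by
    rw [hX, integral_const_mul, ← hβ]
    exact mul_le_mul_of_nonneg_left hle (Real.sqrt_nonneg _)
  have hβ0 : 0 ≤ β := (integral_nonneg hX0).trans hXle
  -- Markov's inequality at a threshold near √β leaves an exceptional probability of at most √β; the
  -- term 1/n keeps the threshold positive when β = 0.
  set s := √β + 1 / (n : ℝ) with hs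
  have hn' : (0 : ℝ) < 1 / n := one_div_pos.2 (by exact_mod_cast hn)
  have hspos : 0 < s := add_pos_of_nonneg_of_pos (Real.sqrt_nonneg _) hn'
  have hmk := (mul_meas_ge_le_integral_of_nonneg (ae_of_all _ hX0) hXi s).trans hXle
  have hsmall : P.real {ω | s ≤ X ω} ≤ √β := by
    refine le_of_mul_le_mul_left (hmk.trans ?_) hspos
    nlinarith [Real.sq_sqrt hβ0, Real.sqrt_nonneg β]
  set G := {ω | Admissible P Pi S c M ν₀ τ Z (est ω) ∧ X ω < s}
  have hcompl : P.real Gᶜ ≤ P.real {ω | s ≤ X ω} := by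
    refine ENNReal.toReal_mono (measure_ne_top _ _) (measure_mono_ae ?_)
    filter_upwards [had] with ω hω hG
    exact not_lt.1 fun hlt => hG ⟨hω, hlt⟩
  have hun : 1 ≤ P.real G + P.real Gᶜ := by
    have := measureReal_union_le (μ := P) G Gᶜ
    rwa [Set.union_compl_self, probReal_univ] at this
  linarith

end Single

theorem IsRIPWEstimate.eq_closedForm {n T : ℕ} (hT : 0 < T) (hn : 0 < n) {Pi : AssignPath T → ℝ}
    {e : Fin n → UnitEst T} {z : Fin n → UnitData T} {τ : ℝ} (h : IsRIPWEstimate Pi e z τ)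
    (hd : denom Pi e z ≠ 0) : τ = closedForm Pi e z := by
  rw [closedForm, ← h.denom_mul hT hn, mul_div_cancel_right₀ _ hd]

end RIPW

open RIPW

/-! ### Assembly: random estimates and the limit inferior -/

theorem mainTheorem6
    {T : ℕ} {𝒳 𝒰 : Type*} [MeasurableSpace 𝒳] [MeasurableSpace 𝒰]
    -- conditional law of `(Y(1), Y(0), W)` given the confounders, common to all units
    (κ : Kernel ((Fin T → 𝒳) × (Fin T → 𝒰)) (UnitData T)) [IsMarkovKernel κ]
    -- for each sample size, the (fixed) values of the confounders of the `n` units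
    (x : (n : ℕ) → Fin n → Fin T → 𝒳) (u : (n : ℕ) → Fin n → Fin T → 𝒰)
    -- `P n` is probability given these confounders: the units are independent, unit `i` having
    -- law `κ (x n i, u n i)`
    {Ω : ℕ → Type*} [∀ n, MeasurableSpace (Ω n)]
    (P : (n : ℕ) → Measure (Ω n)) [∀ n, IsProbabilityMeasure (P n)]
    (Z : (n : ℕ) → Ω n → Fin n → UnitData T)
    (hZ_meas : ∀ n, Measurable (Z n))
    (hZ_law : ∀ n i, (P n).map (fun ω => Z n ω i) = κ (x n i, u n i))
    (hZ_indep : ∀ n, iIndepFun (fun (i : Fin n) ω => Z n ω i) (P n))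
    -- estimates `(π̂_i, m̂_i)`, `i ≤ n`, independent of the data
    (est : (n : ℕ) → Ω n → Fin n → UnitEst T) (hest_meas : ∀ n, Measurable (est n))
    (hest_indep : ∀ n, IndepFun (est n) (Z n) (P n))
    (hest_prob : ∀ n, ∀ᵐ ω ∂(P n), ∀ (i : Fin n) (w : AssignPath T),
      (est n ω i).1 w ∈ Set.Icc (0 : ℝ) 1)
    -- latent mean ignorability
    (h_ign : ∀ n i, LatentMeanIgnorable (κ (x n i, u n i)))
    -- overlap
    (c : ℝ) (hc : 0 < c) (S : Finset (AssignPath T)) (hS_card : 2 ≤ S.card)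
    (hS_nonconst : ∃ w ∈ S, w ≠ (fun _ => false) ∧ w ≠ (fun _ => true))
    (h_overlap : ∀ n i, ∀ w ∈ S, c < propensity (κ (x n i, u n i)) w)
    (h_overlap_est : ∀ n, ∀ᵐ ω ∂(P n), ∀ i, ∀ w ∈ S, c < (est n ω i).1 w)
    -- bounded adjusted potential outcomes
    (M : ℝ)
    (h_bdd : ∀ n, ∀ᵐ ω ∂(P n), ∀ (i : Fin n) (t : Fin T) (b : Bool),
      |potential b (Z n ω i) t - (est n ω i).2 t| < M)
    -- time weights, and a reshaped distribution with support `S` that solves the DATE equation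
    (ξ : Fin T → ℝ) (hξ_nonneg : ∀ t, 0 ≤ ξ t) (hξ_sum : ∑ t, ξ t = 1)
    (Pi : AssignPath T → ℝ) (hPi : IsReshaped Pi S) (hPi_date : DateEquation Pi ξ)
    -- product rate of the estimates
    (h_rate : (fun n : ℕ =>
        rootMeanSq (deltaPi (P n) (fun i => κ (x n i, u n i)) (est n) (Z n)) *
        rootMeanSq (deltaY (P n) ξ (fun i => κ (x n i, u n i)) (est n)))
      =o[atTop] fun n : ℕ => 1 / √(n : ℝ))
    -- lower bound on the average variance of `V_i` (given the estimates)
    (ν₀ : ℝ) (hν₀ : 0 < ν₀)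
    (h_var : ∀ᶠ n : ℕ in atTop, ∀ᵐ ω ∂(P n),
      ν₀ ≤ (1 / (n : ℝ)) * ∑ i : Fin n,
        variance (oracleScore (P n) Pi (est n ω) (Z n)
          (date ξ fun j => κ (x n j, u n j)) i) (P n))
    -- the reshaped IPW estimator
    (τhat : (n : ℕ) → Ω n → ℝ)
    (hτhat : ∀ n, ∀ᵐ ω ∂(P n), IsRIPWEstimate Pi (est n ω) (Z n ω) (τhat n ω))
    -- the level
    (α : ℝ) (hα : α ∈ Set.Ioo (0 : ℝ) 1) :
    1 - α ≤ liminf (fun n : ℕ => (P n).real {ω |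
      date ξ (fun i => κ (x n i, u n i)) ∈
        waldInterval Pi (est n ω) (Z n ω) (τhat n ω) α}) atTop := by
  set ν : (n : ℕ) → Fin n → Measure (UnitData T) := fun n i => κ (x n i, u n i) with hν
  have hνp : ∀ n i, IsProbabilityMeasure (ν n i) := fun n i => by rw [hν]; infer_instance
  have hT : 0 < T := by
    obtain ⟨w, _, h0, _⟩ := hS_nonconst
    rcases Nat.eq_zero_or_pos T with rfl | h
    · exact absurd (funext fun i => i.elim0) h0
    · exact h
  -- A strict bound on an absolute value, read off at sample size 1 where there is a unit.
  have hM : 0 < M := by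
    obtain ⟨ω, hω⟩ := (h_bdd 1).exists
    exact (abs_nonneg _).trans_lt (hω 0 ⟨0, hT⟩ true)
  set β : ℕ → ℝ := fun n => √(n : ℝ) * (√2 * (rootMeanSq (deltaPi (P n) (ν n) (est n) (Z n)) *
    rootMeanSq (deltaY (P n) ξ (ν n) (est n)))) with hβ
  have hβ0 : Tendsto (fun n => √(β n)) atTop (nhds 0) := by
    have h1 := (isLittleO_iff_tendsto' (by
      filter_upwards [eventually_gt_atTop 0] with n hn h0
      have : (0 : ℝ) < 1 / √(n : ℝ) := one_div_pos.2 (Real.sqrt_pos.2 (by exact_mod_cast hn))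
      exact absurd h0 this.ne')).1 h_rate
    have h2 : Tendsto β atTop (nhds 0) := by
      have h3 := h1.const_mul (√2)
      rw [mul_zero] at h3
      refine h3.congr fun n => ?_
      rw [div_div_eq_mul_div, div_one, hβ]
      ring
    simpa using h2.sqrt
  set s : ℕ → ℝ := fun n => √(β n) + 1 / n with hs
  have hs0 : Tendsto s atTop (nhds 0) := by
    simpa [hs] using hβ0.add (tendsto_const_div_atTop_nhds_zero_nat (1 : ℝ))
  set Good : (n : ℕ) → (Fin n → UnitEst T) → Prop := fun n e =>
    Admissible (P n) Pi S c M ν₀ (date ξ (ν n)) (Z n) e ∧ √(n : ℝ) * errProd (ν n) ξ e < s n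
    with hGood
  have hprobGood : ∀ᶠ n in atTop, 1 - √(β n) ≤ (P n).real {ω | Good n (est n ω)} := by
    filter_upwards [h_var, eventually_gt_atTop 0] with n hn hn0
    exact one_sub_le_measureReal_admissible hn0 (hest_meas n) (hZ_meas n) (hZ_law n)
      (hest_indep n) (hest_prob n) ξ (ae_admissible (hest_meas n) (hZ_meas n) (hest_indep n)
        (hest_prob n) (h_overlap_est n) (h_bdd n) hn) rfl
  have hne : ∀ᶠ n in atTop, ∃ e, Good n e := by
    filter_upwards [hprobGood, hβ0.eventually_lt_const one_pos] with n hn h1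
    have hpos : 0 < (P n).real {ω | Good n (est n ω)} := by linarith
    have hnn : {ω | Good n (est n ω)}.Nonempty := by
      by_contra hemp
      rw [Set.not_nonempty_iff_eq_empty.1 hemp] at hpos
      simp at hpos
    obtain ⟨ω, hω⟩ := hnn
    exact ⟨_, hω⟩
  set L : ℝ := 2 + 1 / c + 6 * M + 12 * T * M + 4 * T with hLdef
  have hL : 1 ≤ L := by
    have : 0 < 1 / c := one_div_pos.2 hc
    have : 0 ≤ 12 * T * M := by positivity
    have : (0 : ℝ) ≤ T := Nat.cast_nonneg _
    linarith
  have hcover : ∀ ε > 0, ∀ᶠ n in atTop, ∀ e, Good n e →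
      1 - α - ε ≤ (P n).real {ω | (e, Z n ω) ∈ coverSet n Pi (date ξ (ν n)) α} := by
    intro ε hε
    -- The asymptotic results concern deterministic sequences of estimates; selection makes them
    -- uniform over the good values at each n.
    refine eventually_forall_of_selection hne fun e he => ?_
    have hb : ∀ᶠ n in atTop, ∀ᵐ ω ∂(P n), UnitBounds Pi (e n) (Z n) (date ξ (ν n)) L ω := by
      filter_upwards [he, eventually_gt_atTop 0] with n hn hn0
      exact hn.1.unitBounds hn0 (hZ_meas n) (hZ_law n) hPi hc hM hξ_nonneg hξ_sum
    refine eventually_le_cover_fixed hT P hZ_meas hZ_indep hL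
      (mul_pos (pow_pos hc 2) (pathSpread_pos hPi hS_card hS_nonconst)) hν₀ hb ?_
      (he.mono fun n hn => hn.1.variance_le) ?_ hα hε
    · filter_upwards [he, hb, eventually_gt_atTop 0] with n hn hbn hn0
      exact le_meanDenom hT hn0 (hZ_meas n) (hZ_law n) hL hbn hPi hc (h_overlap n) hn.1.overlap
        hn.1.le_one
    · set C : ℝ := Fintype.card (AssignPath T) * (1 / (c * √c)) * (8 * T * (1 / c + 1))
      have hC : 0 ≤ C := by positivity
      refine squeeze_zero' (Eventually.of_forall fun n => by positivity) ?_
        (by simpa using hs0.const_mul C)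
      filter_upwards [he, hb, eventually_gt_atTop 0] with n hn hbn hn0
      have h1 := abs_biasTerm_le hT hn0 (hZ_meas n) (hZ_law n) hξ_sum hL hbn hPi hPi_date hc
        (h_overlap n) hn.1.overlap (h_ign n)
        fun i b t => integrable_potential (hn.1.ae_unit (hZ_meas n) (hZ_law n) i) b t
      calc √(n : ℝ) * |biasTerm (P n) Pi (e n) (Z n) (date ξ (ν n))|
          ≤ √(n : ℝ) * (C * errProd (ν n) ξ (e n)) :=
            mul_le_mul_of_nonneg_left h1 (Real.sqrt_nonneg _)
        _ = C * (√(n : ℝ) * errProd (ν n) ξ (e n)) := by ring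
        _ ≤ C * s n := mul_le_mul_of_nonneg_left hn.2.le hC
  refine le_of_forall_pos_sub_le fun ε hε => ?_
  refine le_liminf_of_le (isCoboundedUnder_ge_of_le atTop (x := 1) fun n => measureReal_le_one) ?_
  -- The product bound below needs a nonnegative section probability; otherwise the target is
  -- negative and the claim trivial.
  rcases lt_or_ge (1 - α - ε / 2) 0 with hv | hv
  · exact Eventually.of_forall fun n => le_trans (by linarith) measureReal_nonneg
  filter_upwards [hcover (ε / 2) (by linarith), hprobGood,
    hβ0.eventually_lt_const (half_pos hε), eventually_gt_atTop 0] with n h1 h2 h3 hn0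
  have h4 := mul_measureReal_le_of_forall_mem (hest_meas n) (hZ_meas n) (hest_indep n)
    (measurableSet_coverSet Pi hT (date ξ (ν n)) α) (G := {ω | Good n (est n ω)}) hv
    fun ω hω => h1 _ hω
  have h5 : (P n).real {ω | (est n ω, Z n ω) ∈ coverSet n Pi (date ξ (ν n)) α}
      ≤ (P n).real {ω | date ξ (ν n) ∈ waldInterval Pi (est n ω) (Z n ω) (τhat n ω) α} := by
    refine ENNReal.toReal_mono (measure_ne_top _ _) (measure_mono_ae ?_)
    filter_upwards [hτhat n] with ω hω hmem
    -- Positivity of the denominator, part of the covering event, makes the treatment coefficient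
    -- unique, so any minimizer agrees with the closed form there.
    have := hω.eq_closedForm hT hn0 hmem.1.ne'
    change date ξ (ν n) ∈ waldInterval Pi (est n ω) (Z n ω) (τhat n ω) α
    rw [this]
    exact hmem.2
  have h6 : (1 - α - ε / 2) * (1 - ε / 2)
      ≤ (1 - α - ε / 2) * (P n).real {ω | Good n (est n ω)} :=
    mul_le_mul_of_nonneg_left (by linarith) hv
  nlinarith [hα.1]
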